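/- Let $M$ be a smooth finite-dimensional manifold (Hausdorff, second countable, without boundary) and let $(\Lambda,E)$ be a Jacobi structure on $M$: a bivector field $\Lambda$ and a vector field $E$ such that $\{f,h\}=\Lambda(df,dh)+f\,E(h)-h\,E(f)$ satisfies the Jacobi identity on $C^\infty(M)$. Let $\mathcal N:TM\times\mathbb R\to TM\times\mathbb R$ be a $C^\infty(M)$-linear map, $\mathcal N(X,f)=(NX+fY,\ \gamma(X)+fg)$, with $N$ a $(1,1)$-tensor field, $Y\in\mathfrak X(M)$, $\gamma\in\Omega^1(M)$, $g\in C^\infty(M)$, and let $\omega\in\Omega^2(M)$. **Conventions.** $TM\times\mathbb R$ is the Lie algebroid with anchor $\rho(X,f)=X$ and bracket $[(X,f),(Z,h)]=([X,Z],X(h)-Z(f))$; $\phi=(0,1)$ is the $1$-cocycle $\langle\phi,(X,f)\rangle=f$; $d^{\phi}\alpha=d\alpha+\phi\wedge\alpha$ and $\mathcal L^\phi_x=\mathcal L_x+\langle\phi,x\rangle$. The section $(d\omega,\omega)$ of $\wedge^3(T^*M\times\mathbb R)$ is $$(d\omega,\omega)\big((X_1,f_1),(X_2,f_2),(X_3,f_3)\big)=d\omega(X_1,X_2,X_3)+f_1\,\omega(X_2,X_3)-f_2\,\omega(X_1,X_3)+f_3\,\omega(X_1,X_2).$$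 Put $\langle\beta,\Lambda^\sharp\alpha\rangle=\Lambda(\alpha,\beta)$ and $\pi^\sharp(\alpha,f)=(\Lambda,E)^\sharp(\alpha,f)=(\Lambda^\sharp\alpha+fE,\,-\alpha(E))$. For a $C^\infty(M)$-linear map $S$ from sections of $T^*M\times\mathbb R$ to sections of $TM\times\mathbb R$ put $$[\alpha,\beta]_{S}=\mathcal L^\phi_{S\alpha}\beta-\mathcal L^\phi_{S\beta}\alpha-d^\phi\langle\beta,S\alpha\rangle .$$ Then $(T^*M\times\mathbb R)_{(\Lambda,E)}$ is $T^*M\times\mathbb R$ with bracket $[\cdot,\cdot]_{\pi^\sharp}$ and anchor $\rho\circ\pi^\sharp$. Let $[x,y]_{\mathcal N}=[\mathcal Nx,y]+[x,\mathcal Ny]-\mathcal N[x,y]$ and $\mathcal T_{\mathcal N}(x,y)=[\mathcal Nx,\mathcal Ny]-\mathcal N[x,y]_{\mathcal N}$; let $d_{\mathcal N}$ be given by the Cartan formula with bracket $[\cdot,\cdot]_{\mathcal N}$ and anchor $\rho\circ\mathcal N$, and $d_{\mathcal N}^{(\gamma,g)}P=d_{\mathcal N}P+(\gamma,g)\wedge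 P$. **Jacobi quasi-Nijenhuis manifold.** $(M,(\Lambda,E),\mathcal N,\omega)$ is a Jacobi quasi-Nijenhuis manifold if * $\mathcal N$ is compatible with $(\Lambda,E)$: $\mathcal N\pi^\sharp=\pi^\sharp\mathcal N^*$ and $[\alpha,\beta]_{\mathcal N\pi^\sharp}=[\mathcal N^*\alpha,\beta]_{\pi^\sharp}+[\alpha,\mathcal N^*\beta]_{\pi^\sharp}-\mathcal N^*[\alpha,\beta]_{\pi^\sharp}$ for all $\alpha,\beta$; * $\mathcal T_{\mathcal N}(x,y)=-\pi^\sharp\big(i_{x\wedge y}(d\omega,\omega)\big)$ for all sections $x,y$, where $i_{x\wedge y}=i_x i_y$, i.e. $(i_{x\wedge y}\eta)(z)=\eta(y,x,z)$; * $d^{(0,1)}\big(i_{\mathcal N}(d\omega,\omega)\big)=0$, where $i_{\mathcal N}\eta(x,y,z)=\eta(\mathcal Nx,y,z)+\eta(x,\mathcal Ny,z)+\eta(x,y,\mathcal Nz)$. **Quasi-Jacobi bialgebroid.** Let $A$ be a vector bundle over $M$ with a bracket and an anchor on its sections, $\psi$ a section of $A^*$, $\tilde d_*$ an $\mathbb R$-linear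 operator on $\Gamma(\wedge^\bullet A)$ of degree one, and $\mathsf X\in\Gamma(\wedge^3A)$. Then $(A,\psi,\tilde d_*,\mathsf X)$ is a quasi-Jacobi bialgebroid if $A$ is a Lie algebroid, $d\psi=0$, and there is $W\in\Gamma(A)$ such that for all $P\in\Gamma(\wedge^pA)$, $Q\in\Gamma(\wedge^qA)$, $p,q\ge 0$, $$\tilde d_*(P\wedge Q)=\tilde d_*P\wedge Q+(-1)^pP\wedge\tilde d_*Q-W\wedge P\wedge Q,\qquad \tilde d_*[P,Q]^\psi=[\tilde d_*P,Q]^\psi+(-1)^{p+1}[P,\tilde d_*Q]^\psi,$$ and moreover $\tilde d_*\mathsf X=0$ and $\tilde d_*^2=[\mathsf X,\cdot\,]^\psi$. Here $[P,Q]^\psi=[P,Q]+(p-1)P\wedge i_\psi Q-(-1)^{p-1}(q-1)\,i_\psi P\wedge Q$, where $[\cdot,\cdot]$ is the Schouten (Gerstenhaber) bracket of $A$, $[P,Q]=-(-1)^{(p-1)(q-1)}[Q,P]$, $[P,Q\wedge R]=[P,Q]\wedge R+(-1)^{(p-1)q}Q\wedge[P,R]$, $[a,f]=\rho_A(a)f$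 for $a\in\Gamma(A)$ and a function $f$, the bracket of two functions being $0$; $i_\psi$ contracts the first slot and vanishes on functions. **Proposition.** $(M,(\Lambda,E),\mathcal N,\omega)$ is a Jacobi quasi-Nijenhuis manifold if and only if $$\big((T^*M\times\mathbb R)_{(\Lambda,E)},\ (-E,0),\ d^{(\gamma,g)}_{\mathcal N},\ (d\omega,\omega)\big)$$ is a quasi-Jacobi bialgebroid. -/

import Mathlib

open scoped Manifold ContDiff

noncomputable section

/-!
Everything is expressed through modules of smooth sections over the algebra `R` of smooth functions.
* Vector fields are the derivations of `R`.
* A vector bundle `B` enters through its module of sections `V = Γ(B)`. Sections of the dual bundle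
  are `Module.Dual R V = Γ(B*)`, and sections of `⋀^k B*` are the alternating `R`-multilinear maps
  `V [⋀^Fin k]→ₗ[R] R` (for `k = 0` these are the functions).
-/

namespace JacobiGeom

set_option linter.all false
variable {R : Type*} [CommRing R] [Algebra ℝ R] {V : Type*} [AddCommGroup V] [Module R V]

/-- A skew-symmetric bracket and an anchor on the sections `V` of a vector bundle that satisfy the
Leibniz rule (no Jacobi identity). The derivations of `R` are the vector fields of the base. -/
structure PreLieAlgebroid (R : Type*) [CommRing R] [Algebra ℝ R]
    (V : Type*) [AddCommGroup V] [Module R V] where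
  anchor : V →ₗ[R] Derivation ℝ R R
  bracket : V → V → V
  bracket_self : ∀ x, bracket x x = 0
  add_bracket : ∀ x y z, bracket (x + y) z = bracket x z + bracket y z
  bracket_add : ∀ x y z, bracket x (y + z) = bracket x y + bracket x z
  bracket_smul : ∀ x (f : R) y, bracket x (f • y) = f • bracket x y + anchor x f • y

/-- `i_T α`, the degree-zero derivation
`(i_T α)(w₁, …, w_k) = ∑ j, α(w₁, …, T w_j, …, w_k)`. -/
def insertSum {S : Type*} [CommRing S] {V W : Type*} [AddCommGroup V] [Module S V]
    [AddCommGroup W] [Module S W] {k : ℕ} (T : V →ₗ[S] V) (α : V [⋀^Fin k]→ₗ[S] W) :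
    V [⋀^Fin k]→ₗ[S] W :=
  { MultilinearMap.mk' (fun w => ∑ j, α (Function.update w j (T (w j))))
      (by
        intro m i x y
        rw [← Finset.sum_add_distrib]
        refine Finset.sum_congr rfl fun j _ => ?_
        by_cases h : j = i
        · subst h; simp
        · simp [Function.update_of_ne h, Function.update_comm (Ne.symm h)])
      (by
        intro m i c x
        rw [Finset.smul_sum]
        refine Finset.sum_congr rfl fun j _ => ?_
        by_cases h : j = i
        · subst h; simp
        · simp [Function.update_of_ne h, Function.update_comm (Ne.symm h)]) with
    map_eq_zero_of_eq' := by
      intro v i j hv hij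
      show ∑ l, α (Function.update v l (T (v l))) = 0
      rw [Fintype.sum_eq_add i j hij]
      · have h := α.map_swap (Function.update v i (T (v i))) hij
        have h2 : (Function.update v i (T (v i))) ∘ Equiv.swap i j
            = Function.update v j (T (v j)) := by
          funext l
          by_cases hi : l = i
          · subst hi; simp [hij, hij.symm, hv, Function.update_of_ne]
          · by_cases hj : l = j
            · subst hj; simp [hv]
            · simp [Equiv.swap_apply_of_ne_of_ne hi hj, hi, hj]
        rw [← h2, h]; simp
      · rintro l ⟨hi, hj⟩
        exact α.map_eq_zero_of_eq _ (by simp [Function.update_of_ne hi.symm,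
          Function.update_of_ne hj.symm, hv]) hij }

@[simp] theorem insertSum_apply {S : Type*} [CommRing S] {V W : Type*} [AddCommGroup V] [Module S V]
    [AddCommGroup W] [Module S W] {k : ℕ} (T : V →ₗ[S] V) (α : V [⋀^Fin k]→ₗ[S] W) (w : Fin k → V) :
    insertSum T α w = ∑ j, α (Function.update w j (T (w j))) := rfl

/-- An alternating form, regarded as an additive one. -/
def toInt {k : ℕ} (α : V [⋀^Fin k]→ₗ[R] R) : V [⋀^Fin k]→ₗ[ℤ] R :=
  { α.toMultilinearMap.restrictScalars ℤ with
    map_eq_zero_of_eq' := α.map_eq_zero_of_eq' }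

@[simp] theorem toInt_apply {k : ℕ} (α : V [⋀^Fin k]→ₗ[R] R) (v) : toInt α v = α v := rfl

namespace PreLieAlgebroid
variable (𝒜 : PreLieAlgebroid R V)

theorem bracket_swap (x y : V) : 𝒜.bracket x y = - 𝒜.bracket y x := by
  have h := 𝒜.bracket_self (x + y)
  rw [𝒜.add_bracket, 𝒜.bracket_add, 𝒜.bracket_add, 𝒜.bracket_self, 𝒜.bracket_self] at h
  rw [zero_add, add_zero] at h
  exact eq_neg_of_add_eq_zero_left h

theorem smul_bracket (f : R) (x y : V) :
    𝒜.bracket (f • x) y = f • 𝒜.bracket x y - 𝒜.anchor y f • x := by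
  rw [bracket_swap, 𝒜.bracket_smul, 𝒜.bracket_swap y x, smul_neg]; abel

/-- `[x, -]` as an additive map. -/
def ad (x : V) : V →ₗ[ℤ] V :=
  (AddMonoidHom.mk' (𝒜.bracket x) (𝒜.bracket_add x)).toIntLinearMap

@[simp] theorem ad_apply (x y : V) : 𝒜.ad x y = 𝒜.bracket x y := rfl

/-- Auxiliary map for the Cartan formula. -/
def cartanAux {k : ℕ} (α : V [⋀^Fin k]→ₗ[R] R) : V →ₗ[ℤ] V [⋀^Fin k]→ₗ[ℤ] R :=
  (AddMonoidHom.mk' (fun x => ((𝒜.anchor x : R →ₗ[ℝ] R).toAddMonoidHom.toIntLinearMap).compAlternatingMap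
      (toInt α) - (2 : ℝ)⁻¹ • insertSum (𝒜.ad x) (toInt α)) (by
    intro x y
    ext w
    simp [𝒜.add_bracket, Finset.sum_add_distrib]
    ring)).toIntLinearMap

theorem cartanAux_apply {k : ℕ} (α : V [⋀^Fin k]→ₗ[R] R) (x : V) (w : Fin k → V) :
    𝒜.cartanAux α x w = 𝒜.anchor x (α w)
      - (2 : ℝ)⁻¹ • ∑ j, α (Function.update w j (𝒜.bracket x (w j))) := rfl


theorem toInt_homog {n : ℕ} (Φ : V [⋀^Fin (n + 1)]→ₗ[ℤ] R)
    (h : ∀ (c : R) (x : V) (w : Fin n → V),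
      Φ (Matrix.vecCons (c • x) w) = c * Φ (Matrix.vecCons x w))
    (v : Fin (n + 1) → V) (i : Fin (n + 1)) (c : R) (x : V) :
    Φ (Function.update v i (c • x)) = c * Φ (Function.update v i x) := by
  have key : ∀ y, Function.update v i y = i.insertNth y (i.removeNth v) := by
    intro y; simp
  rw [key, key, AlternatingMap.map_insertNth, AlternatingMap.map_insertNth, h]
  simp only [zsmul_eq_mul]; ring


theorem map_cons_smul {k : ℕ} (α : V [⋀^Fin (k + 1)]→ₗ[R] R) (c : R) (y : V) (u : Fin k → V) :
    α (Fin.cons (c • y) u : Fin (k + 1) → V) = c * α (Fin.cons y u : Fin (k + 1) → V) :=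
  α.map_vecCons_smul u c y

theorem map_cons_add {k : ℕ} (α : V [⋀^Fin (k + 1)]→ₗ[R] R) (y z : V) (u : Fin k → V) :
    α (Fin.cons (y + z) u : Fin (k + 1) → V) =
      α (Fin.cons y u : Fin (k + 1) → V) + α (Fin.cons z u : Fin (k + 1) → V) :=
  α.map_vecCons_add u y z

theorem map_cons_sub {k : ℕ} (α : V [⋀^Fin (k + 1)]→ₗ[R] R) (y z : V) (u : Fin k → V) :
    α (Fin.cons (y - z) u : Fin (k + 1) → V) =
      α (Fin.cons y u : Fin (k + 1) → V) - α (Fin.cons z u : Fin (k + 1) → V) := by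
  have := map_cons_add α y ((-1 : R) • z) u
  rw [map_cons_smul] at this
  simpa [sub_eq_add_neg] using this

theorem cartan_cons {k : ℕ} (α : V [⋀^Fin (k + 1)]→ₗ[R] R) (x : V) (w : Fin (k + 1) → V) :
    AlternatingMap.alternatizeUncurryFin (𝒜.cartanAux α) (Fin.cons x w : Fin (k + 2) → V) =
      𝒜.anchor x (α w) - (2 : ℝ)⁻¹ • ∑ j : Fin (k + 1), (-1) ^ (j : ℕ) *
        α (Fin.cons (𝒜.bracket x (w j)) (j.removeNth w) : Fin (k + 1) → V)
      + ∑ j : Fin (k + 1), (-1) ^ (j + 1 : ℕ) *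
        (𝒜.anchor (w j) (α (Fin.cons x (j.removeNth w) : Fin (k + 1) → V))
          - (2 : ℝ)⁻¹ • (α (Fin.cons (𝒜.bracket (w j) x) (j.removeNth w) : Fin (k + 1) → V)
            + ∑ l, α (Fin.cons x (Function.update (j.removeNth w) l
                (𝒜.bracket (w j) (j.removeNth w l))) : Fin (k + 1) → V))) := by
  have h1 : ∀ (j : Fin (k+1)) (y : V), α (Function.update w j y) =
      (-1) ^ (j : ℕ) * α (Fin.cons y (j.removeNth w) : Fin (k + 1) → V) := by
    intro j y
    have h : Function.update w j y = j.insertNth y (j.removeNth w) := by simp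
    rw [h, AlternatingMap.map_insertNth]; simp [Matrix.vecCons]
  have h2 : ∀ (y : V) (j : Fin (k+1)),
      j.succ.removeNth (Fin.cons y w : Fin (k + 2) → V) =
        (Fin.cons y (j.removeNth w) : Fin (k + 1) → V) :=
    fun y j => Fin.cons_comp_succ_succAbove y w j
  simp only [AlternatingMap.alternatizeUncurryFin_apply, cartanAux_apply]
  rw [Fin.sum_univ_succ]
  congr 1
  · simp [h1]
  · refine Finset.sum_congr rfl fun j _ => ?_
    simp only [h2, Fin.cons_succ, Fin.val_succ, Fin.sum_univ_succ (n := k), Fin.cons_zero,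
      ← Fin.cons_update, Fin.update_cons_zero, zsmul_eq_mul]
    push_cast
    rfl

theorem cartan_homog {k : ℕ} (α : V [⋀^Fin k]→ₗ[R] R) (c : R) (x : V) (w : Fin k → V) :
    AlternatingMap.alternatizeUncurryFin (𝒜.cartanAux α) (Matrix.vecCons (c • x) w) =
      c * AlternatingMap.alternatizeUncurryFin (𝒜.cartanAux α) (Matrix.vecCons x w) := by
  cases k with
  | zero =>
    simp [AlternatingMap.alternatizeUncurryFin_apply, cartanAux_apply,
      Subsingleton.elim (Fin.removeNth 0 (Matrix.vecCons (c • x) w))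
        (Fin.removeNth 0 (Matrix.vecCons x w))]
  | succ k =>
    change AlternatingMap.alternatizeUncurryFin _ (Fin.cons (c • x) w : Fin (k + 2) → V) =
      c * AlternatingMap.alternatizeUncurryFin _ (Fin.cons x w : Fin (k + 2) → V)
    rw [cartan_cons, cartan_cons]
    simp only [𝒜.bracket_smul, 𝒜.smul_bracket, map_cons_add, map_cons_sub, map_cons_smul, map_smul,
      Derivation.smul_apply, Derivation.leibniz, smul_eq_mul, ← Finset.mul_sum]
    have ht : (algebraMap ℝ R 2⁻¹) + algebraMap ℝ R 2⁻¹ = 1 := by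
      rw [← map_add]; norm_num
    simp only [Algebra.smul_def]
    rw [mul_add, mul_sub, sub_add, sub_add]
    congr 1
    simp only [Finset.mul_sum]
    rw [← Finset.sum_sub_distrib, ← Finset.sum_sub_distrib]
    refine Finset.sum_congr rfl fun j _ => ?_
    simp only [← Finset.mul_sum]
    rw [pow_succ]
    linear_combination (-(-1) ^ (j : ℕ) * 𝒜.anchor (w j) c
      * α (Fin.cons x (j.removeNth w) : Fin (k + 1) → V)) * ht

theorem alternatizeUncurryFin_cartanAux {k : ℕ} (α : V [⋀^Fin k]→ₗ[R] R) (v : Fin (k + 1) → V) :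
    AlternatingMap.alternatizeUncurryFin (𝒜.cartanAux α) v =
      ∑ i : Fin (k + 1), (-1 : R) ^ (i : ℕ) * (𝒜.anchor (v i) (α (i.removeNth v)) -
        (2 : ℝ)⁻¹ • ∑ j : Fin k,
          α (Function.update (i.removeNth v) j (𝒜.bracket (v i) (i.removeNth v j)))) := by
  rw [AlternatingMap.alternatizeUncurryFin_apply]
  exact Finset.sum_congr rfl fun i _ => by rw [cartanAux_apply, zsmul_eq_mul]; push_cast; rfl

/-- The differential of forms, by the Cartan formula
`(dα)(v₀, …, v_k) = ∑ i, (-1)^i ρ(v_i)(α(v₀, …, v̂_i, …, v_k))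
  + ∑ i < j, (-1)^(i+j) α([v_i, v_j], v₀, …, v̂_i, …, v̂_j, …, v_k)`.
In the code `[v_i, v_j]` is moved to the place of `v_j`, and the sum runs over all pairs
`i ≠ j`, which counts every pair twice. -/
def d {k : ℕ} : (V [⋀^Fin k]→ₗ[R] R) →ₗ[ℝ] V [⋀^Fin (k + 1)]→ₗ[R] R where
  toFun α :=
    { toFun := fun v => ∑ i : Fin (k + 1), (-1 : R) ^ (i : ℕ) *
        (𝒜.anchor (v i) (α (i.removeNth v)) - (2 : ℝ)⁻¹ • ∑ j : Fin k,
          α (Function.update (i.removeNth v) j (𝒜.bracket (v i) (i.removeNth v j))))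
      map_update_add' := by
        intro inst v i x y
        simp only [← alternatizeUncurryFin_cartanAux]
        exact (AlternatingMap.alternatizeUncurryFin (𝒜.cartanAux α)).map_update_add' v i x y
      map_update_smul' := by
        intro inst v i c x
        rw [Subsingleton.elim inst (instDecidableEqFin _)]
        simp only [← alternatizeUncurryFin_cartanAux]
        exact toInt_homog (AlternatingMap.alternatizeUncurryFin (𝒜.cartanAux α))
          (𝒜.cartan_homog α) v i c x
      map_eq_zero_of_eq' := by
        intro v i j hv hij
        rw [← alternatizeUncurryFin_cartanAux]
        exact AlternatingMap.map_eq_zero_of_eq _ v hv hij }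
  map_add' α β := by
    ext v
    simp only [AlternatingMap.coe_mk, MultilinearMap.coe_mk, AlternatingMap.add_apply, map_add]
    rw [← Finset.sum_add_distrib]
    exact Finset.sum_congr rfl fun i _ => by rw [Finset.sum_add_distrib, smul_add]; ring
  map_smul' c α := by
    ext v
    simp only [AlternatingMap.coe_mk, MultilinearMap.coe_mk, AlternatingMap.smul_apply,
      RingHom.id_apply]
    rw [Finset.smul_sum]
    exact Finset.sum_congr rfl fun i _ => by
      rw [Derivation.map_smul, ← Finset.smul_sum, smul_comm, ← smul_sub, mul_smul_comm]

end PreLieAlgebroid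

/-- `lastSlot P u = P(u₁, …, u_a, -)`. -/
def lastSlot {a : ℕ} (P : V [⋀^Fin (a + 1)]→ₗ[R] R) : V [⋀^Fin a]→ₗ[R] Module.Dual R V :=
  { P.toMultilinearMap.curryRight with
    map_eq_zero_of_eq' := by
      intro v i j hv hij
      ext x
      exact P.map_eq_zero_of_eq (Fin.snoc v x : Fin (a + 1) → V)
        (i := i.castSucc) (j := j.castSucc) (by simpa using hv) (by simpa using hij) }

theorem lastSlot_apply {a : ℕ} (P : V [⋀^Fin (a + 1)]→ₗ[R] R) (u : Fin a → V) (x : V) :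
    lastSlot P u x = P (Fin.snoc u x : Fin (a + 1) → V) := rfl

/-- `firstSlot Q u = Q(-, u₁, …, u_b)`. -/
def firstSlot {b : ℕ} (Q : V [⋀^Fin (b + 1)]→ₗ[R] R) : V [⋀^Fin b]→ₗ[R] Module.Dual R V where
  toFun u :=
    { toFun := fun x => Q.curryLeft x u
      map_add' := fun x y => by simp
      map_smul' := fun c x => by simp }
  map_update_add' := by intro _ m i x y; ext z; exact (Q.curryLeft z).map_update_add' m i x y
  map_update_smul' := by intro _ m i c x; ext z; exact (Q.curryLeft z).map_update_smul' m i c x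
  map_eq_zero_of_eq' := by
    intro v i j hv hij; ext z; exact (Q.curryLeft z).map_eq_zero_of_eq v hv hij

theorem firstSlot_apply {b : ℕ} (Q : V [⋀^Fin (b + 1)]→ₗ[R] R) (u : Fin b → V) (x : V) :
    firstSlot Q u x = Q (Fin.cons x u : Fin (b + 1) → V) := rfl

namespace PreLieAlgebroid

/-!
### The Schouten bracket

Here `A` is a vector bundle with a bracket and an anchor on `Γ(A)`, where `Γ(A)` is given as the dual
of the module `V = Γ(A*)`; so `Γ(⋀^k A)` consists of the alternating forms on `V`.
-/

variable (𝒜 : PreLieAlgebroid R (Module.Dual R V))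

/-- The differential of a section `v` of `A*`:
`(d v)(α, β) = ρ(α)⟨β, v⟩ - ρ(β)⟨α, v⟩ - ⟨[α, β], v⟩`. -/
def dDual (v : V) (α β : Module.Dual R V) : R :=
  𝒜.anchor α (β v) - 𝒜.anchor β (α v) - 𝒜.bracket α β v

/-- The summand of the Schouten bracket, see `schoutenPos`. -/
def schoutenSummand {a b : ℕ} (P : V [⋀^Fin (a + 1)]→ₗ[R] R) (Q : V [⋀^Fin (b + 1)]→ₗ[R] R)
    (w : Fin (a + 1 + b) → V) : R :=
  let α : Module.Dual R V := lastSlot P fun i => w (Fin.castAdd b i.castSucc)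
  let v : V := w (Fin.castAdd b (Fin.last a))
  let β : Module.Dual R V := firstSlot Q fun j => w (Fin.natAdd (a + 1) j)
  ((b + 1 : ℝ)⁻¹ • 𝒜.anchor α (β v)) - ((a + 1 : ℝ)⁻¹ • 𝒜.anchor β (α v)) - 𝒜.dDual v α β

theorem sum_perm_eq_zero {n : ℕ} (k : Fin n) (J : Finset (Fin n)) (hk : k ∉ J) (t : ℝ)
    (A : (Fin n → V) → R) (hA : ∀ j ∈ J, ∀ w, A (w ∘ Equiv.swap k j) = - A w)
    (coef : Fin n → ℝ) (hc : ∀ j ∈ J, coef j = t) (hck : coef k = - (J.card * t))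
    (hc0 : ∀ j, j ≠ k → j ∉ J → coef j = 0) (u : Fin n → V) (i : Fin n) :
    ∑ σ : Equiv.Perm (Fin n), Equiv.Perm.sign σ • coef (σ⁻¹ i) • A (u ∘ σ) = 0 := by
  classical
  have hsw : ∀ j ∈ J, ∑ σ : Equiv.Perm (Fin n),
      (if σ j = i then Equiv.Perm.sign σ • A (u ∘ σ) else 0) =
      ∑ σ : Equiv.Perm (Fin n), (if σ k = i then Equiv.Perm.sign σ • A (u ∘ σ) else 0) := by
    intro j hj
    have hkj : k ≠ j := fun h => hk (h ▸ hj)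
    refine Fintype.sum_equiv (Equiv.mulRight (Equiv.swap k j)) _ _ fun σ => ?_
    have h1 : u ∘ ⇑(σ * Equiv.swap k j) = (u ∘ σ) ∘ Equiv.swap k j := rfl
    simp only [Equiv.coe_mulRight, h1, hA j hj, Equiv.Perm.mul_apply, Equiv.swap_apply_left,
      Equiv.Perm.sign_mul, Equiv.Perm.sign_swap hkj]
    simp
  have hexp : ∀ σ : Equiv.Perm (Fin n), Equiv.Perm.sign σ • coef (σ⁻¹ i) • A (u ∘ σ) =
      ∑ j, coef j • (if σ j = i then Equiv.Perm.sign σ • A (u ∘ σ) else 0) := by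
    intro σ
    rw [Finset.sum_eq_single (σ⁻¹ i)]
    · have h : σ (σ⁻¹ i) = i := σ.apply_symm_apply i
      rw [if_pos h, smul_comm]
    · intro j _ hj
      rw [if_neg, smul_zero]
      rintro rfl
      simp at hj
    · simp
  simp_rw [hexp]
  rw [Finset.sum_comm]
  simp_rw [← Finset.smul_sum]
  rw [← Finset.sum_subset (Finset.subset_univ (insert k J)), Finset.sum_insert hk]
  · have h2 : ∀ j ∈ J, (coef j • ∑ σ : Equiv.Perm (Fin n),
        (if σ j = i then Equiv.Perm.sign σ • A (u ∘ σ) else 0)) =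
        t • ∑ σ : Equiv.Perm (Fin n),
          (if σ k = i then Equiv.Perm.sign σ • A (u ∘ σ) else 0) :=
      fun j hj => by rw [hc j hj, hsw j hj]
    rw [Finset.sum_congr rfl h2, Finset.sum_const, hck]
    rw [← Nat.cast_smul_eq_nsmul ℝ, smul_smul, neg_smul]; simp
  · intro j _ hj
    rw [Finset.mem_insert, not_or] at hj
    rw [hc0 j hj.1 hj.2, zero_smul]


variable {a b : ℕ} (P : V [⋀^Fin (a + 1)]→ₗ[R] R) (Q : V [⋀^Fin (b + 1)]→ₗ[R] R)

theorem schoutenSummand_apply (w : Fin (a + 1 + b) → V) :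
    𝒜.schoutenSummand P Q w =
      𝒜.bracket (lastSlot P fun i => w (Fin.castAdd b i.castSucc))
        (firstSlot Q fun j => w (Fin.natAdd (a + 1) j)) (w (Fin.castAdd b (Fin.last a)))
      + ((b + 1 : ℝ)⁻¹ - 1) • 𝒜.anchor (lastSlot P fun i => w (Fin.castAdd b i.castSucc))
          (firstSlot Q (fun j => w (Fin.natAdd (a + 1) j)) (w (Fin.castAdd b (Fin.last a))))
      - ((a + 1 : ℝ)⁻¹ - 1) • 𝒜.anchor (firstSlot Q fun j => w (Fin.natAdd (a + 1) j))
          (lastSlot P (fun i => w (Fin.castAdd b i.castSucc)) (w (Fin.castAdd b (Fin.last a)))) := by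
  simp only [schoutenSummand, dDual, sub_smul, one_smul]
  abel

/-- Auxiliary function for the tensoriality of the Schouten bracket. -/
def symA (c : R) (w : Fin (a + 1 + b) → V) : R :=
  𝒜.anchor (lastSlot P fun i => w (Fin.castAdd b i.castSucc)) c *
    firstSlot Q (fun j => w (Fin.natAdd (a + 1) j)) (w (Fin.castAdd b (Fin.last a)))

/-- Auxiliary function for the tensoriality of the Schouten bracket. -/
def symB (c : R) (w : Fin (a + 1 + b) → V) : R :=
  𝒜.anchor (firstSlot Q fun j => w (Fin.natAdd (a + 1) j)) c *
    lastSlot P (fun i => w (Fin.castAdd b i.castSucc)) (w (Fin.castAdd b (Fin.last a)))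

/-- Auxiliary coefficients. -/
def coefA (a b : ℕ) : Fin (a + 1 + b) → ℝ :=
  Fin.addCases (fun i => if i = Fin.last a then (b + 1 : ℝ)⁻¹ - 1 else 0) (fun _ => (b + 1 : ℝ)⁻¹)

/-- Auxiliary coefficients. -/
def coefB (a b : ℕ) : Fin (a + 1 + b) → ℝ :=
  Fin.addCases (fun i => if i = Fin.last a then (a + 1 : ℝ)⁻¹ - 1 else (a + 1 : ℝ)⁻¹) (fun _ => 0)

theorem schoutenSummand_update_smul (w : Fin (a + 1 + b) → V) (j : Fin (a + 1 + b)) (c : R)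
    (x : V) :
    𝒜.schoutenSummand P Q (Function.update w j (c • x)) =
      c * 𝒜.schoutenSummand P Q (Function.update w j x)
      + coefA a b j • 𝒜.symA P Q c (Function.update w j x)
      - coefB a b j • 𝒜.symB P Q c (Function.update w j x) := by
  simp only [schoutenSummand_apply, symA, symB]
  refine Fin.addCases (fun i => ?_) (fun i => ?_) j
  · refine Fin.lastCases ?_ (fun i => ?_) i
    · have h1 : ∀ y, (fun i => Function.update w (Fin.castAdd b (Fin.last a)) y
          (Fin.castAdd b (Fin.castSucc i))) = fun i => w (Fin.castAdd b (Fin.castSucc i)) := by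
        intro y; (try funext l); simp [Function.update_apply, Fin.ext_iff] <;> omega
      have h2 : ∀ y, (fun j => Function.update w (Fin.castAdd b (Fin.last a)) y
          (Fin.natAdd (a + 1) j)) = fun j => w (Fin.natAdd (a + 1) j) := by
        intro y; (try funext l); simp [Function.update_apply, Fin.ext_iff] <;> omega
      simp only [h1, h2, Function.update_self, coefA, coefB, Fin.addCases_left, if_true,
        map_smul, smul_eq_mul, Derivation.leibniz, mul_add, mul_sub, sub_mul, map_sub, map_one, Algebra.smul_def]
      ring
    · have h1 : ∀ y, (fun l => Function.update w (Fin.castAdd b (Fin.castSucc i)) y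
          (Fin.castAdd b (Fin.castSucc l))) =
          Function.update (fun i => w (Fin.castAdd b (Fin.castSucc i))) i y := by
        intro y; (try funext l); simp [Function.update_apply, Fin.ext_iff] <;> omega
      have h2 : ∀ y, (fun j => Function.update w (Fin.castAdd b (Fin.castSucc i)) y
          (Fin.natAdd (a + 1) j)) = fun j => w (Fin.natAdd (a + 1) j) := by
        intro y; (try funext l); simp [Function.update_apply, Fin.ext_iff] <;> omega
      have h3 : ∀ y, Function.update w (Fin.castAdd b (Fin.castSucc i)) y
          (Fin.castAdd b (Fin.last a)) = w (Fin.castAdd b (Fin.last a)) := by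
        intro y; (try funext l); simp [Function.update_apply, Fin.ext_iff] <;> omega
      have h4 : Fin.castSucc i ≠ Fin.last a := (Fin.castSucc_lt_last i).ne
      simp only [h1, h2, h3, coefA, coefB, Fin.addCases_left, if_neg h4, AlternatingMap.map_update_smul,
        map_smul, smul_eq_mul, Derivation.leibniz, mul_add, mul_sub, sub_mul, map_sub, map_one, Algebra.smul_def,
        𝒜.smul_bracket, LinearMap.sub_apply, LinearMap.smul_apply, Derivation.smul_apply, map_zero]
      ring
  · have h1 : ∀ y, (fun l => Function.update w (Fin.natAdd (a + 1) i) y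
          (Fin.castAdd b (Fin.castSucc l))) = fun l => w (Fin.castAdd b (Fin.castSucc l)) := by
        intro y; (try funext l); simp [Function.update_apply, Fin.ext_iff] <;> omega
    have h2 : ∀ y, (fun j => Function.update w (Fin.natAdd (a + 1) i) y
          (Fin.natAdd (a + 1) j)) = Function.update (fun j => w (Fin.natAdd (a + 1) j)) i y := by
        intro y; (try funext l); simp [Function.update_apply, Fin.ext_iff] <;> omega
    have h3 : ∀ y, Function.update w (Fin.natAdd (a + 1) i) y
          (Fin.castAdd b (Fin.last a)) = w (Fin.castAdd b (Fin.last a)) := by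
        intro y; (try funext l); simp [Function.update_apply, Fin.ext_iff] <;> omega
    simp only [h1, h2, h3, coefA, coefB, Fin.addCases_right, AlternatingMap.map_update_smul,
        map_smul, smul_eq_mul, Derivation.leibniz, mul_add, mul_sub, sub_mul, map_sub, map_one, Algebra.smul_def,
        𝒜.bracket_smul, LinearMap.add_apply, LinearMap.smul_apply, Derivation.smul_apply, map_zero]
    ring

theorem schoutenSummand_update_add (w : Fin (a + 1 + b) → V) (j : Fin (a + 1 + b))
    (x y : V) :
    𝒜.schoutenSummand P Q (Function.update w j (x + y)) =
      𝒜.schoutenSummand P Q (Function.update w j x)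
      + 𝒜.schoutenSummand P Q (Function.update w j y) := by
  simp only [schoutenSummand_apply]
  refine Fin.addCases (fun i => ?_) (fun i => ?_) j
  · refine Fin.lastCases ?_ (fun i => ?_) i
    · have h1 : ∀ y, (fun i => Function.update w (Fin.castAdd b (Fin.last a)) y
          (Fin.castAdd b (Fin.castSucc i))) = fun i => w (Fin.castAdd b (Fin.castSucc i)) := by
        intro y; (try funext l); simp [Function.update_apply, Fin.ext_iff] <;> omega
      have h2 : ∀ y, (fun j => Function.update w (Fin.castAdd b (Fin.last a)) y
          (Fin.natAdd (a + 1) j)) = fun j => w (Fin.natAdd (a + 1) j) := by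
        intro y; (try funext l); simp [Function.update_apply, Fin.ext_iff] <;> omega
      simp only [h1, h2, Function.update_self, AlternatingMap.map_update_add, map_add,
        𝒜.add_bracket, 𝒜.bracket_add, LinearMap.add_apply, Derivation.add_apply, smul_add]
      ring
    · have h1 : ∀ y, (fun l => Function.update w (Fin.castAdd b (Fin.castSucc i)) y
          (Fin.castAdd b (Fin.castSucc l))) =
          Function.update (fun i => w (Fin.castAdd b (Fin.castSucc i))) i y := by
        intro y; (try funext l); simp [Function.update_apply, Fin.ext_iff] <;> omega
      have h2 : ∀ y, (fun j => Function.update w (Fin.castAdd b (Fin.castSucc i)) y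
          (Fin.natAdd (a + 1) j)) = fun j => w (Fin.natAdd (a + 1) j) := by
        intro y; (try funext l); simp [Function.update_apply, Fin.ext_iff] <;> omega
      have h3 : ∀ y, Function.update w (Fin.castAdd b (Fin.castSucc i)) y
          (Fin.castAdd b (Fin.last a)) = w (Fin.castAdd b (Fin.last a)) := by
        intro y; (try funext l); simp [Function.update_apply, Fin.ext_iff] <;> omega
      have h4 : Fin.castSucc i ≠ Fin.last a := (Fin.castSucc_lt_last i).ne
      simp only [h1, h2, h3, AlternatingMap.map_update_add, map_add,
        𝒜.add_bracket, 𝒜.bracket_add, LinearMap.add_apply, Derivation.add_apply, smul_add]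
      ring
  · have h1 : ∀ y, (fun l => Function.update w (Fin.natAdd (a + 1) i) y
          (Fin.castAdd b (Fin.castSucc l))) = fun l => w (Fin.castAdd b (Fin.castSucc l)) := by
        intro y; (try funext l); simp [Function.update_apply, Fin.ext_iff] <;> omega
    have h2 : ∀ y, (fun j => Function.update w (Fin.natAdd (a + 1) i) y
          (Fin.natAdd (a + 1) j)) = Function.update (fun j => w (Fin.natAdd (a + 1) j)) i y := by
        intro y; (try funext l); simp [Function.update_apply, Fin.ext_iff] <;> omega
    have h3 : ∀ y, Function.update w (Fin.natAdd (a + 1) i) y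
          (Fin.castAdd b (Fin.last a)) = w (Fin.castAdd b (Fin.last a)) := by
        intro y; (try funext l); simp [Function.update_apply, Fin.ext_iff] <;> omega
    simp only [h1, h2, h3, AlternatingMap.map_update_add, map_add,
        𝒜.add_bracket, 𝒜.bracket_add, LinearMap.add_apply, Derivation.add_apply, smul_add]
    ring



theorem symA_swap (c : R) (j : Fin b) (w : Fin (a + 1 + b) → V) :
    𝒜.symA P Q c (w ∘ Equiv.swap (Fin.castAdd b (Fin.last a)) (Fin.natAdd (a + 1) j)) =
      - 𝒜.symA P Q c w := by
  have h1 : (fun i : Fin a => (w ∘ Equiv.swap (Fin.castAdd b (Fin.last a)) (Fin.natAdd (a + 1) j))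
      (Fin.castAdd b i.castSucc)) = fun i : Fin a => w (Fin.castAdd b i.castSucc) := by
    funext i
    rw [Function.comp_apply, Equiv.swap_apply_of_ne_of_ne] <;> simp [Fin.ext_iff] <;> omega
  have h2 : (Fin.cons (w (Fin.natAdd (a + 1) j)) (fun l : Fin b =>
      (w ∘ Equiv.swap (Fin.castAdd b (Fin.last a)) (Fin.natAdd (a + 1) j)) (Fin.natAdd (a + 1) l)) :
        Fin (b + 1) → V) =
      (Fin.cons (w (Fin.castAdd b (Fin.last a))) (fun l : Fin b => w (Fin.natAdd (a + 1) l)) :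
        Fin (b + 1) → V) ∘ Equiv.swap 0 j.succ := by
    funext l
    refine Fin.cases ?_ (fun l => ?_) l
    · simp
    · by_cases h : l = j
      · subst h; simp
      · have h3 : Fin.natAdd (a + 1) l ≠ Fin.castAdd b (Fin.last a) := by
          simp [Fin.ext_iff]; omega
        rw [Function.comp_apply, Equiv.swap_apply_of_ne_of_ne (Fin.succ_ne_zero l)
          (by simpa using h), Fin.cons_succ, Fin.cons_succ, Function.comp_apply,
          Equiv.swap_apply_of_ne_of_ne h3 (by simpa using h)]
  have h4 : (0 : Fin (b + 1)) ≠ j.succ := (Fin.succ_ne_zero j).symm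
  simp only [symA, h1, firstSlot_apply, Function.comp_apply (f := w), Equiv.swap_apply_left]
  simp only [Function.comp_apply (f := w)] at h1 h2
  rw [h1, h2, AlternatingMap.map_swap _ _ h4, mul_neg]

theorem symB_swap (c : R) (j : Fin a) (w : Fin (a + 1 + b) → V) :
    𝒜.symB P Q c (w ∘ Equiv.swap (Fin.castAdd b (Fin.last a)) (Fin.castAdd b j.castSucc)) =
      - 𝒜.symB P Q c w := by
  have h1 : (fun i : Fin b => (w ∘ Equiv.swap (Fin.castAdd b (Fin.last a))
      (Fin.castAdd b j.castSucc)) (Fin.natAdd (a + 1) i)) =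
      fun i : Fin b => w (Fin.natAdd (a + 1) i) := by
    funext i
    rw [Function.comp_apply, Equiv.swap_apply_of_ne_of_ne] <;> simp [Fin.ext_iff] <;> omega
  have h2 : (Fin.snoc (fun l : Fin a => (w ∘ Equiv.swap (Fin.castAdd b (Fin.last a))
      (Fin.castAdd b j.castSucc)) (Fin.castAdd b l.castSucc)) (w (Fin.castAdd b j.castSucc)) :
        Fin (a + 1) → V) =
      (fun l : Fin (a + 1) => w (Fin.castAdd b l)) ∘ Equiv.swap (Fin.last a) j.castSucc := by
    funext l
    refine Fin.lastCases ?_ (fun l => ?_) l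
    · simp
    · by_cases h : l = j
      · subst h; simp
      · have h3 : Fin.castAdd b l.castSucc ≠ Fin.castAdd b (Fin.last a) := by
          simp [Fin.ext_iff]; omega
        rw [Function.comp_apply, Equiv.swap_apply_of_ne_of_ne (Fin.castSucc_lt_last l).ne
          (by simpa using h), Fin.snoc_castSucc, Function.comp_apply,
          Equiv.swap_apply_of_ne_of_ne h3 (by simpa using h)]
  have h5 : (Fin.snoc (fun l : Fin a => w (Fin.castAdd b l.castSucc))
      (w (Fin.castAdd b (Fin.last a))) : Fin (a + 1) → V) =
      fun l : Fin (a + 1) => w (Fin.castAdd b l) := by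
    funext l
    refine Fin.lastCases ?_ (fun l => ?_) l <;> simp
  have h4 : Fin.last a ≠ j.castSucc := (Fin.castSucc_lt_last j).ne'
  simp only [symB, h1, lastSlot_apply, Function.comp_apply (f := w), Equiv.swap_apply_left]
  simp only [Function.comp_apply (f := w)] at h1 h2
  rw [h1, h2, AlternatingMap.map_swap _ _ h4, mul_neg, h5]

theorem sum_symA (c : R) (u : Fin (a + 1 + b) → V) (i : Fin (a + 1 + b)) :
    ∑ σ : Equiv.Perm (Fin (a + 1 + b)),
      Equiv.Perm.sign σ • coefA a b (σ⁻¹ i) • 𝒜.symA P Q c (u ∘ σ) = 0 := by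
  refine sum_perm_eq_zero (Fin.castAdd b (Fin.last a)) (Finset.univ.map (Fin.natAddEmb (a + 1)))
    ?_ (b + 1 : ℝ)⁻¹ _ ?_ _ ?_ ?_ ?_ u i
  · simp [Fin.ext_iff]; omega
  · intro j hj w
    obtain ⟨j, -, rfl⟩ := Finset.mem_map.1 hj
    exact 𝒜.symA_swap P Q c j w
  · intro j hj
    obtain ⟨j, -, rfl⟩ := Finset.mem_map.1 hj
    simp [coefA]
  · have h : (b + 1 : ℝ) ≠ 0 := by positivity
    simp [coefA]; field_simp; ring
  · refine fun j => Fin.addCases (fun i hi _ => ?_) (fun i _ hi => ?_) j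
    · have : i ≠ Fin.last a := fun h => hi (by rw [h])
      simp [coefA, this]
    · exact absurd (Finset.mem_map.2 ⟨i, Finset.mem_univ _, rfl⟩) hi

theorem sum_symB (c : R) (u : Fin (a + 1 + b) → V) (i : Fin (a + 1 + b)) :
    ∑ σ : Equiv.Perm (Fin (a + 1 + b)),
      Equiv.Perm.sign σ • coefB a b (σ⁻¹ i) • 𝒜.symB P Q c (u ∘ σ) = 0 := by
  refine sum_perm_eq_zero (Fin.castAdd b (Fin.last a))
    (Finset.univ.map (Fin.castSuccEmb.trans (Fin.castAddEmb b)))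
    ?_ (a + 1 : ℝ)⁻¹ _ ?_ _ ?_ ?_ ?_ u i
  · simp [Fin.ext_iff]; omega
  · intro j hj w
    obtain ⟨j, -, rfl⟩ := Finset.mem_map.1 hj
    exact 𝒜.symB_swap P Q c j w
  · intro j hj
    obtain ⟨j, -, rfl⟩ := Finset.mem_map.1 hj
    have h4 : j.castSucc ≠ Fin.last a := (Fin.castSucc_lt_last j).ne
    simp [coefB, h4]
  · have h : (a + 1 : ℝ) ≠ 0 := by positivity
    simp [coefB]; field_simp; ring
  · intro j
    refine Fin.addCases (fun i => ?_) (fun i _ _ => ?_) j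
    · refine Fin.lastCases ?_ (fun i => ?_) i
      · exact fun h => absurd rfl h
      · exact fun _ hi => absurd (Finset.mem_map.2 ⟨i, Finset.mem_univ _, rfl⟩) hi
    · simp [coefB]

theorem update_comp_perm {n : ℕ} (v : Fin n → V) (i : Fin n) (y : V) (σ : Equiv.Perm (Fin n)) :
    Function.update v i y ∘ σ = Function.update (v ∘ σ) (σ⁻¹ i) y := by
  funext l
  by_cases h : l = σ⁻¹ i
  · have h2 : σ l = i := by rw [h]; exact σ.apply_symm_apply i
    rw [Function.comp_apply, h2, h, Function.update_self, Function.update_self]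
  · have h2 : σ l ≠ i := fun h3 => h (by rw [← h3]; exact (σ.symm_apply_apply l).symm)
    rw [Function.comp_apply, Function.update_of_ne h2, Function.update_of_ne h, Function.comp_apply]

/-- The Schouten bracket of `P ∈ Γ(⋀^p A)` and `Q ∈ Γ(⋀^q A)` with `p = a + 1`, `q = b + 1`.
Evaluated on sections `v₁, …, v_(p+q-1)` of `A*` it is
`∑ ± ρ(P(v_I, -))(Q(v_J)) - ∑ ± ρ(Q(-, v_J))(P(v_I)) - ∑ ± (d v_k)(P(v_I, -), Q(-, v_J))`,
summed over the splittings of the arguments, in the order `(I, J)`, `(I, J)` and `(I, k, J)`, with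
the sign of the shuffle. The code sums over all permutations of the arguments and divides by the
number of repetitions.
For `p = q = 1` this is the bracket of sections; it is the extension of that bracket to a
Gerstenhaber bracket: `[P, Q] = -(-1)^((p-1)(q-1)) [Q, P]` and
`[P, Q ∧ S] = [P, Q] ∧ S + (-1)^((p-1)q) Q ∧ [P, S]`. -/
def schoutenPos : V [⋀^Fin (a + 1 + b)]→ₗ[R] R where
  toFun v := (a.factorial * b.factorial : ℝ)⁻¹ • ∑ σ : Equiv.Perm (Fin (a + 1 + b)),
    Equiv.Perm.sign σ • 𝒜.schoutenSummand P Q (v ∘ σ)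
  map_update_add' := by
    intro inst v i x y
    cases Subsingleton.elim inst (instDecidableEqFin _)
    rw [← smul_add, ← Finset.sum_add_distrib]
    congr 1
    refine Finset.sum_congr rfl fun σ _ => ?_
    rw [update_comp_perm, update_comp_perm, update_comp_perm, schoutenSummand_update_add, smul_add]
  map_update_smul' := by
    intro inst v i c x
    cases Subsingleton.elim inst (instDecidableEqFin _)
    rw [smul_comm]
    congr 1
    have hA := 𝒜.sum_symA P Q c (Function.update v i x) i
    have hB := 𝒜.sum_symB P Q c (Function.update v i x) i
    have h : ∀ σ : Equiv.Perm (Fin (a + 1 + b)),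
        Equiv.Perm.sign σ • 𝒜.schoutenSummand P Q (Function.update v i (c • x) ∘ σ) =
        c • Equiv.Perm.sign σ • 𝒜.schoutenSummand P Q (Function.update v i x ∘ σ)
        + Equiv.Perm.sign σ • coefA a b (σ⁻¹ i) • 𝒜.symA P Q c (Function.update v i x ∘ σ)
        - Equiv.Perm.sign σ • coefB a b (σ⁻¹ i) • 𝒜.symB P Q c (Function.update v i x ∘ σ) := by
      intro σ
      rw [update_comp_perm, update_comp_perm, schoutenSummand_update_smul, smul_sub, smul_add,
        ← smul_eq_mul, smul_comm c]
    rw [Finset.sum_congr rfl fun σ _ => h σ, Finset.sum_sub_distrib, Finset.sum_add_distrib, hA, hB,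
      add_zero, sub_zero, Finset.smul_sum]
  map_eq_zero_of_eq' := by
    intro v i j hv hij
    have h : ∑ σ : Equiv.Perm (Fin (a + 1 + b)),
        Equiv.Perm.sign σ • 𝒜.schoutenSummand P Q (v ∘ σ) = 0 := by
      refine Finset.sum_involution (fun σ _ => Equiv.swap i j * σ) (fun σ _ => ?_) (fun σ _ _ => ?_)
        (fun σ _ => Finset.mem_univ _) (fun σ _ => ?_)
      · have h2 : v ∘ ⇑(Equiv.swap i j * σ) = v ∘ σ := by
          funext l
          exact Equiv.apply_swap_eq_self hv (σ l)
        rw [h2, Equiv.Perm.sign_mul, Equiv.Perm.sign_swap hij]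
        simp
      · intro h
        exact hij (by simpa using h)
      · rw [← mul_assoc, Equiv.swap_mul_self, one_mul]
    rw [h, smul_zero]

/-- `α ↦ ρ(α) f`, for a function `f`. -/
def anchorApply (f : R) : Module.Dual R V →ₗ[R] R where
  toFun α := 𝒜.anchor α f
  map_add' α β := by rw [map_add, Derivation.add_apply]
  map_smul' c α := by rw [map_smul, Derivation.smul_apply, RingHom.id_apply]

end PreLieAlgebroid

/-- Change of the name of the degree along an equality. -/
def castDeg {m n : ℕ} (h : m = n) (P : V [⋀^Fin m]→ₗ[R] R) : V [⋀^Fin n]→ₗ[R] R :=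
  P.domDomCongr (finCongr h)

/-- A section of the dual bundle, as a form of degree one. -/
def oneForm (α : Module.Dual R V) : V [⋀^Fin 1]→ₗ[R] R :=
  AlternatingMap.ofSubsingleton R V R 0 α

/-- The wedge product (sum over shuffles), placed in degree `n = p + q`. -/
def wedge {p q n : ℕ} (h : p + q = n) (P : V [⋀^Fin p]→ₗ[R] R) (Q : V [⋀^Fin q]→ₗ[R] R) :
    V [⋀^Fin n]→ₗ[R] R :=
  castDeg h (((LinearMap.mul' R R).compAlternatingMap (P.domCoprod Q)).domDomCongr finSumFinEquiv)

theorem wedge_add {p q n : ℕ} (h : p + q = n) (P : V [⋀^Fin p]→ₗ[R] R)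
    (Q Q' : V [⋀^Fin q]→ₗ[R] R) : wedge h P (Q + Q') = wedge h P Q + wedge h P Q' := by
  have h1 : P.domCoprod (Q + Q') = P.domCoprod Q + P.domCoprod Q' := by
    simp only [← AlternatingMap.domCoprod'_apply, TensorProduct.tmul_add, map_add]
  ext v
  simp [wedge, castDeg, h1]

theorem wedge_smul {p q n : ℕ} (h : p + q = n) (P : V [⋀^Fin p]→ₗ[R] R) (c : R)
    (Q : V [⋀^Fin q]→ₗ[R] R) : wedge h P (c • Q) = c • wedge h P Q := by
  have h1 : P.domCoprod (c • Q) = c • P.domCoprod Q := by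
    simp only [← AlternatingMap.domCoprod'_apply, TensorProduct.tmul_smul, map_smul]
  ext v
  simp [wedge, castDeg, h1]

namespace PreLieAlgebroid

/-- The Schouten bracket on the multisections of `A`, in degree `n = p + q - 1`, where
`[P, f] = (-1)^(p+1) i_(df) P` and `[f, Q] = -i_(df) Q` for a function `f`.
The bracket of two functions is zero; it has no degree here. -/
def schouten (𝒜 : PreLieAlgebroid R (Module.Dual R V)) : ∀ {p q n : ℕ}, p + q = n + 1 →
    V [⋀^Fin p]→ₗ[R] R → V [⋀^Fin q]→ₗ[R] R → V [⋀^Fin n]→ₗ[R] R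
  | 0, 0, _, h, _, _ => absurd h (by omega)
  | a + 1, 0, _, h, P, f => castDeg (by omega : a = _)
      ((𝒜.anchorApply (f ![])).compAlternatingMap (lastSlot P))
  | 0, b + 1, _, h, f, Q => castDeg (by omega : b = _)
      (-(𝒜.anchorApply (f ![])).compAlternatingMap (firstSlot Q))
  | a + 1, b + 1, _, h, P, Q => castDeg (by omega : a + 1 + b = _) (𝒜.schoutenPos P Q)

end PreLieAlgebroid

/-- `P ∧ i_φ Q` (zero if `Q` is a function), where `i_φ Q = Q(φ, -, …, -)`. -/
def wedgeContract (φ : V) : ∀ {p q n : ℕ}, p + q = n + 1 →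
    V [⋀^Fin p]→ₗ[R] R → V [⋀^Fin q]→ₗ[R] R → V [⋀^Fin n]→ₗ[R] R
  | _, 0, _, _, _, _ => 0
  | _, _ + 1, _, h, P, Q => wedge (by omega) P (Q.curryLeft φ)

/-- `i_φ P ∧ Q` (zero if `P` is a function). -/
def contractWedge (φ : V) : ∀ {p q n : ℕ}, p + q = n + 1 →
    V [⋀^Fin p]→ₗ[R] R → V [⋀^Fin q]→ₗ[R] R → V [⋀^Fin n]→ₗ[R] R
  | 0, _, _, _, _, _ => 0
  | _ + 1, _, _, h, P, Q => wedge (by omega) (P.curryLeft φ) Q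

/-- The Schouten-Jacobi bracket
`[P, Q]^φ = [P, Q] + (p-1) P ∧ i_φ Q - (-1)^(p-1) (q-1) i_φ P ∧ Q`
on the multisections of `A`, for a section `φ` of `A*`. -/
def jacobiBracket (𝒜 : PreLieAlgebroid R (Module.Dual R V)) (φ : V) {p q n : ℕ}
    (h : p + q = n + 1) (P : V [⋀^Fin p]→ₗ[R] R) (Q : V [⋀^Fin q]→ₗ[R] R) :
    V [⋀^Fin n]→ₗ[R] R :=
  𝒜.schouten h P Q + ((p : ℤ) - 1) • wedgeContract φ h P Q
    - ((-1) ^ (p + 1) * ((q : ℤ) - 1)) • contractWedge φ h P Q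

/-- Lie algebroids: the bracket satisfies the Jacobi identity and the anchor preserves brackets. -/
structure IsLieAlgebroid {L : Type*} [AddCommGroup L] [Module R L] (𝒜 : PreLieAlgebroid R L) :
    Prop where
  jacobi : ∀ x y z, 𝒜.bracket x (𝒜.bracket y z) =
    𝒜.bracket (𝒜.bracket x y) z + 𝒜.bracket y (𝒜.bracket x z)
  anchor_bracket : ∀ x y, 𝒜.anchor (𝒜.bracket x y) = ⁅𝒜.anchor x, 𝒜.anchor y⁆

/-- `(A, φ)` is a Jacobi algebroid: `A` is a Lie algebroid and the section `φ` of `A*` is a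
`1`-cocycle. -/
structure IsJacobiAlgebroid (𝒜 : PreLieAlgebroid R (Module.Dual R V)) (φ : V) : Prop where
  isLieAlgebroid : IsLieAlgebroid 𝒜
  cocycle : ∀ α β, 𝒜.dDual φ α β = 0

/-- `D` is a `W`-quasi differential on the Jacobi algebroid `(A, φ)`, for a section `W` of `A`.
In the second condition the bracket of two functions is zero, whence the two cases. -/
structure IsQuasiDifferential (𝒜 : PreLieAlgebroid R (Module.Dual R V)) (φ : V)
    (W : Module.Dual R V)
    (D : ∀ k : ℕ, (V [⋀^Fin k]→ₗ[R] R) →ₗ[ℝ] V [⋀^Fin (k + 1)]→ₗ[R] R) : Prop where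
  map_wedge : ∀ (p q : ℕ) (P : V [⋀^Fin p]→ₗ[R] R) (Q : V [⋀^Fin q]→ₗ[R] R),
    D (p + q) (wedge rfl P Q) =
      wedge (by omega) (D p P) Q + (-1 : ℤ) ^ p • wedge (by omega) P (D q Q)
        - wedge (by omega) (oneForm W) (wedge (rfl : p + q = p + q) P Q)
  map_bracket : ∀ (p q n : ℕ) (h : p + q = n + 1) (P : V [⋀^Fin p]→ₗ[R] R)
    (Q : V [⋀^Fin q]→ₗ[R] R),
    D n (jacobiBracket 𝒜 φ h P Q) =
      jacobiBracket 𝒜 φ (by omega) (D p P) Q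
        + (-1 : ℤ) ^ (p + 1) • jacobiBracket 𝒜 φ (by omega) P (D q Q)
  map_bracket_zero : ∀ f g : V [⋀^Fin 0]→ₗ[R] R,
    0 = jacobiBracket 𝒜 φ (p := 1) (q := 0) (n := 0) rfl (D 0 f) g
      + (-1 : ℤ) ^ (0 + 1) • jacobiBracket 𝒜 φ (p := 0) (q := 1) (n := 0) rfl f (D 0 g)

/-- `(A, φ, D, X)` is a quasi-Jacobi bialgebroid: `(A, φ)` is a Jacobi algebroid, `D` is a `W`-quasi
differential on it for some `W`, `X` is a `3`-section of `A`, `D X = 0` and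
`D² = [X, -]^φ`. -/
structure IsQuasiJacobiBialgebroid (𝒜 : PreLieAlgebroid R (Module.Dual R V)) (φ : V)
    (D : ∀ k : ℕ, (V [⋀^Fin k]→ₗ[R] R) →ₗ[ℝ] V [⋀^Fin (k + 1)]→ₗ[R] R)
    (X : V [⋀^Fin 3]→ₗ[R] R) : Prop where
  isJacobiAlgebroid : IsJacobiAlgebroid 𝒜 φ
  exists_isQuasiDifferential : ∃ W : Module.Dual R V, IsQuasiDifferential 𝒜 φ W D
  map_threeSection : D 3 X = 0
  map_map : ∀ (k : ℕ) (P : V [⋀^Fin k]→ₗ[R] R),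
    D (k + 1) (D k P) = jacobiBracket 𝒜 φ (by omega) X P

/-!
### Jacobi bivectors and the algebroid structure on the dual

Now `V = Γ(A)` and `Module.Dual R V = Γ(A*)`.
-/

/-- A bivector `π ∈ Γ(⋀² A)`, given by the skew-symmetric map `π♯ : Γ(A*) → Γ(A)` with
`⟨β, π♯ α⟩ = π(α, β)`. -/
structure Bivector (R : Type*) [CommRing R] (V : Type*) [AddCommGroup V] [Module R V] where
  sharp : Module.Dual R V →ₗ[R] V
  skew : ∀ α β : Module.Dual R V, β (sharp α) = - α (sharp β)

theorem Bivector.apply_self (π : Bivector R V) (α : Module.Dual R V) : α (π.sharp α) = 0 := by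
  have h := π.skew α α
  have h2 : (2 : ℝ) • α (π.sharp α) = 0 := by
    rw [two_smul]; nth_rw 2 [h]; exact add_neg_cancel _
  have h3 := congrArg (fun r => (2 : ℝ)⁻¹ • r) h2
  simpa [smul_smul] using h3

namespace PreLieAlgebroid

variable (𝒜 : PreLieAlgebroid R V)

/-- `ℒ^φ_x β = ℒ_x β + ⟨φ, x⟩ β`, with `⟨ℒ_x β, v⟩ = ρ(x)⟨β, v⟩ - ⟨β, [x, v]⟩`. -/
def lieDeriv (φ : Module.Dual R V) (x : V) (β : Module.Dual R V) : Module.Dual R V where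
  toFun v := 𝒜.anchor x (β v) - β (𝒜.bracket x v) + φ x * β v
  map_add' v w := by simp only [map_add, 𝒜.bracket_add]; ring
  map_smul' c v := by
    simp only [map_smul, 𝒜.bracket_smul, map_add, smul_eq_mul, Derivation.leibniz,
      RingHom.id_apply]
    ring

/-- `d^φ f = df + f φ`, for a function `f`. -/
def dFun (φ : Module.Dual R V) (f : R) : Module.Dual R V where
  toFun v := 𝒜.anchor v f + φ v * f
  map_add' v w := by simp only [map_add, Derivation.add_apply]; ring
  map_smul' c v := by
    simp only [map_smul, smul_eq_mul, Derivation.smul_apply, RingHom.id_apply]; ring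

/-- `[α, β]_S = ℒ^φ_(S α) β - ℒ^φ_(S β) α - d^φ ⟨β, S α⟩`, for `S = π♯` the bracket on `Γ(A*)`
defined by `π`. -/
def dualBracket (φ : Module.Dual R V) (S : Module.Dual R V →ₗ[R] V) (α β : Module.Dual R V) :
    Module.Dual R V :=
  𝒜.lieDeriv φ (S α) β - 𝒜.lieDeriv φ (S β) α - 𝒜.dFun φ (β (S α))

/-- The bracket `[-, -]_π` and the anchor `ρ ∘ π♯` on `A*`. -/
def dual (φ : Module.Dual R V) (π : Bivector R V) : PreLieAlgebroid R (Module.Dual R V) where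
  anchor := 𝒜.anchor ∘ₗ π.sharp
  bracket := 𝒜.dualBracket φ π.sharp
  bracket_self α := by
    ext v
    simp [dualBracket, dFun, π.apply_self]
  add_bracket α β γ := by
    ext v
    simp only [dualBracket, dFun, lieDeriv, LinearMap.sub_apply, LinearMap.coe_mk, AddHom.coe_mk,
      LinearMap.add_apply, map_add, Derivation.add_apply, 𝒜.add_bracket]
    ring
  bracket_add α β γ := by
    ext v
    simp only [dualBracket, dFun, lieDeriv, LinearMap.sub_apply, LinearMap.coe_mk, AddHom.coe_mk,
      LinearMap.add_apply, map_add, Derivation.add_apply, 𝒜.add_bracket]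
    ring
  bracket_smul α f β := by
    ext v
    simp only [dualBracket, dFun, lieDeriv, LinearMap.sub_apply, LinearMap.coe_mk, AddHom.coe_mk,
      LinearMap.add_apply, LinearMap.smul_apply, map_smul, Derivation.smul_apply, smul_eq_mul,
      Derivation.leibniz, 𝒜.smul_bracket, map_sub, LinearMap.comp_apply, π.skew α β]
    ring

/-- The bracket `[x, y]_N = [N x, y] + [x, N y] - N [x, y]` and the anchor `ρ ∘ N`. -/
def deform (N : V →ₗ[R] V) : PreLieAlgebroid R V where
  anchor := 𝒜.anchor ∘ₗ N
  bracket x y := 𝒜.bracket (N x) y + 𝒜.bracket x (N y) - N (𝒜.bracket x y)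
  bracket_self x := by
    rw [𝒜.bracket_self, map_zero, sub_zero, 𝒜.bracket_swap (N x) x, neg_add_cancel]
  add_bracket x y z := by simp only [map_add, 𝒜.add_bracket]; abel
  bracket_add x y z := by simp only [map_add, 𝒜.bracket_add]; abel
  bracket_smul x f y := by
    simp only [map_smul, 𝒜.bracket_smul, map_add, LinearMap.comp_apply, smul_sub, smul_add]
    abel

/-- The torsion `𝒯_N(x, y) = [N x, N y] - N [x, y]_N`. -/
def torsion (N : V →ₗ[R] V) (x y : V) : V :=
  𝒜.bracket (N x) (N y) - N ((𝒜.deform N).bracket x y)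

/-- The `φ`-twisted differential `d^φ α = dα + φ ∧ α`. -/
def twistedD (φ : Module.Dual R V) (k : ℕ) :
    (V [⋀^Fin k]→ₗ[R] R) →ₗ[ℝ] V [⋀^Fin (k + 1)]→ₗ[R] R where
  toFun α := 𝒜.d α + wedge (Nat.add_comm 1 k) (oneForm φ) α
  map_add' α β := by rw [map_add, wedge_add]; abel
  map_smul' c α := by
    have h : c • α = algebraMap ℝ R c • α := by ext v; simp [Algebra.smul_def]
    have h2 : ∀ β : V [⋀^Fin (k + 1)]→ₗ[R] R, c • β = algebraMap ℝ R c • β := by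
      intro β; ext v; simp [Algebra.smul_def]
    rw [map_smul, h, wedge_smul, RingHom.id_apply, smul_add, ← h2]

/-- `N` is compatible with `π`: `N π♯ = π♯ N*` and
`[α, β]_(Nπ) = [N* α, β]_π + [α, N* β]_π - N* [α, β]_π`. -/
structure IsCompatible (φ : Module.Dual R V) (π : Bivector R V) (N : V →ₗ[R] V) : Prop where
  comm : ∀ α, N (π.sharp α) = π.sharp (α ∘ₗ N)
  concomitant : ∀ α β, 𝒜.dualBracket φ (N ∘ₗ π.sharp) α β =
    𝒜.dualBracket φ π.sharp (α ∘ₗ N) β + 𝒜.dualBracket φ π.sharp α (β ∘ₗ N)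
      - (𝒜.dualBracket φ π.sharp α β) ∘ₗ N

end PreLieAlgebroid

/-- `i_(x ∧ y) η = i_x (i_y η)`, that is `z ↦ η(y, x, z)`, for a `3`-form `η`. -/
def contractTwo (x y : V) (η : V [⋀^Fin 3]→ₗ[R] R) : Module.Dual R V :=
  (AlternatingMap.ofSubsingleton R V R (0 : Fin 1)).symm ((η.curryLeft y).curryLeft x)

/-!
### Jacobi manifolds

`R` is the algebra of smooth functions of the manifold and `Derivation ℝ R R` is the module of its
vector fields. A section `(X, f)` of `TM × ℝ` is an element of `Derivation ℝ R R × R`.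
-/

section Manifold

variable (R)

/-- The tangent Lie algebroid `TM`. -/
def tangent : PreLieAlgebroid R (Derivation ℝ R R) where
  anchor := LinearMap.id
  bracket X Y := ⁅X, Y⁆
  bracket_self X := lie_self X
  add_bracket X Y Z := add_lie X Y Z
  bracket_add X Y Z := lie_add X Y Z
  bracket_smul X f Y := by
    ext h
    simp only [Derivation.commutator_apply, Derivation.smul_apply, Derivation.add_apply,
      smul_eq_mul, Derivation.leibniz, LinearMap.id_apply]
    ring

/-- The Lie algebroid `TM × ℝ`: `[(X, f), (Y, g)] = ([X, Y], X g - Y f)` and `ρ(X, f) = X`. -/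
def tangentTimes : PreLieAlgebroid R (Derivation ℝ R R × R) where
  anchor := LinearMap.fst R (Derivation ℝ R R) R
  bracket u v := (⁅u.1, v.1⁆, u.1 v.2 - v.1 u.2)
  bracket_self u := by simp
  add_bracket u v w := by
    ext : 1
    · exact add_lie u.1 v.1 w.1
    · simp only [Prod.fst_add, Prod.snd_add, Derivation.add_apply, map_add]; ring
  bracket_add u v w := by
    ext : 1
    · exact lie_add u.1 v.1 w.1
    · simp only [Prod.fst_add, Prod.snd_add, Derivation.add_apply, map_add]; ring
  bracket_smul u f v := by
    ext : 1
    · exact (tangent R).bracket_smul u.1 f v.1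
    · simp only [Prod.smul_fst, Prod.smul_snd, Prod.snd_add, Derivation.smul_apply, smul_eq_mul,
        Derivation.leibniz, LinearMap.fst_apply]
      ring

/-- The `1`-cocycle `(0, 1)` of `TM × ℝ`: `⟨(0, 1), (X, f)⟩ = f`. -/
def cocycleOne : Module.Dual R (Derivation ℝ R R × R) :=
  LinearMap.snd R (Derivation ℝ R R) R

variable {R}

/-- The Jacobi bracket of functions `{f, h} = Λ(df, dh) + f E(h) - h E(f)`. -/
def functionBracket (Λ : Bivector R (Derivation ℝ R R)) (E : Derivation ℝ R R) (f h : R) : R :=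
  Λ.sharp ((tangent R).dFun 0 f) h + f * E h - h * E f

/-- `(Λ, E)` is a Jacobi structure: the bracket `{-, -}` of functions satisfies the Jacobi
identity. -/
def IsJacobiStructure (Λ : Bivector R (Derivation ℝ R R)) (E : Derivation ℝ R R) : Prop :=
  ∀ f g h : R,
    functionBracket Λ E f (functionBracket Λ E g h)
      + functionBracket Λ E g (functionBracket Λ E h f)
      + functionBracket Λ E h (functionBracket Λ E f g) = 0

/-- The bivector `(Λ, E)` of `TM × ℝ`:
`(Λ, E)♯(α, f) = (Λ♯ α + f E, -⟨α, E⟩)`, where `(α, f) ∈ Γ(T*M × ℝ)` is the section with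
`⟨(α, f), (X, h)⟩ = ⟨α, X⟩ + f h`. -/
def pairBivector (Λ : Bivector R (Derivation ℝ R R)) (E : Derivation ℝ R R) :
    Bivector R (Derivation ℝ R R × R) where
  sharp :=
    { toFun := fun ζ => (Λ.sharp (ζ ∘ₗ LinearMap.inl R (Derivation ℝ R R) R) + ζ (0, 1) • E,
        -ζ (E, 0))
      map_add' := fun ζ ξ => by
        ext : 1
        · simp only [LinearMap.add_comp, map_add, LinearMap.add_apply, add_smul, Prod.fst_add]; abel
        · simp only [LinearMap.add_apply, Prod.snd_add]; ring
      map_smul' := fun c ζ => by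
        ext : 1
        · simp only [LinearMap.smul_comp, map_smul, LinearMap.smul_apply, smul_assoc,
            Prod.smul_fst, smul_add, RingHom.id_apply]
        · simp only [LinearMap.smul_apply, Prod.smul_snd, smul_neg, RingHom.id_apply] }
  skew ζ ξ := by
    have key : ∀ (ζ : Module.Dual R (Derivation ℝ R R × R)) (X : Derivation ℝ R R) (f : R),
        ζ (X, f) = (ζ ∘ₗ LinearMap.inl R (Derivation ℝ R R) R) X + f * ζ (0, 1) := by
      intro ζ X f
      have h : (X, f) = (X, 0) + f • ((0, 1) : Derivation ℝ R R × R) := by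
        ext : 1 <;> simp
      rw [h, map_add, map_smul, smul_eq_mul]; rfl
    have h := Λ.skew (ζ ∘ₗ LinearMap.inl R (Derivation ℝ R R) R)
      (ξ ∘ₗ LinearMap.inl R (Derivation ℝ R R) R)
    simp only [LinearMap.coe_mk, AddHom.coe_mk]
    rw [key ξ, key ζ (Λ.sharp _ + _), map_add, map_add, map_smul, map_smul, h]
    simp only [LinearMap.comp_apply, LinearMap.inl_apply, smul_eq_mul]
    ring

/-- The map `𝒩 = (N, Y, γ, g)` of `TM × ℝ`: `𝒩(X, f) = (N X + f Y, ⟨γ, X⟩ + f g)`. -/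
def pairMap (N : Derivation ℝ R R →ₗ[R] Derivation ℝ R R) (Y : Derivation ℝ R R)
    (γ : Module.Dual R (Derivation ℝ R R)) (g : R) :
    Derivation ℝ R R × R →ₗ[R] Derivation ℝ R R × R :=
  LinearMap.prod
    (N ∘ₗ LinearMap.fst R (Derivation ℝ R R) R
      + (LinearMap.snd R (Derivation ℝ R R) R).smulRight Y)
    (γ ∘ₗ LinearMap.fst R (Derivation ℝ R R) R + g • LinearMap.snd R (Derivation ℝ R R) R)

/-- The section `(α, f)` of `T*M × ℝ`. -/
def pairOneForm (α : Module.Dual R (Derivation ℝ R R)) (f : R) :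
    Module.Dual R (Derivation ℝ R R × R) :=
  α ∘ₗ LinearMap.fst R (Derivation ℝ R R) R + f • LinearMap.snd R (Derivation ℝ R R) R

/-- The section `(η, ω₂)` of `⋀³(T*M × ℝ)` for `η ∈ Ω³(M)`, `ω₂ ∈ Ω²(M)`:
`(η, ω₂)((X₁, f₁), (X₂, f₂), (X₃, f₃)) =
  η(X₁, X₂, X₃) + f₁ ω₂(X₂, X₃) - f₂ ω₂(X₁, X₃) + f₃ ω₂(X₁, X₂)`. -/
def pairThreeForm (η : Derivation ℝ R R [⋀^Fin 3]→ₗ[R] R) (ω₂ : Derivation ℝ R R [⋀^Fin 2]→ₗ[R] R) :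
    (Derivation ℝ R R × R) [⋀^Fin 3]→ₗ[R] R :=
  η.compLinearMap (LinearMap.fst R (Derivation ℝ R R) R)
    + wedge (rfl : 1 + 2 = 3) (oneForm (cocycleOne R))
        (ω₂.compLinearMap (LinearMap.fst R (Derivation ℝ R R) R))

/-- The `3`-section `(dω₂, ω₂)`. -/
def threeFormOf (ω₂ : Derivation ℝ R R [⋀^Fin 2]→ₗ[R] R) :
    (Derivation ℝ R R × R) [⋀^Fin 3]→ₗ[R] R :=
  pairThreeForm ((tangent R).d ω₂) ω₂

/-- `(M, (Λ, E), 𝒩, ω₂)` is a Jacobi quasi-Nijenhuis manifold. -/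
structure IsJacobiQuasiNijenhuis (Λ : Bivector R (Derivation ℝ R R)) (E : Derivation ℝ R R)
    (𝒩 : Derivation ℝ R R × R →ₗ[R] Derivation ℝ R R × R)
    (ω₂ : Derivation ℝ R R [⋀^Fin 2]→ₗ[R] R) : Prop where
  isJacobiStructure : IsJacobiStructure Λ E
  isCompatible : (tangentTimes R).IsCompatible (cocycleOne R) (pairBivector Λ E) 𝒩
  torsion_eq : ∀ x y, (tangentTimes R).torsion 𝒩 x y =
    -(pairBivector Λ E).sharp (contractTwo x y (threeFormOf ω₂))
  closed : (tangentTimes R).twistedD (cocycleOne R) 3 (insertSum 𝒩 (threeFormOf ω₂)) = 0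

/-- The bracket and the anchor of `(T*M × ℝ)_(Λ, E)`. -/
def jacobiDual (Λ : Bivector R (Derivation ℝ R R)) (E : Derivation ℝ R R) :
    PreLieAlgebroid R (Module.Dual R (Derivation ℝ R R × R)) :=
  (tangentTimes R).dual (cocycleOne R) (pairBivector Λ E)

end Manifold

/-- The algebra of smooth functions on a manifold modelled on `F`. -/
abbrev SmoothFunctions (F : Type*) [NormedAddCommGroup F] [NormedSpace ℝ F] (M : Type*)
    [TopologicalSpace M] [ChartedSpace F M] : Type _ :=
  C^∞⟮𝓘(ℝ, F), M; ℝ⟯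

/-- The module of smooth vector fields on a manifold modelled on `F`. -/
abbrev VectorFields (F : Type*) [NormedAddCommGroup F] [NormedSpace ℝ F] (M : Type*)
    [TopologicalSpace M] [ChartedSpace F M] : Type _ :=
  Derivation ℝ (SmoothFunctions F M) (SmoothFunctions F M)

end JacobiGeom

end

noncomputable section

namespace JacobiGeom

set_option linter.all false

section

variable {R : Type*} [CommRing R] [Algebra ℝ R] {V : Type*} [AddCommGroup V] [Module R V]

/-! ### Signed sums over permutations and shuffle products -/

/-! Write `A = TM × ℝ`, `φ = (0, 1)`, `π = (Λ, E)`, `V = Γ(A)` and `X = (dω, ω)`; let `d` be the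
`φ`-twisted differential of `A`, `i_T` the insertion of an endomorphism, and `m` the contraction of
two forms through `π♯`. Multisections of `A*` are alternating forms on `V`. The tool throughout is
induction on the degree (`Forms.eq_zero_of_interior`): an identity between operators holds if it
holds on functions and if contracting its defect with a vector gives defects of the same kind in
lower degree.

Three formulas carry the proof. First, the Schouten-Jacobi bracket of the dual algebroid is
generated by `d`, namely `[P, Q] = m(P, dQ) + (-1)^p m(dP, Q) - (-1)^p d m(P, Q)`
(`jacobiBracket_dual`). Both sides obey the same recursion, since the twisted differential on `A*`
of a section `v` of `A` is minus the Lie derivative of `π` along `v` (`twistedDDual_dual`). As `d² =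
0`, `d` is a derivation of this bracket (`diff_koszul`). Second, the deformed twisted differential
is a commutator, `d_N = i_N d - d i_N` (`diff_deform`). Third, if the torsion of `N` is `π♯` of
contractions of `X`, then `[i_N, d_N] - [i_(N²), d] = -2 m(X, -)` (`insertion_diff_deform`).

From quasi-Nijenhuis to bialgebroid: compatibility says that `i_N` is a derivation of the bracket of
`π` up to the bracket of `Nπ`, and this error cancels in the commutator with `d`; so `d_N` is a
derivation, with `W = N*φ = (γ, g)`. Composing the third formula with `d` on either side and adding
gives `d_N² = [X, -]`. As `X = d(pr*ω)` is closed, `d_N X = -d(i_N X)`, and the two closedness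
conditions coincide.

Conversely, low degrees suffice. The derivation rule on two functions gives `N π♯ = π♯ N*`; on a
section and a function it kills the concomitant on `(α, df)`; and `d_N² f = [X, f]` gives the
torsion. These conclusions, and the Jacobi identity of the dual algebroid, are first obtained on the
sections `df` of `A*`. They extend because the `df` separate sections of `A` and generate `Γ(A*)`
locally, a consequence of Hadamard's lemma (`exists_local_frame`, `eq_zero_of_dFun_eq_zero`). -/

/-- The signed sum of a function over the permutations of its arguments. -/
def permSum {n : ℕ} (T : (Fin n → V) → R) (v : Fin n → V) : R :=
  ∑ σ : Equiv.Perm (Fin n), Equiv.Perm.sign σ • T (v ∘ σ)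

/-- Laplace expansion: a permutation is determined by the place `j` that receives the first argument
and by the permutation of the remaining ones. All degree recursions below start from this. -/
theorem permSum_cons {n : ℕ} (T : (Fin (n + 1) → V) → R) (x : V) (u : Fin n → V) :
    permSum T (Fin.cons x u : Fin (n + 1) → V) =
      ∑ j : Fin (n + 1), (-1 : ℤ) ^ (j : ℕ) • permSum (fun w => T (j.insertNth x w)) u := by
  -- `j.cycleRange` carries `j` to `0`, with sign `(-1)^j`; the second factor then fixes `0` and
  -- permutes the rest by `τ`. Bijectivity follows from injectivity by counting.
  let e : Fin (n + 1) × Equiv.Perm (Fin n) → Equiv.Perm (Fin (n + 1)) :=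
    fun q => Equiv.Perm.decomposeFin.symm (0, q.2) * q.1.cycleRange
  have he0 : ∀ q : Fin (n + 1) × Equiv.Perm (Fin n), e q q.1 = 0 := by
    intro q
    simp [e, Equiv.Perm.mul_apply]
  have he : ∀ (q : Fin (n + 1) × Equiv.Perm (Fin n)) (k : Fin n),
      e q (q.1.succAbove k) = (q.2 k).succ := by
    intro q k
    simp [e, Equiv.Perm.mul_apply, Fin.cycleRange_succAbove]
  have hinj : Function.Injective e := by
    rintro ⟨j, τ⟩ ⟨j', τ'⟩ h
    have hj : j = j' := by
      apply (e (j, τ)).injective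
      rw [he0 (j, τ), h, he0 (j', τ')]
    subst hj
    congr 1
    ext k
    have := he (j, τ) k
    rw [h, he (j, τ') k] at this
    exact congrArg Fin.val (Fin.succ_injective _ this).symm
  have hbij : Function.Bijective e := by
    rw [Fintype.bijective_iff_injective_and_card]
    refine ⟨hinj, ?_⟩
    simp [Fintype.card_perm, Nat.factorial_succ]
  have hcomp : ∀ q : Fin (n + 1) × Equiv.Perm (Fin n),
      (Fin.cons x u : Fin (n + 1) → V) ∘ e q = q.1.insertNth x (u ∘ q.2) := by
    intro q
    rw [Fin.eq_insertNth_iff]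
    constructor
    · rw [Function.comp_apply, he0, Fin.cons_zero]
    · funext k
      rw [Fin.removeNth_apply, Function.comp_apply, he, Fin.cons_succ, Function.comp_apply]
  have hsign : ∀ q : Fin (n + 1) × Equiv.Perm (Fin n),
      Equiv.Perm.sign (e q) = (-1) ^ (q.1 : ℕ) * Equiv.Perm.sign q.2 := by
    intro q
    simp only [e, Equiv.Perm.sign_mul, Fin.sign_cycleRange, Equiv.Perm.decomposeFin.symm_sign]
    simp [mul_comm]
  unfold permSum
  rw [← hbij.sum_comp, Fintype.sum_prod_type]
  refine Finset.sum_congr rfl fun j _ => ?_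
  rw [Finset.smul_sum]
  refine Finset.sum_congr rfl fun τ _ => ?_
  rw [hcomp, hsign, mul_smul]
  simp only [Units.smul_def, Units.val_pow_eq_pow_val, Units.val_neg, Units.val_one]

theorem permSum_zero {n : ℕ} (u : Fin n → V) : permSum (fun _ => (0 : R)) u = 0 := by
  simp [permSum]

theorem permSum_zsmul {n : ℕ} (c : ℤ) (T : (Fin n → V) → R) (u : Fin n → V) :
    permSum (fun w => c • T w) u = c • permSum T u := by
  unfold permSum
  rw [Finset.smul_sum]
  exact Finset.sum_congr rfl fun σ _ => smul_comm _ _ _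

/-- The arguments number `s, …, s + l - 1`. -/
def block {n : ℕ} (s l : ℕ) (w : Fin n → V) : Fin l → V :=
  -- The default `0` allows lengths such as `p - 1` without casts; where the lengths do not fit, one
  -- of the factors to be multiplied is the zero form.
  fun i => if h : s + i < n then w ⟨s + i, h⟩ else 0

theorem insertNth_mk_apply {n : ℕ} (j : Fin (n + 1)) (x : V) (w : Fin n → V) (k : ℕ)
    (hk : k < n + 1) :
    (j.insertNth x w : Fin (n + 1) → V) ⟨k, hk⟩ =
      if h : k < j then w ⟨k, by omega⟩ else if h : k = j then x else w ⟨k - 1, by omega⟩ := by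
  split_ifs with h1 h2
  · have : (⟨k, hk⟩ : Fin (n + 1)) = j.succAbove ⟨k, by omega⟩ := by
      rw [Fin.succAbove_of_castSucc_lt _ _ (by simpa [Fin.lt_def] using h1)]; rfl
    rw [this, Fin.insertNth_apply_succAbove]
  · have : (⟨k, hk⟩ : Fin (n + 1)) = j := Fin.ext h2
    rw [this, Fin.insertNth_apply_same]
  · have : (⟨k, hk⟩ : Fin (n + 1)) = j.succAbove ⟨k - 1, by omega⟩ := by
      rw [Fin.succAbove_of_le_castSucc _ _ (by simp [Fin.le_def]; omega)]
      ext; simp; omega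
    rw [this, Fin.insertNth_apply_succAbove]

/-- An argument inserted at place `j` shifts a block that starts after `j`, leaves alone one that
ends before `j`, and enlarges one that contains `j`; this lemma and the next two are these cases. -/
theorem block_insertNth_before {n s l : ℕ} (j : Fin (n + 1)) (hj : (j : ℕ) < s + 1) (x : V)
    (w : Fin n → V) : block (s + 1) l (j.insertNth x w : Fin (n + 1) → V) = block s l w := by
  funext i
  unfold block
  by_cases h : s + 1 + i < n + 1
  · rw [dif_pos h, insertNth_mk_apply, dif_neg (by omega), dif_neg (by omega), dif_pos (by omega)]
    congr 2; omega
  · rw [dif_neg h, dif_neg (by omega)]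

theorem block_insertNth_after {n s l : ℕ} (j : Fin (n + 1)) (hj : s + l ≤ (j : ℕ)) (x : V)
    (w : Fin n → V) : block s l (j.insertNth x w : Fin (n + 1) → V) = block s l w := by
  funext i
  unfold block
  rw [dif_pos (by omega : s + (i : ℕ) < n + 1), insertNth_mk_apply, dif_pos (by omega),
    dif_pos (by omega)]

theorem block_insertNth_mem {n s l : ℕ} (i : Fin (l + 1)) (j : Fin (n + 1))
    (hj : (j : ℕ) = s + i) (x : V) (w : Fin n → V) (h : s + l ≤ n) :
    block s (l + 1) (j.insertNth x w : Fin (n + 1) → V) = i.insertNth x (block s l w) := by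
  funext k
  obtain ⟨k, hk⟩ := k
  rw [insertNth_mk_apply]
  unfold block
  rw [dif_pos (by simp; omega), insertNth_mk_apply]
  by_cases h1 : k < i
  · rw [dif_pos h1, dif_pos (by simp; omega), dif_pos (by simp; omega)]
  · by_cases h2 : k = i
    · rw [dif_neg h1, dif_pos h2, dif_neg (by simp; omega), dif_pos (by simp; omega)]
    · rw [dif_neg h1, dif_neg h2, dif_neg (by simp; omega), dif_neg (by simp; omega),
        dif_pos (by simp; omega)]
      congr 2; simp; omega

variable {U U₁ U₂ : Type*} [AddCommGroup U] [Module R U] [AddCommGroup U₁] [Module R U₁]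
  [AddCommGroup U₂] [Module R U₂]

/-- `i_x P`, which is zero for `P` of degree zero. -/
def contr (x : V) : ∀ {p : ℕ}, V [⋀^Fin p]→ₗ[R] U → V [⋀^Fin (p - 1)]→ₗ[R] U
  | 0, _ => 0
  | _ + 1, P => P.curryLeft x

/-- `∑ ± B(P(v_I), Q(v_J))`, summed over the shuffles. -/
def shuffle (B : U₁ →+ U₂ →+ R) {p q : ℕ} (P : V [⋀^Fin p]→ₗ[R] U₁) (Q : V [⋀^Fin q]→ₗ[R] U₂)
    {n : ℕ} (v : Fin n → V) : R :=
  (p.factorial * q.factorial : ℝ)⁻¹ • permSum (fun w => B (P (block 0 p w)) (Q (block p q w))) v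

/-- `∑ ± C(v_k)(P(v_I), Q(v_J))`, summed over the shuffles `(I, k, J)`. -/
def shuffleMid (C : V →+ U₁ →+ U₂ →+ R) {p q : ℕ} (P : V [⋀^Fin p]→ₗ[R] U₁)
    (Q : V [⋀^Fin q]→ₗ[R] U₂) {n : ℕ} (v : Fin n → V) : R :=
  (p.factorial * q.factorial : ℝ)⁻¹ • permSum (fun w => C (block p 1 w 0) (P (block 0 p w))
    (Q (block (p + 1) q w))) v

theorem sum_fin_split {n p q : ℕ} (h : p + q = n) (f : Fin n → R) :
    ∑ j, f j = ∑ i : Fin p, f ⟨i, by omega⟩ + ∑ i : Fin q, f ⟨p + i, by omega⟩ := by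
  subst h
  rw [Fin.sum_univ_add]
  rfl

/-- Moving `x` from place `i` of the block of `Q` to its front costs `(-1)^i`, which cancels against
the sign of the expansion. The `q` places in the block therefore contribute equally, and only
`(-1)^s` remains. By `hG` the other factor does not see `x`. -/
theorem sum_contr {s q : ℕ} (Q : V [⋀^Fin q]→ₗ[R] U) (x : V) {n : ℕ}
    (hn : s + q ≤ n + 1) (g : (Fin n → V) → U →+ R) (u : Fin n → V) (G : (Fin (n + 1) → V) → U →+ R)
    (hG : ∀ (i : Fin q) (w : Fin n → V),
      G ((⟨s + i, by omega⟩ : Fin (n + 1)).insertNth x w) = g w) :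
    ∑ i : Fin q, (-1 : ℤ) ^ (s + i : ℕ) • permSum (fun w =>
        G ((⟨s + i, by omega⟩ : Fin (n + 1)).insertNth x w) (Q (block s q
        ((⟨s + i, by omega⟩ : Fin (n + 1)).insertNth x w : Fin (n + 1) → V)))) u =
      (-1 : ℤ) ^ s • q • permSum (fun w => g w (contr x Q (block s (q - 1) w))) u := by
  rcases q with _ | q
  · simp
  · rw [Finset.sum_congr rfl (g := fun _ => (-1 : ℤ) ^ s •
      permSum (fun w => g w (contr x Q (block s q w))) u)]
    · simp [mul_left_comm]
    · intro i _
      rw [pow_add, mul_smul, ← permSum_zsmul]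
      congr 2
      funext w
      rw [block_insertNth_mem i _ (by simp) _ _ (by omega), AlternatingMap.map_insertNth, hG,
        map_zsmul, smul_smul, ← mul_pow]
      simp [contr]

theorem inv_factorial_mul (p : ℕ) (c : ℝ) (hp : p ≠ 0) :
    (p.factorial * c)⁻¹ * (p : ℝ) = ((p - 1).factorial * c)⁻¹ := by
  obtain ⟨p, rfl⟩ := Nat.exists_eq_succ_of_ne_zero hp
  have h1 : ((p : ℝ) + 1) ≠ 0 := by positivity
  simp only [Nat.factorial_succ, Nat.succ_eq_add_one, Nat.add_sub_cancel, mul_inv]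
  push_cast
  rw [mul_inv]
  field_simp

/-- Turns the factor `q` of `sum_contr` into the normalisation of a form of degree one less. For `p
= 0` the truncated `p - 1` is harmless, since then `s = 0`. -/
theorem inv_factorial_smul_nsmul {p : ℕ} (c : ℝ) (s : R) (hs : p = 0 → s = 0) :
    (p.factorial * c : ℝ)⁻¹ • (p • s) = ((p - 1).factorial * c : ℝ)⁻¹ • s := by
  by_cases hp : p = 0
  · rw [hs hp]; simp
  · rw [← Nat.cast_smul_eq_nsmul ℝ, smul_smul, inv_factorial_mul p c hp]

theorem contr_of_eq_zero {p : ℕ} (hp : p = 0) (x : V) (P : V [⋀^Fin p]→ₗ[R] U) (w) :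
    contr x P w = 0 := by
  subst hp; rfl

/-- Contraction is an antiderivation: `x` lands either among the arguments of `P` or, after passing
`p` places, among those of `Q`. -/
theorem shuffle_cons (B : U₁ →+ U₂ →+ R) {p q : ℕ} (P : V [⋀^Fin p]→ₗ[R] U₁)
    (Q : V [⋀^Fin q]→ₗ[R] U₂) {n : ℕ} (h : p + q = n + 1) (x : V) (u : Fin n → V) :
    shuffle B P Q (Fin.cons x u : Fin (n + 1) → V) =
      shuffle B (contr x P) Q u + (-1 : ℤ) ^ p • shuffle B P (contr x Q) u := by
  unfold shuffle
  rw [permSum_cons, sum_fin_split h, smul_add]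
  have e1 := sum_contr (s := 0) (q := p) P x (n := n) (by omega)
    (fun w => B.flip (Q (block (p - 1) q w))) u
    (fun w => B.flip (Q (block p q w))) (by
      intro i w
      obtain ⟨p', rfl⟩ : ∃ p', p = p' + 1 := ⟨p - 1, by have := i.2; omega⟩
      rw [block_insertNth_before _ (by simp; omega)]; rfl)
  have e2 := sum_contr (s := p) (q := q) Q x (n := n) (by omega) (fun w => B (P (block 0 p w))) u
    (fun w => B (P (block 0 p w))) (by
      intro i w
      rw [block_insertNth_after _ (by simp)])
  simp only [AddMonoidHom.flip_apply, zero_add, pow_zero, one_smul] at e1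
  rw [e1, e2]
  congr 1
  · rw [inv_factorial_smul_nsmul]
    intro hp
    simp [contr_of_eq_zero hp, permSum_zero]
  · rw [smul_comm, mul_comm, inv_factorial_smul_nsmul, mul_comm]
    intro hp
    simp [contr_of_eq_zero hp, permSum_zero]

/-- Here `x` may also land in the middle slot. That term is an ordinary shuffle with respect to `C
x`; it is the source of the error terms in the recursion for the Schouten bracket. -/
theorem shuffleMid_cons (C : V →+ U₁ →+ U₂ →+ R) {p q : ℕ} (P : V [⋀^Fin p]→ₗ[R] U₁)
    (Q : V [⋀^Fin q]→ₗ[R] U₂) {n : ℕ} (h : p + 1 + q = n + 1) (x : V) (u : Fin n → V) :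
    shuffleMid C P Q (Fin.cons x u : Fin (n + 1) → V) =
      shuffleMid C (contr x P) Q u + (-1 : ℤ) ^ p • shuffle (C x) P Q u
        + (-1 : ℤ) ^ (p + 1) • shuffleMid C P (contr x Q) u := by
  unfold shuffleMid shuffle
  rw [permSum_cons, sum_fin_split h, sum_fin_split (p := p) (q := 1) rfl, smul_add, smul_add]
  have e1 := sum_contr (s := 0) (q := p) P x (n := n) (by omega)
    (fun w => (C (block (p - 1) 1 w 0)).flip (Q (block (p - 1 + 1) q w))) u
    (fun w => (C (block p 1 w 0)).flip (Q (block (p + 1) q w))) (by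
      intro i w
      obtain ⟨p', rfl⟩ : ∃ p', p = p' + 1 := ⟨p - 1, by have := i.2; omega⟩
      rw [block_insertNth_before _ (by simp; omega), block_insertNth_before _ (by simp)]; rfl)
  have e2 := sum_contr (s := p + 1) (q := q) Q x (n := n) (by omega)
    (fun w => C (block p 1 w 0) (P (block 0 p w))) u
    (fun w => C (block p 1 w 0) (P (block 0 p w))) (by
      intro i w
      rw [block_insertNth_after _ (by simp), block_insertNth_after _ (by simp; omega)])
  simp only [AddMonoidHom.flip_apply, zero_add, pow_zero, one_smul] at e1
  rw [e1, e2]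
  congr 1
  · congr 1
    · rw [inv_factorial_smul_nsmul]
      intro hp
      simp [contr_of_eq_zero hp, permSum_zero]
    · rw [Fin.sum_univ_one, smul_comm]
      congr 3
      funext w
      have hx := block_insertNth_mem (s := p) (l := 0) 0 ⟨p + (0 : Fin 1), by simp; omega⟩ rfl x w
        (by omega)
      rw [hx, block_insertNth_after _ (by simp), block_insertNth_before _ (by simp)]
      simp
  · rw [smul_comm, mul_comm, inv_factorial_smul_nsmul, mul_comm]
    intro hp
    simp [contr_of_eq_zero hp, permSum_zero]

end

/-! ### Wedge products and the Schouten bracket as shuffle sums -/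

section

variable {R : Type*} [CommRing R] [Algebra ℝ R] {V : Type*} [AddCommGroup V] [Module R V]

variable {U U₁ U₂ : Type*} [AddCommGroup U] [Module R U] [AddCommGroup U₁] [Module R U₁]
  [AddCommGroup U₂] [Module R U₂]

/-- A bilinear map, regarded as a biadditive one. -/
def biadd (B : U₁ →ₗ[R] U₂ →ₗ[R] R) : U₁ →+ U₂ →+ R :=
  AddMonoidHom.mk' (fun a => (B a).toAddMonoidHom) fun a b => by ext; simp

@[simp] theorem biadd_apply (B : U₁ →ₗ[R] U₂ →ₗ[R] R) (a : U₁) (b : U₂) : biadd B a b = B a b := rfl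

/-- The wedge product of vector valued forms with respect to a pairing of the values. -/
def wedgeWith (B : U₁ →ₗ[R] U₂ →ₗ[R] R) {p q n : ℕ} (h : p + q = n) (P : V [⋀^Fin p]→ₗ[R] U₁)
    (Q : V [⋀^Fin q]→ₗ[R] U₂) : V [⋀^Fin n]→ₗ[R] R :=
  castDeg h (((TensorProduct.lift B).compAlternatingMap (P.domCoprod Q)).domDomCongr
    finSumFinEquiv)

theorem wedge_eq_wedgeWith {p q n : ℕ} (h : p + q = n) (P : V [⋀^Fin p]→ₗ[R] R)
    (Q : V [⋀^Fin q]→ₗ[R] R) : wedge h P Q = wedgeWith (LinearMap.mul R R) h P Q := rfl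

theorem block_castAdd {p q : ℕ} (w : Fin (p + q) → V) :
    block 0 p w = fun i => w (Fin.castAdd q i) := by
  funext i
  unfold block
  rw [dif_pos (by omega)]
  congr 1
  ext
  simp

theorem block_natAdd {p q : ℕ} (w : Fin (p + q) → V) :
    block p q w = fun i => w (Fin.natAdd p i) := by
  funext i
  unfold block
  rw [dif_pos (by omega)]
  rfl

/-- `domCoprod` has one term per shuffle, while the sum over all permutations counts each shuffle
`p! q!` times. -/
theorem wedgeWith_apply (B : U₁ →ₗ[R] U₂ →ₗ[R] R) {p q n : ℕ} (h : p + q = n)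
    (P : V [⋀^Fin p]→ₗ[R] U₁) (Q : V [⋀^Fin q]→ₗ[R] U₂) (v : Fin n → V) :
    wedgeWith B h P Q v = shuffle (biadd B) P Q v := by
  subst h
  have h1 := MultilinearMap.domCoprod_alternization_eq P Q
  have h2 := congrArg (fun f => TensorProduct.lift B (f (v ∘ finSumFinEquiv))) h1
  simp only [MultilinearMap.alternatization_apply, AlternatingMap.smul_apply, map_nsmul,
    Fintype.card_fin, map_sum] at h2
  have h3 : wedgeWith B rfl P Q v = TensorProduct.lift B (P.domCoprod Q (v ∘ finSumFinEquiv)) := by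
    simp [wedgeWith, castDeg]
  have hne : ((p.factorial * q.factorial : ℕ) : ℝ) ≠ 0 := by positivity
  have h4 : shuffle (biadd B) P Q v = ((p.factorial * q.factorial : ℕ) : ℝ)⁻¹ •
      ((p.factorial * q.factorial) • TensorProduct.lift B (P.domCoprod Q (v ∘ finSumFinEquiv))) := by
    rw [← h2, shuffle, Nat.cast_mul]
    congr 1
    unfold permSum
    refine Fintype.sum_equiv (finSumFinEquiv.symm.permCongr) _ _ fun σ => ?_
    rw [Equiv.Perm.sign_permCongr]
    simp only [Units.smul_def, map_zsmul]
    congr 1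
    simp only [MultilinearMap.domDomCongr_apply, MultilinearMap.domCoprod_apply,
      TensorProduct.lift.tmul, biadd_apply, AlternatingMap.coe_multilinearMap]
    congr 2 <;> congr 1 <;> funext i
    · simp [block_castAdd]
    · simp [block_natAdd]
  rw [h3, h4, ← Nat.cast_smul_eq_nsmul ℝ, smul_smul, inv_mul_cancel₀ hne, one_smul]

theorem shuffle_zero_left (B : U₁ →+ U₂ →+ R) {p q : ℕ} (Q : V [⋀^Fin q]→ₗ[R] U₂) {n : ℕ}
    (v : Fin n → V) : shuffle B (0 : V [⋀^Fin p]→ₗ[R] U₁) Q v = 0 := by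
  simp [shuffle, permSum_zero]

theorem shuffle_zero_right (B : U₁ →+ U₂ →+ R) {p q : ℕ} (P : V [⋀^Fin p]→ₗ[R] U₁) {n : ℕ}
    (v : Fin n → V) : shuffle B P (0 : V [⋀^Fin q]→ₗ[R] U₂) v = 0 := by
  simp [shuffle, permSum_zero]

theorem shuffleMid_zero_left (C : V →+ U₁ →+ U₂ →+ R) {p q : ℕ} (Q : V [⋀^Fin q]→ₗ[R] U₂) {n : ℕ}
    (v : Fin n → V) : shuffleMid C (0 : V [⋀^Fin p]→ₗ[R] U₁) Q v = 0 := by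
  simp [shuffleMid, permSum_zero]

theorem shuffleMid_zero_right (C : V →+ U₁ →+ U₂ →+ R) {p q : ℕ} (P : V [⋀^Fin p]→ₗ[R] U₁) {n : ℕ}
    (v : Fin n → V) : shuffleMid C P (0 : V [⋀^Fin q]→ₗ[R] U₂) v = 0 := by
  simp [shuffleMid, permSum_zero]

theorem permSum_neg {n : ℕ} (T : (Fin n → V) → R) (u : Fin n → V) :
    permSum (fun w => -T w) u = -permSum T u := by
  simpa using permSum_zsmul (-1) T u

theorem permSum_sub {n : ℕ} (T T' : (Fin n → V) → R) (u : Fin n → V) :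
    permSum (fun w => T w - T' w) u = permSum T u - permSum T' u := by
  simp [permSum, smul_sub]

theorem permSum_add {n : ℕ} (T T' : (Fin n → V) → R) (u : Fin n → V) :
    permSum (fun w => T w + T' w) u = permSum T u + permSum T' u := by
  simp [permSum, smul_add, Finset.sum_add_distrib]

theorem permSum_smul {n : ℕ} (c : ℝ) (T : (Fin n → V) → R) (u : Fin n → V) :
    permSum (fun w => c • T w) u = c • permSum T u := by
  unfold permSum
  rw [Finset.smul_sum]
  exact Finset.sum_congr rfl fun σ _ => smul_comm _ _ _

theorem shuffle_neg_right (B : U₁ →+ U₂ →+ R) {p q : ℕ} (P : V [⋀^Fin p]→ₗ[R] U₁)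
    (Q : V [⋀^Fin q]→ₗ[R] U₂) {n : ℕ} (v : Fin n → V) :
    shuffle B P (-Q) v = - shuffle B P Q v := by
  simp [shuffle, permSum_neg]

theorem shuffleMid_neg_right (C : V →+ U₁ →+ U₂ →+ R) {p q : ℕ} (P : V [⋀^Fin p]→ₗ[R] U₁)
    (Q : V [⋀^Fin q]→ₗ[R] U₂) {n : ℕ} (v : Fin n → V) :
    shuffleMid C P (-Q) v = - shuffleMid C P Q v := by
  simp [shuffleMid, permSum_neg]

/-- `lastSlot`, extended by zero to degree zero. -/
def lastArg : ∀ {p : ℕ}, V [⋀^Fin p]→ₗ[R] R → V [⋀^Fin (p - 1)]→ₗ[R] Module.Dual R V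
  | 0, _ => 0
  | _ + 1, P => lastSlot P

/-- `firstSlot`, extended by zero to degree zero. -/
def firstArg : ∀ {p : ℕ}, V [⋀^Fin p]→ₗ[R] R → V [⋀^Fin (p - 1)]→ₗ[R] Module.Dual R V
  | 0, _ => 0
  | _ + 1, P => firstSlot P

theorem lastArg_contr {p : ℕ} (x : V) (P : V [⋀^Fin p]→ₗ[R] R) :
    lastArg (contr x P) = contr x (lastArg P) := by
  rcases p with _ | _ | p
  · rfl
  · rfl
  · ext u y
    show P (Fin.cons x (Fin.snoc u y : Fin (p + 1) → V) : Fin (p + 2) → V) =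
      P (Fin.snoc (Fin.cons x u : Fin (p + 1) → V) y : Fin (p + 2) → V)
    rw [Fin.cons_snoc_eq_snoc_cons]

/-- The vector that is inserted must pass the slot kept free at the front, whence the sign; in
`lastArg_contr` the free slot is at the end and there is none. -/
theorem firstArg_contr {p : ℕ} (x : V) (P : V [⋀^Fin p]→ₗ[R] R) :
    firstArg (contr x P) = - contr x (firstArg P) := by
  rcases p with _ | _ | p
  · ext u y; exact (neg_zero (G := R)).symm
  · ext u y; exact (neg_zero (G := R)).symm
  · ext u y
    show P (Fin.cons x (Fin.cons y u : Fin (p + 1) → V) : Fin (p + 2) → V) =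
      -P (Fin.cons y (Fin.cons x u : Fin (p + 1) → V) : Fin (p + 2) → V)
    rw [← P.map_swap (Fin.cons y (Fin.cons x u : Fin (p + 1) → V) : Fin (p + 2) → V)
      (i := 0) (j := 1) (by simp)]
    congr 1
    funext k
    refine Fin.cases ?_ (fun k => Fin.cases ?_ (fun k => ?_) k) k
    · simp
    · simp
    · rw [Function.comp_apply, Equiv.swap_apply_of_ne_of_ne (Fin.succ_ne_zero _)
        (by simp [Fin.ext_iff])]
      rfl

theorem lastArg_apply {p : ℕ} (P : V [⋀^Fin p]→ₗ[R] R) (u : Fin (p - 1) → V) (x : V) :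
    lastArg P u x = (-1 : ℤ) ^ (p - 1) • contr x P u := by
  rcases p with _ | p
  · simp [lastArg, contr]
  · have h := AlternatingMap.map_insertNth P (Fin.last p) x u
    rw [Fin.insertNth_last'] at h
    simpa [lastArg, contr, lastSlot_apply] using h

theorem firstArg_apply {p : ℕ} (P : V [⋀^Fin p]→ₗ[R] R) (u : Fin (p - 1) → V) (x : V) :
    firstArg P u x = contr x P u := by
  rcases p with _ | p
  · rfl
  · rfl

namespace PreLieAlgebroid

variable (𝒜 : PreLieAlgebroid R (Module.Dual R V))

/-- `(α, f) ↦ ρ(α) f`. -/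
def anchorPairing : Module.Dual R V →+ R →+ R :=
  AddMonoidHom.mk' (fun α => ((𝒜.anchor α : R →ₗ[ℝ] R).toAddMonoidHom)) fun α β => by
    ext; simp

/-- `v ↦ dv`. -/
def dDualHom : V →+ Module.Dual R V →+ Module.Dual R V →+ R :=
  AddMonoidHom.mk' (fun v => AddMonoidHom.mk' (fun α => AddMonoidHom.mk' (fun β => 𝒜.dDual v α β)
    (fun β β' => by simp [dDual, 𝒜.bracket_add]; ring))
    (fun α α' => by ext β; simp [dDual, 𝒜.add_bracket]; ring))
    (fun v v' => by ext α β; simp [dDual]; ring)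

@[simp] theorem dDualHom_apply (v : V) (α β : Module.Dual R V) :
    𝒜.dDualHom v α β = 𝒜.dDual v α β := rfl

/-- The values of the Schouten bracket, in terms of shuffles. -/
def schoutenValue {p q : ℕ} (P : V [⋀^Fin p]→ₗ[R] R) (Q : V [⋀^Fin q]→ₗ[R] R) {n : ℕ}
    (v : Fin n → V) : R :=
  shuffle 𝒜.anchorPairing (lastArg P) Q v - shuffle 𝒜.anchorPairing.flip P (firstArg Q) v
    - shuffleMid 𝒜.dDualHom (lastArg P) (firstArg Q) v

/-- The weights in `schoutenSummand` adjust the common factor `1 / (a! b!)` to the block lengths: `1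
/ (b + 1)` makes it `1 / (a! (b + 1)!)` for the blocks `(a, b + 1)`, and symmetrically for `(a + 1,
b)`. -/
theorem schoutenPos_apply {a b : ℕ} (P : V [⋀^Fin (a + 1)]→ₗ[R] R)
    (Q : V [⋀^Fin (b + 1)]→ₗ[R] R) (v : Fin (a + 1 + b) → V) :
    𝒜.schoutenPos P Q v = 𝒜.schoutenValue P Q v := by
  have h0 : ∀ w : Fin (a + 1 + b) → V, block 0 a w = fun i => w (Fin.castAdd b i.castSucc) := by
    intro w; funext i; simp [block, dif_pos (show (i : ℕ) < a + 1 + b by omega)]; rfl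
  have h1 : ∀ w : Fin (a + 1 + b) → V, block a 1 w 0 = w (Fin.castAdd b (Fin.last a)) := by
    intro w; simp [block, dif_pos (show a < a + 1 + b by omega)]; rfl
  have h2 : ∀ w : Fin (a + 1 + b) → V, block a (b + 1) w =
      Fin.cons (w (Fin.castAdd b (Fin.last a))) (fun j => w (Fin.natAdd (a + 1) j)) := by
    intro w; funext i
    refine Fin.cases ?_ (fun i => ?_) i
    · simp [block, dif_pos (show a < a + 1 + b by omega)]; rfl
    · simp [block, dif_pos (show a + (i + 1 : ℕ) < a + 1 + b by omega)]; congr 1; ext; simp; omega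
  have h3 : ∀ w : Fin (a + 1 + b) → V, block 0 (a + 1) w =
      Fin.snoc (fun i : Fin a => w (Fin.castAdd b i.castSucc)) (w (Fin.castAdd b (Fin.last a))) := by
    intro w; rw [block_castAdd]; funext i
    refine Fin.lastCases ?_ (fun i => ?_) i <;> simp
  have key : 𝒜.schoutenPos P Q v = (a.factorial * b.factorial : ℝ)⁻¹ •
      permSum (𝒜.schoutenSummand P Q) v := rfl
  have hs : 𝒜.schoutenSummand P Q = fun w =>
      ((b + 1 : ℝ)⁻¹ • 𝒜.anchorPairing (lastArg P (block 0 a w)) (Q (block a (b + 1) w))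
        - (a + 1 : ℝ)⁻¹ • 𝒜.anchorPairing.flip (P (block 0 (a + 1) w))
            (firstArg Q (block (a + 1) b w)))
        - 𝒜.dDualHom (block a 1 w 0) (lastArg P (block 0 a w)) (firstArg Q (block (a + 1) b w)) := by
    funext w
    rw [h1, h2, h3, h0, block_natAdd]
    rfl
  rw [key, hs, permSum_sub, permSum_sub, permSum_smul, permSum_smul, schoutenValue, shuffle, shuffle,
    shuffleMid, smul_sub, smul_sub, smul_smul, smul_smul]
  congr 2
  · congr 1
    simp only [Nat.factorial_succ, Nat.add_sub_cancel]; push_cast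
    rw [← mul_inv]; congr 1; ring
  · congr 1
    simp only [Nat.factorial_succ, Nat.add_sub_cancel]; push_cast
    rw [← mul_inv]; congr 1; ring

theorem shuffle_degree_zero_right (B : U₁ →+ U₂ →+ R) {p : ℕ} (P : V [⋀^Fin p]→ₗ[R] U₁)
    (Q : V [⋀^Fin 0]→ₗ[R] U₂) (v : Fin p → V) : shuffle B P Q v = B (P v) (Q ![]) := by
  have h1 : ∀ w : Fin p → V, block 0 p w = w := by
    intro w; funext i; simp [block]
  have h2 : ∀ w : Fin p → V, block p 0 w = ![] := fun w => Subsingleton.elim _ _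
  have h3 : ∀ σ : Equiv.Perm (Fin p), Equiv.Perm.sign σ • B (P (v ∘ σ)) (Q ![])
      = B (P v) (Q ![]) := by
    intro σ
    rw [AlternatingMap.map_perm]
    simp only [Units.smul_def, map_zsmul, AddMonoidHom.smul_apply, smul_smul]
    rw [← Units.val_mul, Int.units_mul_self, Units.val_one, one_smul]
  simp only [shuffle, permSum, h1, h2, h3]
  simp only [Finset.sum_const, Finset.card_univ, Fintype.card_perm, Fintype.card_fin]
  rw [← Nat.cast_smul_eq_nsmul ℝ, smul_smul]
  have : (p.factorial : ℝ) ≠ 0 := by positivity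
  simp [this]

theorem shuffle_degree_zero_left (B : U₁ →+ U₂ →+ R) {q : ℕ} (P : V [⋀^Fin 0]→ₗ[R] U₁)
    (Q : V [⋀^Fin q]→ₗ[R] U₂) (v : Fin q → V) : shuffle B P Q v = B (P ![]) (Q v) := by
  have h : shuffle B P Q v = shuffle B.flip Q P v := by
    simp only [shuffle, mul_comm]
    congr 2
    funext w
    have h1 : block 0 0 w = block q 0 w := Subsingleton.elim _ _
    rw [h1]; rfl
  rw [h, shuffle_degree_zero_right]; rfl

/-- One formula for all degrees. If an argument is a function, its `lastArg` or `firstArg` is zero,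
and only the anchor term that differentiates this function survives. -/
theorem schouten_apply {p q n : ℕ} (h : p + q = n + 1) (P : V [⋀^Fin p]→ₗ[R] R)
    (Q : V [⋀^Fin q]→ₗ[R] R) (v : Fin n → V) :
    𝒜.schouten h P Q v = 𝒜.schoutenValue P Q v := by
  rcases p with _ | a <;> rcases q with _ | b
  · omega
  · obtain rfl : b = n := by omega
    simp [schouten, schoutenValue, lastArg, shuffle_zero_left, shuffleMid_zero_left, castDeg]
    rw [shuffle_degree_zero_left]
    rfl
  · obtain rfl : a = n := by omega
    simp [schouten, schoutenValue, firstArg, shuffle_zero_right, shuffleMid_zero_right, castDeg]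
    rw [shuffle_degree_zero_right]
    rfl
  · obtain rfl : a + 1 + b = n := by omega
    rw [← schoutenPos_apply]
    rfl

end PreLieAlgebroid

end

section

variable {R : Type*} [CommRing R] [Algebra ℝ R] {V : Type*} [AddCommGroup V] [Module R V]

variable {U U₁ U₂ : Type*} [AddCommGroup U] [Module R U] [AddCommGroup U₁] [Module R U₁]
  [AddCommGroup U₂] [Module R U₂]

/-! ### Inhomogeneous forms -/

/-- The families of forms, one in each degree. -/
abbrev Forms (R : Type*) [CommRing R] (V : Type*) [AddCommGroup V] [Module R V] (U : Type*)
    [AddCommGroup U] [Module R U] : Type _ :=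
  ∀ k : ℕ, V [⋀^Fin k]→ₗ[R] U

/-- The interior product. -/
def interior : V →+ Forms R V U →+ Forms R V U :=
  AddMonoidHom.mk' (fun v => AddMonoidHom.mk' (fun P k => (P (k + 1)).curryLeft v)
    fun P Q => by ext; simp) fun v w => by ext P k u; simp

theorem interior_apply (v : V) (P : Forms R V U) (k : ℕ) (u : Fin k → V) :
    interior v P k u = P (k + 1) (Fin.cons v u : Fin (k + 1) → V) := rfl

theorem interior_apply' (v : V) (P : Forms R V U) (k : ℕ) :
    interior v P k = (P (k + 1)).curryLeft v := rfl

theorem interior_anticomm (v w : V) (P : Forms R V U) :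
    interior v (interior w P) = - interior w (interior v P) := by
  have h : interior (v + w) (interior (v + w) P) = 0 := by
    funext k
    exact AlternatingMap.curryLeft_same _ _
  have h2 : ∀ x, interior x (interior x P) = 0 := fun x => by
    funext k
    exact AlternatingMap.curryLeft_same _ _
  simp only [map_add, AddMonoidHom.add_apply, h2] at h
  rw [eq_neg_iff_add_eq_zero, add_comm]
  simpa using h

theorem Forms.apply_succ_eq_zero {P : Forms R V U} {k : ℕ} (h : ∀ v, interior v P k = 0) :
    P (k + 1) = 0 := by
  ext w
  have := congrArg (fun f : V [⋀^Fin k]→ₗ[R] U => f (Fin.tail w)) (h (w 0))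
  simpa [interior_apply, Fin.cons_self_tail] using this

/-- Induction on the degree. -/
theorem Forms.eq_zero_of_interior {I : Type*} (Z : I → Forms R V U) (h0 : ∀ i, Z i 0 = 0)
    (h : ∀ n, (∀ i, Z i n = 0) → ∀ i v, interior v (Z i) n = 0) (i : I) : Z i = 0 := by
  -- The induction treats all members of the family at once, since contracting one member usually
  -- produces others.
  have key : ∀ n i, Z i n = 0 := by
    intro n
    induction n with
    | zero => exact h0
    | succ n ih => exact fun i => Forms.apply_succ_eq_zero (h n ih i)
  exact funext fun n => key n i

/-- Multiplication by `(-1)^k` in degree `k`. -/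
def gradeSign : Forms R V U →+ Forms R V U :=
  AddMonoidHom.mk' (fun P k => (-1 : ℤ) ^ k • P k) fun P Q => by funext k; simp

theorem gradeSign_apply (P : Forms R V U) (k : ℕ) : gradeSign P k = (-1 : ℤ) ^ k • P k := rfl

@[simp] theorem gradeSign_zero (P : Forms R V U) : gradeSign P 0 = P 0 := by
  simp [gradeSign_apply]

@[simp] theorem gradeSign_gradeSign (P : Forms R V U) : gradeSign (gradeSign P) = P := by
  funext k
  simp [gradeSign_apply, smul_smul, ← mul_pow]

theorem interior_gradeSign (v : V) (P : Forms R V U) :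
    interior v (gradeSign P) = - gradeSign (interior v P) := by
  funext k
  ext u
  simp [interior_apply, gradeSign_apply, pow_succ]

/-- An operator of degree one on forms. -/
def raise (D : ∀ k : ℕ, (V [⋀^Fin k]→ₗ[R] R) →ₗ[ℝ] V [⋀^Fin (k + 1)]→ₗ[R] R) :
    Forms R V R →+ Forms R V R :=
  AddMonoidHom.mk' (fun P k => match k with
    | 0 => 0
    | k + 1 => D k (P k)) fun P Q => by
      funext k
      rcases k with _ | k <;> simp

@[simp] theorem raise_apply_zero
    (D : ∀ k : ℕ, (V [⋀^Fin k]→ₗ[R] R) →ₗ[ℝ] V [⋀^Fin (k + 1)]→ₗ[R] R)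
    (P : Forms R V R) : raise D P 0 = 0 := rfl

theorem raise_apply_succ (D : ∀ k : ℕ, (V [⋀^Fin k]→ₗ[R] R) →ₗ[ℝ] V [⋀^Fin (k + 1)]→ₗ[R] R)
    (P : Forms R V R) (k : ℕ) : raise D P (k + 1) = D k (P k) := rfl

theorem gradeSign_raise (D : ∀ k : ℕ, (V [⋀^Fin k]→ₗ[R] R) →ₗ[ℝ] V [⋀^Fin (k + 1)]→ₗ[R] R)
    (P : Forms R V R) : gradeSign (raise D P) = - raise D (gradeSign P) := by
  funext k
  rcases k with _ | k
  · simp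
  · simp [gradeSign_apply, raise_apply_succ, pow_succ]

/-- The insertion of an endomorphism, in all degrees. -/
def insertion (T : V →ₗ[R] V) : Forms R V R →+ Forms R V R :=
  AddMonoidHom.mk' (fun P k => insertSum T (P k)) fun P Q => by
    funext k; ext u; simp [Finset.sum_add_distrib]

theorem insertion_apply (T : V →ₗ[R] V) (P : Forms R V R) (k : ℕ) :
    insertion T P k = insertSum T (P k) := rfl

@[simp] theorem insertion_apply_zero (T : V →ₗ[R] V) (P : Forms R V R) :
    insertion T P 0 = 0 := by
  ext u; simp [insertion_apply]

theorem gradeSign_insertion (T : V →ₗ[R] V) (P : Forms R V R) :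
    gradeSign (insertion T P) = insertion T (gradeSign P) := by
  funext k
  ext u
  simp [gradeSign_apply, insertion_apply, Finset.mul_sum]

/-- The extra term comes from the first slot, where `T` is applied to `v` itself. -/
theorem interior_insertion (T : V →ₗ[R] V) (v : V) (P : Forms R V R) :
    interior v (insertion T P) = insertion T (interior v P) + interior (T v) P := by
  funext k
  ext u
  simp only [interior_apply, insertion_apply, insertSum_apply, Pi.add_apply,
    AlternatingMap.add_apply, Fin.sum_univ_succ, Fin.cons_zero, Fin.cons_succ,
    Fin.update_cons_zero, ← Fin.cons_update]
  rw [add_comm]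

theorem interior_single_zero (v : V) (f : V [⋀^Fin 0]→ₗ[R] U) :
    interior v (Pi.single 0 f : Forms R V U) = 0 := by
  funext k
  simp [interior_apply']

theorem interior_single_succ (v : V) (k : ℕ) (P : V [⋀^Fin (k + 1)]→ₗ[R] U) :
    interior v (Pi.single (k + 1) P : Forms R V U) = Pi.single k (P.curryLeft v) := by
  funext j
  by_cases h : j = k
  · subst h; simp [interior_apply']
  · simp [interior_apply', h]

theorem raise_single (D : ∀ k : ℕ, (V [⋀^Fin k]→ₗ[R] R) →ₗ[ℝ] V [⋀^Fin (k + 1)]→ₗ[R] R)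
    (k : ℕ) (P : V [⋀^Fin k]→ₗ[R] R) :
    raise D (Pi.single k P : Forms R V R) = Pi.single (k + 1) (D k P) := by
  funext j
  rcases j with _ | j
  · simp
  · by_cases h : j = k
    · subst h; simp [raise_apply_succ]
    · simp [raise_apply_succ, h]

theorem gradeSign_single (k : ℕ) (P : V [⋀^Fin k]→ₗ[R] U) :
    gradeSign (Pi.single k P : Forms R V U) = Pi.single k ((-1 : ℤ) ^ k • P) := by
  funext j
  by_cases h : j = k
  · subst h; simp [gradeSign_apply]
  · simp [gradeSign_apply, h]

/-! ### Products -/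

/-- The wedge product of families of forms, with respect to a pairing of the values. -/
def wedgeFun (B : U₁ →ₗ[R] U₂ →ₗ[R] R) (P : Forms R V U₁) (Q : Forms R V U₂) : Forms R V R :=
  fun n => ∑ x ∈ Finset.HasAntidiagonal.antidiagonal n,
    if h : x.1 + x.2 = n then wedgeWith B h (P x.1) (Q x.2) else 0

theorem wedgeFun_apply (B : U₁ →ₗ[R] U₂ →ₗ[R] R) (P : Forms R V U₁) (Q : Forms R V U₂) (n : ℕ)
    (u : Fin n → V) : wedgeFun B P Q n u =
      ∑ x ∈ Finset.HasAntidiagonal.antidiagonal n, shuffle (biadd B) (P x.1) (Q x.2) u := by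
  have hs := map_sum (AddMonoidHom.mk' (fun f : V [⋀^Fin n]→ₗ[R] R => f u) fun _ _ => rfl)
    (fun x : ℕ × ℕ => if h : x.1 + x.2 = n then wedgeWith B h (P x.1) (Q x.2) else 0)
    (Finset.HasAntidiagonal.antidiagonal n)
  refine hs.trans ?_
  refine Finset.sum_congr rfl fun x hx => ?_
  rw [dif_pos (Finset.HasAntidiagonal.mem_antidiagonal.1 hx)]
  exact wedgeWith_apply _ _ _ _ _

theorem shuffle_add_left (B : U₁ →+ U₂ →+ R) {p q : ℕ} (P P' : V [⋀^Fin p]→ₗ[R] U₁)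
    (Q : V [⋀^Fin q]→ₗ[R] U₂) {n : ℕ} (v : Fin n → V) :
    shuffle B (P + P') Q v = shuffle B P Q v + shuffle B P' Q v := by
  simp [shuffle, permSum_add]

theorem shuffle_add_right (B : U₁ →+ U₂ →+ R) {p q : ℕ} (P : V [⋀^Fin p]→ₗ[R] U₁)
    (Q Q' : V [⋀^Fin q]→ₗ[R] U₂) {n : ℕ} (v : Fin n → V) :
    shuffle B P (Q + Q') v = shuffle B P Q v + shuffle B P Q' v := by
  simp [shuffle, permSum_add]

theorem shuffle_zsmul_left (B : U₁ →+ U₂ →+ R) {p q : ℕ} (c : ℤ) (P : V [⋀^Fin p]→ₗ[R] U₁)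
    (Q : V [⋀^Fin q]→ₗ[R] U₂) {n : ℕ} (v : Fin n → V) :
    shuffle B (c • P) Q v = c • shuffle B P Q v := by
  simp only [shuffle, AlternatingMap.smul_apply, map_zsmul, AddMonoidHom.smul_apply, permSum_zsmul]
  rw [smul_comm]

/-- The wedge product of families of forms, as a biadditive map. -/
def wedgeTotal (B : U₁ →ₗ[R] U₂ →ₗ[R] R) : Forms R V U₁ →+ Forms R V U₂ →+ Forms R V R :=
  AddMonoidHom.mk' (fun P => AddMonoidHom.mk' (fun Q => wedgeFun B P Q) fun Q Q' => by
      funext n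
      ext u
      simp only [Pi.add_apply, AlternatingMap.add_apply, wedgeFun_apply, shuffle_add_right,
        Finset.sum_add_distrib])
    fun P P' => by
      ext Q n u
      simp only [AddMonoidHom.mk'_apply, AddMonoidHom.add_apply, Pi.add_apply,
        AlternatingMap.add_apply, wedgeFun_apply, shuffle_add_left, Finset.sum_add_distrib]

theorem wedgeTotal_apply (B : U₁ →ₗ[R] U₂ →ₗ[R] R) (P : Forms R V U₁) (Q : Forms R V U₂) (n : ℕ)
    (u : Fin n → V) : wedgeTotal B P Q n u =
      ∑ x ∈ Finset.HasAntidiagonal.antidiagonal n, shuffle (biadd B) (P x.1) (Q x.2) u :=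
  wedgeFun_apply B P Q n u

theorem wedgeTotal_apply_zero (B : U₁ →ₗ[R] U₂ →ₗ[R] R) (P : Forms R V U₁) (Q : Forms R V U₂)
    (u : Fin 0 → V) : wedgeTotal B P Q 0 u = B (P 0 ![]) (Q 0 ![]) := by
  rw [wedgeTotal_apply, Finset.Nat.antidiagonal_zero, Finset.sum_singleton]
  have := Subsingleton.elim u ![]
  subst this
  exact PreLieAlgebroid.shuffle_degree_zero_left _ _ _ _

/-- The behaviour of a graded product under contractions. -/
def IsGradedProduct (M : Forms R V U₁ → Forms R V U₂ → Forms R V R) : Prop :=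
  ∀ v P Q, interior v (M P Q) = M (interior v P) Q + M (gradeSign P) (interior v Q)

theorem isGradedProduct_wedgeTotal (B : U₁ →ₗ[R] U₂ →ₗ[R] R) :
    IsGradedProduct (V := V) (fun P Q => wedgeTotal B P Q) := by
  dsimp only [IsGradedProduct]
  intro v P Q
  funext n
  ext u
  rw [interior_apply, wedgeTotal_apply]
  have h : ∀ x ∈ Finset.HasAntidiagonal.antidiagonal (n + 1),
      shuffle (biadd B) (P x.1) (Q x.2) (Fin.cons v u : Fin (n + 1) → V) =
      shuffle (biadd B) (contr v (P x.1)) (Q x.2) u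
        + (-1 : ℤ) ^ x.1 • shuffle (biadd B) (P x.1) (contr v (Q x.2)) u := fun x hx =>
    shuffle_cons _ _ _ (Finset.HasAntidiagonal.mem_antidiagonal.1 hx) _ _
  rw [Finset.sum_congr rfl h, Finset.sum_add_distrib, Finset.Nat.sum_antidiagonal_succ,
    Finset.Nat.sum_antidiagonal_succ']
  simp only [Pi.add_apply, AlternatingMap.add_apply, wedgeTotal_apply, gradeSign_apply,
    shuffle_zsmul_left]
  -- The extreme terms of the two antidiagonals contract a form of degree zero.
  have h1 : shuffle (biadd B) (contr v (P 0)) (Q (n + 1)) u = 0 := shuffle_zero_left _ _ _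
  have h2 : shuffle (biadd B) (P (n + 1)) (contr v (Q 0)) u = 0 := shuffle_zero_right _ _ _
  rw [h1, h2, smul_zero, zero_add, zero_add]
  rfl

theorem wedgeTotal_single (B : U₁ →ₗ[R] U₂ →ₗ[R] R) {p q n : ℕ} (h : p + q = n)
    (P : V [⋀^Fin p]→ₗ[R] U₁) (Q : V [⋀^Fin q]→ₗ[R] U₂) :
    wedgeTotal B (Pi.single p P) (Pi.single q Q) = Pi.single n (wedgeWith B h P Q) := by
  subst h
  funext m
  ext u
  rw [wedgeTotal_apply]
  by_cases hm : m = p + q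
  · subst hm
    rw [Finset.sum_eq_single (p, q)]
    · simp [wedgeWith_apply]
    · rintro ⟨a, b⟩ hab hne
      by_cases ha : a = p
      · have hb : b ≠ q := by rintro rfl; exact hne (by rw [ha])
        simp only [Pi.single_eq_of_ne hb, shuffle_zero_right]
      · simp only [Pi.single_eq_of_ne ha, shuffle_zero_left]
    · intro h; simp at h
  · rw [Pi.single_eq_of_ne hm, AlternatingMap.zero_apply]
    refine Finset.sum_eq_zero ?_
    rintro ⟨a, b⟩ hab
    rw [Finset.HasAntidiagonal.mem_antidiagonal] at hab
    by_cases ha : a = p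
    · have hb : b ≠ q := by rintro rfl; simp at hab; omega
      simp only [Pi.single_eq_of_ne hb, shuffle_zero_right]
    · simp only [Pi.single_eq_of_ne ha, shuffle_zero_left]

/-- A graded product is determined by its part of degree zero. -/
theorem IsGradedProduct.ext {M M' : Forms R V U₁ → Forms R V U₂ → Forms R V R}
    (hM : IsGradedProduct M) (hM' : IsGradedProduct M')
    (h0 : ∀ P Q, M P Q 0 = M' P Q 0) (P : Forms R V U₁) (Q : Forms R V U₂) : M P Q = M' P Q := by
  rw [← sub_eq_zero]
  refine Forms.eq_zero_of_interior (I := Forms R V U₁ × Forms R V U₂)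
    (fun i => M i.1 i.2 - M' i.1 i.2) (fun i => ?_) (fun n hn i v => ?_) (P, Q)
  · simp [h0]
  · rw [map_sub, hM, hM', add_sub_add_comm, Pi.add_apply, hn (interior v i.1, i.2),
      hn (gradeSign i.1, interior v i.2), add_zero]

/-- `lastSlot` in all degrees. -/
def lastTotal : Forms R V R →+ Forms R V (Module.Dual R V) :=
  AddMonoidHom.mk' (fun P k => lastSlot (P (k + 1))) fun P Q => by
    funext k; ext u x; simp [lastSlot_apply]

/-- `firstSlot` in all degrees. -/
def firstTotal : Forms R V R →+ Forms R V (Module.Dual R V) :=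
  AddMonoidHom.mk' (fun P k => firstSlot (P (k + 1))) fun P Q => by
    funext k; ext u x; simp [firstSlot_apply]

theorem interior_lastTotal (v : V) (P : Forms R V R) :
    interior v (lastTotal P) = lastTotal (interior v P) := by
  funext k
  exact (lastArg_contr v (P (k + 2))).symm

theorem interior_firstTotal (v : V) (P : Forms R V R) :
    interior v (firstTotal P) = - firstTotal (interior v P) := by
  funext k
  have h : firstSlot ((P (k + 2)).curryLeft v) = -(firstSlot (P (k + 2))).curryLeft v :=
    firstArg_contr v (P (k + 2))
  ext u x
  have h2 := congrArg (fun f : V [⋀^Fin k]→ₗ[R] Module.Dual R V => f u x) h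
  exact eq_neg_of_add_eq_zero_left ((add_comm _ _).trans (eq_neg_iff_add_eq_zero.1 h2))

theorem lastTotal_gradeSign (P : Forms R V R) :
    lastTotal (gradeSign P) = - gradeSign (lastTotal P) := by
  funext k
  ext u x
  simp [lastTotal, gradeSign_apply, lastSlot_apply, pow_succ]

/-- The contraction of two forms by a pairing `B`:
`∑ ± B(P(v_I, -), Q(-, v_J))`. -/
def contraction (B : Module.Dual R V →ₗ[R] Module.Dual R V →ₗ[R] R) :
    Forms R V R →+ Forms R V R →+ Forms R V R :=
  (AddMonoidHom.compHom ((AddMonoidHom.compHom.flip firstTotal))) ((wedgeTotal B).comp lastTotal)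

theorem contraction_apply (B : Module.Dual R V →ₗ[R] Module.Dual R V →ₗ[R] R)
    (P Q : Forms R V R) : contraction B P Q = wedgeTotal B (lastTotal P) (firstTotal Q) := rfl

/-- Two signs cancel: `lastTotal` anticommutes with `gradeSign`, as it lowers the degree by one, and
`firstTotal` anticommutes with contractions. -/
theorem isGradedProduct_contraction (B : Module.Dual R V →ₗ[R] Module.Dual R V →ₗ[R] R) :
    IsGradedProduct (fun P Q => contraction B P Q) := by
  intro v P Q
  have h := isGradedProduct_wedgeTotal (V := V) B v
  dsimp only at h
  simp only [contraction_apply, h, interior_lastTotal,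
    interior_firstTotal, lastTotal_gradeSign, map_neg, AddMonoidHom.neg_apply]

/-- The part of degree one, as a section of the dual. -/
def linearPart : Forms R V R →+ Module.Dual R V :=
  AddMonoidHom.mk' (fun P => (AlternatingMap.ofSubsingleton R V R (0 : Fin 1)).symm (P 1))
    fun P Q => by ext x; simp

theorem linearPart_apply (P : Forms R V R) (x : V) : linearPart P x = interior x P 0 ![] := by
  simp [linearPart, interior_apply]
  congr 1
  funext i
  fin_cases i
  rfl

/-- Both forms lose a slot, so in degree zero only their parts of degree one meet. Base cases about
contractions thereby become statements about sections of the dual. -/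
theorem contraction_apply_zero (B : Module.Dual R V →ₗ[R] Module.Dual R V →ₗ[R] R)
    (P Q : Forms R V R) (u : Fin 0 → V) :
    contraction B P Q 0 u = B (linearPart P) (linearPart Q) := by
  have h1 : lastTotal P 0 ![] = linearPart P := by
    ext x
    rw [linearPart_apply]
    show P 1 _ = P 1 _
    congr 1
    funext i
    fin_cases i
    rfl
  have h2 : firstTotal Q 0 ![] = linearPart Q := by
    ext x
    rw [linearPart_apply]
    rfl
  rw [contraction_apply, wedgeTotal_apply_zero, h1, h2]

end

section

variable {R : Type*} [CommRing R] [Algebra ℝ R] {V : Type*} [AddCommGroup V] [Module R V]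

/-! ### Cartan calculus -/

namespace PreLieAlgebroid

variable (𝒜 : PreLieAlgebroid R V) (φ : Module.Dual R V)

theorem d_eq_alternatizeUncurryFin {k : ℕ} (α : V [⋀^Fin k]→ₗ[R] R) (v : Fin (k + 1) → V) :
    𝒜.d α v = AlternatingMap.alternatizeUncurryFin (𝒜.cartanAux α) v :=
  (𝒜.alternatizeUncurryFin_cartanAux α v).symm

theorem map_update_eq_cons {k : ℕ} (α : V [⋀^Fin (k + 1)]→ₗ[R] R) (w : Fin (k + 1) → V)
    (j : Fin (k + 1)) (y : V) : α (Function.update w j y) =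
      (-1) ^ (j : ℕ) * α (Fin.cons y (j.removeNth w) : Fin (k + 1) → V) := by
  have h : Function.update w j y = j.insertNth y (j.removeNth w) := by simp
  rw [h, AlternatingMap.map_insertNth]; simp [Matrix.vecCons]

theorem d_cons_zero (f : V [⋀^Fin 0]→ₗ[R] R) (x : V) (w : Fin 0 → V) :
    𝒜.d f (Fin.cons x w : Fin 1 → V) = 𝒜.anchor x (f w) := by
  rw [d_eq_alternatizeUncurryFin, alternatizeUncurryFin_cartanAux]
  simp [Subsingleton.elim (Fin.removeNth 0 (Fin.cons x w : Fin 1 → V)) w]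

/-- Cartan's formula. In `d α` every pair of arguments is counted twice with weight one half; the
two halves of the pairs that involve `x` combine to the Lie derivative, and the pairs without `x`
cancel against the differential of the contracted form. -/
theorem d_cons_add {k : ℕ} (α : V [⋀^Fin (k + 1)]→ₗ[R] R) (x : V) (w : Fin (k + 1) → V) :
    𝒜.d α (Fin.cons x w : Fin (k + 2) → V) + 𝒜.d (α.curryLeft x) w =
      𝒜.anchor x (α w) - ∑ j, α (Function.update w j (𝒜.bracket x (w j))) := by
  rw [d_eq_alternatizeUncurryFin, cartan_cons, d_eq_alternatizeUncurryFin,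
    alternatizeUncurryFin_cartanAux]
  simp only [map_update_eq_cons α]
  have h2 : ∀ j : Fin (k + 1), 𝒜.bracket (w j) x = - 𝒜.bracket x (w j) := fun j =>
    𝒜.bracket_swap _ _
  have h3 : ∀ (y : V) (u : Fin k → V), α (Fin.cons (-y) u : Fin (k + 1) → V) =
      - α (Fin.cons y u : Fin (k + 1) → V) := fun y u => by
    have := map_cons_smul α (-1) y u
    simpa using this
  simp only [h2, h3, AlternatingMap.curryLeft_apply_apply, Matrix.vecCons]
  rw [add_assoc, ← Finset.sum_add_distrib, sub_add, Finset.smul_sum, ← Finset.sum_sub_distrib]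
  congr 1
  refine Finset.sum_congr rfl fun j _ => ?_
  have ht : (algebraMap ℝ R 2⁻¹) + algebraMap ℝ R 2⁻¹ = 1 := by
    rw [← map_add]; norm_num
  simp only [Algebra.smul_def, pow_succ]
  linear_combination ((-1) ^ (j : ℕ) *
    α (Fin.cons (𝒜.bracket x (w j)) (j.removeNth w) : Fin (k + 1) → V)) * ht

theorem wedge_oneForm_cons {k : ℕ} (α : V [⋀^Fin (k + 1)]→ₗ[R] R) (x : V) (w : Fin (k + 1) → V) :
    wedge (Nat.add_comm 1 (k + 1)) (oneForm φ) α (Fin.cons x w : Fin (k + 2) → V)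
      + wedge (Nat.add_comm 1 k) (oneForm φ) (α.curryLeft x) w = φ x * α w := by
  simp only [wedge_eq_wedgeWith, wedgeWith_apply]
  rw [shuffle_cons _ _ _ (Nat.add_comm 1 (k + 1)), shuffle_degree_zero_left]
  simp [contr, oneForm]

theorem wedge_oneForm_cons_zero (f : V [⋀^Fin 0]→ₗ[R] R) (x : V) (w : Fin 0 → V) :
    wedge (Nat.add_comm 1 0) (oneForm φ) f (Fin.cons x w : Fin 1 → V) = φ x * f w := by
  simp only [wedge_eq_wedgeWith, wedgeWith_apply]
  rw [shuffle_degree_zero_right, Subsingleton.elim w ![]]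
  simp [oneForm]

/-- The `φ`-twisted differential, in all degrees. -/
def diff : Forms R V R →+ Forms R V R := raise (𝒜.twistedD φ)

/-- The `φ`-twisted Lie derivative of forms. -/
def lie (v : V) : Forms R V R →+ Forms R V R :=
  (interior v).comp (𝒜.diff φ) + (𝒜.diff φ).comp (interior v)

theorem interior_diff (v : V) (P : Forms R V R) :
    interior v (𝒜.diff φ P) = 𝒜.lie φ v P - 𝒜.diff φ (interior v P) := by
  simp [lie]

@[simp] theorem diff_apply_zero (P : Forms R V R) : 𝒜.diff φ P 0 = 0 := rfl

/-- Cartan's formula for `d` and the contraction of `φ ∧ P` together turn the definition of `lie`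
into an expression by slots, from which its commutators can be read off. -/
theorem lie_apply (v : V) (P : Forms R V R) (k : ℕ) (w : Fin k → V) :
    𝒜.lie φ v P k w = 𝒜.anchor v (P k w)
      - ∑ j, P k (Function.update w j (𝒜.bracket v (w j))) + φ v * P k w := by
  rcases k with _ | k
  · simp only [lie, AddMonoidHom.add_apply, AddMonoidHom.comp_apply, Pi.add_apply, diff_apply_zero,
      add_zero, interior_apply]
    show (𝒜.d (P 0) + wedge (Nat.add_comm 1 0) (oneForm φ) (P 0) : V [⋀^Fin 1]→ₗ[R] R)
      (Fin.cons v w : Fin 1 → V) = _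
    rw [AlternatingMap.add_apply, d_cons_zero, wedge_oneForm_cons_zero]
    simp
  · simp only [lie, AddMonoidHom.add_apply, AddMonoidHom.comp_apply, Pi.add_apply,
      AlternatingMap.add_apply, interior_apply]
    show (𝒜.d (P (k + 1)) + wedge (Nat.add_comm 1 (k + 1)) (oneForm φ) (P (k + 1)) :
        V [⋀^Fin (k + 2)]→ₗ[R] R) (Fin.cons v w : Fin (k + 2) → V)
      + (𝒜.d ((P (k + 1)).curryLeft v) + wedge (Nat.add_comm 1 k) (oneForm φ)
        ((P (k + 1)).curryLeft v) : V [⋀^Fin (k + 1)]→ₗ[R] R) w = _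
    rw [AlternatingMap.add_apply, AlternatingMap.add_apply, ← wedge_oneForm_cons φ,
      ← d_cons_add]
    ring

theorem interior_lie (u v : V) (P : Forms R V R) :
    interior u (𝒜.lie φ v P) =
      𝒜.lie φ v (interior u P) - interior (𝒜.bracket v u) P := by
  funext k
  ext w
  simp only [interior_apply, lie_apply, Pi.sub_apply, AlternatingMap.sub_apply,
    Fin.sum_univ_succ, Fin.cons_zero, Fin.cons_succ, Fin.update_cons_zero, ← Fin.cons_update]
  ring

theorem lie_gradeSign (v : V) (P : Forms R V R) :
    𝒜.lie φ v (gradeSign P) = gradeSign (𝒜.lie φ v P) := by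
  simp only [lie, AddMonoidHom.add_apply, AddMonoidHom.comp_apply, map_add, diff,
    interior_gradeSign, map_neg, ← neg_eq_iff_eq_neg.2 (gradeSign_raise _ _)]
  rw [← neg_eq_iff_eq_neg.2 (interior_gradeSign v _)]
  simp [gradeSign_raise]

theorem gradeSign_diff (P : Forms R V R) :
    gradeSign (𝒜.diff φ P) = - 𝒜.diff φ (gradeSign P) := gradeSign_raise _ _

/-- The Lie derivative `ℒ_v T` of an endomorphism `T`. -/
def lieEnd (v : V) (T : V →ₗ[R] V) : V →ₗ[R] V where
  toFun y := 𝒜.bracket v (T y) - T (𝒜.bracket v y)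
  map_add' y z := by simp only [map_add, 𝒜.bracket_add]; abel
  map_smul' c y := by
    simp only [map_smul, 𝒜.bracket_smul, map_add, RingHom.id_apply, smul_sub]; abel

theorem lieEnd_apply (v : V) (T : V →ₗ[R] V) (y : V) :
    𝒜.lieEnd v T y = 𝒜.bracket v (T y) - T (𝒜.bracket v y) := rfl

/-- A pattern used repeatedly: the defect vanishes on functions and commutes with contractions, the
extra contractions cancelling by the definition of `lieEnd`; hence it vanishes in every degree. -/
theorem lie_insertion (v : V) (T : V →ₗ[R] V) (P : Forms R V R) :
    𝒜.lie φ v (insertion T P) = insertion T (𝒜.lie φ v P) + insertion (𝒜.lieEnd v T) P := by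
  rw [← sub_eq_zero]
  refine Forms.eq_zero_of_interior (fun P => 𝒜.lie φ v (insertion T P) -
    (insertion T (𝒜.lie φ v P) + insertion (𝒜.lieEnd v T) P)) (fun P => ?_) (fun n hn P u => ?_) P
  · ext w
    simp [lie_apply]
  · have h := hn (interior u P)
    have e : interior u (𝒜.lie φ v (insertion T P) -
        (insertion T (𝒜.lie φ v P) + insertion (𝒜.lieEnd v T) P)) =
        𝒜.lie φ v (insertion T (interior u P)) -
          (insertion T (𝒜.lie φ v (interior u P)) + insertion (𝒜.lieEnd v T) (interior u P)) := by
      simp only [map_sub, map_add, interior_lie, interior_insertion, lieEnd_apply,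
        AddMonoidHom.sub_apply]
      abel
    rw [e]; exact h

/-- The condition that `φ` is a `1`-cocycle. -/
def IsCocycle : Prop :=
  ∀ x y, 𝒜.anchor x (φ y) - 𝒜.anchor y (φ x) - φ (𝒜.bracket x y) = 0

variable {𝒜 φ}

/-- On functions this needs that the anchor preserves brackets and that `φ` is closed; the
contraction step is the Jacobi identity. -/
theorem IsCocycle.lie_lie (h𝒜 : IsLieAlgebroid 𝒜) (hφ : 𝒜.IsCocycle φ) (v u : V)
    (P : Forms R V R) : 𝒜.lie φ v (𝒜.lie φ u P) - 𝒜.lie φ u (𝒜.lie φ v P) =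
      𝒜.lie φ (𝒜.bracket v u) P := by
  rw [← sub_eq_zero]
  refine Forms.eq_zero_of_interior (fun P => 𝒜.lie φ v (𝒜.lie φ u P) - 𝒜.lie φ u (𝒜.lie φ v P) -
      𝒜.lie φ (𝒜.bracket v u) P) (fun P => ?_) (fun n hn P x => ?_) P
  · ext w
    have h1 := congrArg (fun D : Derivation ℝ R R => D (P 0 w)) (h𝒜.anchor_bracket v u)
    simp only [Derivation.commutator_apply] at h1
    have h2 := hφ v u
    simp [lie_apply, h1]
    linear_combination P 0 w * h2
  · have h := hn (interior x P)
    have hJ : interior (𝒜.bracket (𝒜.bracket v u) x) P =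
        interior (𝒜.bracket v (𝒜.bracket u x)) P - interior (𝒜.bracket u (𝒜.bracket v x)) P := by
      rw [h𝒜.jacobi v u x, map_add, AddMonoidHom.add_apply, add_sub_cancel_right]
    have e : interior x (𝒜.lie φ v (𝒜.lie φ u P) - 𝒜.lie φ u (𝒜.lie φ v P) -
        𝒜.lie φ (𝒜.bracket v u) P) = 𝒜.lie φ v (𝒜.lie φ u (interior x P))
          - 𝒜.lie φ u (𝒜.lie φ v (interior x P)) - 𝒜.lie φ (𝒜.bracket v u) (interior x P) := by
      simp only [map_sub, interior_lie, hJ]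
      abel
    rw [e]; exact h

/-- By `lie_lie` the defect anticommutes with contractions, and it vanishes in degree zero because
`diff` raises the degree. -/
theorem IsCocycle.lie_diff (h𝒜 : IsLieAlgebroid 𝒜) (hφ : 𝒜.IsCocycle φ) (v : V)
    (P : Forms R V R) : 𝒜.lie φ v (𝒜.diff φ P) = 𝒜.diff φ (𝒜.lie φ v P) := by
  rw [← sub_eq_zero]
  refine Forms.eq_zero_of_interior (fun P => 𝒜.lie φ v (𝒜.diff φ P) - 𝒜.diff φ (𝒜.lie φ v P))
    (fun P => ?_) (fun n hn P x => ?_) P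
  · ext w
    simp [lie_apply]
  · have h := hn (interior x P)
    have e : interior x (𝒜.lie φ v (𝒜.diff φ P) - 𝒜.diff φ (𝒜.lie φ v P)) =
        -(𝒜.lie φ v (𝒜.diff φ (interior x P)) - 𝒜.diff φ (𝒜.lie φ v (interior x P))) := by
      have h1 := hφ.lie_lie h𝒜 v x P
      simp only [map_sub, interior_lie, interior_diff]
      rw [sub_eq_iff_eq_add] at h1
      rw [h1]
      abel
    rw [e, Pi.neg_apply, h, neg_zero]

/-- By Cartan's formula and `lie_diff`, the square of the differential commutes with contractions.
-/
theorem IsCocycle.diff_diff (h𝒜 : IsLieAlgebroid 𝒜) (hφ : 𝒜.IsCocycle φ) (P : Forms R V R) :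
    𝒜.diff φ (𝒜.diff φ P) = 0 := by
  refine Forms.eq_zero_of_interior (fun P => 𝒜.diff φ (𝒜.diff φ P)) (fun P => ?_)
    (fun n hn P x => ?_) P
  · simp
  · have h := hn (interior x P)
    have e : interior x (𝒜.diff φ (𝒜.diff φ P)) = 𝒜.diff φ (𝒜.diff φ (interior x P)) := by
      simp only [interior_diff, hφ.lie_diff h𝒜, map_sub]
      abel
    rw [e]; exact h

end PreLieAlgebroid

end

/-! ### Lie derivatives of pairings and the Koszul bracket of forms -/

section

variable {R : Type*} [CommRing R] [Algebra ℝ R] {V : Type*} [AddCommGroup V] [Module R V]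

theorem interior_contraction (B : Module.Dual R V →ₗ[R] Module.Dual R V →ₗ[R] R) (v : V)
    (P Q : Forms R V R) : interior v (contraction B P Q) =
      contraction B (interior v P) Q + contraction B (gradeSign P) (interior v Q) :=
  isGradedProduct_contraction B v P Q

theorem interior_wedgeTotal (v : V) (P Q : Forms R V R) :
    interior v (wedgeTotal (LinearMap.mul R R) P Q) = wedgeTotal (LinearMap.mul R R) (interior v P) Q
      + wedgeTotal (LinearMap.mul R R) (gradeSign P) (interior v Q) :=
  isGradedProduct_wedgeTotal _ v P Q

/-- The pairing `(α, β) ↦ ⟨β, S α⟩`. -/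
def sharpPairing (S : Module.Dual R V →ₗ[R] V) : Module.Dual R V →ₗ[R] Module.Dual R V →ₗ[R] R :=
  Module.Dual.eval R V ∘ₗ S

@[simp] theorem sharpPairing_apply (S : Module.Dual R V →ₗ[R] V) (α β : Module.Dual R V) :
    sharpPairing S α β = β (S α) := rfl

namespace PreLieAlgebroid

variable (𝒜 : PreLieAlgebroid R V) (φ : Module.Dual R V)

theorem lieDeriv_apply (x : V) (β : Module.Dual R V) (v : V) :
    𝒜.lieDeriv φ x β v = 𝒜.anchor x (β v) - β (𝒜.bracket x v) + φ x * β v := rfl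

theorem dFun_apply (f : R) (v : V) : 𝒜.dFun φ f v = 𝒜.anchor v f + φ v * f := rfl

theorem lieDeriv_add (x : V) (β γ : Module.Dual R V) :
    𝒜.lieDeriv φ x (β + γ) = 𝒜.lieDeriv φ x β + 𝒜.lieDeriv φ x γ := by
  ext v; simp [lieDeriv_apply]; ring

theorem lieDeriv_smul (x : V) (c : R) (β : Module.Dual R V) :
    𝒜.lieDeriv φ x (c • β) = c • 𝒜.lieDeriv φ x β + 𝒜.anchor x c • β := by
  ext v; simp [lieDeriv_apply]; ring

/-- The Lie derivative of a pairing. -/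
def liePairing (v : V) (B : Module.Dual R V →ₗ[R] Module.Dual R V →ₗ[R] R) :
    Module.Dual R V →ₗ[R] Module.Dual R V →ₗ[R] R :=
  LinearMap.mk₂ R (fun α β => 𝒜.anchor v (B α β) + φ v * B α β - B (𝒜.lieDeriv φ v α) β
      - B α (𝒜.lieDeriv φ v β))
    (fun α α' β => by simp [lieDeriv_add]; ring)
    (fun c α β => by simp [lieDeriv_smul]; ring)
    (fun α β β' => by simp [lieDeriv_add]; ring)
    (fun c α β => by simp [lieDeriv_smul]; ring)

theorem liePairing_apply (v : V) (B : Module.Dual R V →ₗ[R] Module.Dual R V →ₗ[R] R)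
    (α β : Module.Dual R V) : 𝒜.liePairing φ v B α β =
      𝒜.anchor v (B α β) + φ v * B α β - B (𝒜.lieDeriv φ v α) β - B α (𝒜.lieDeriv φ v β) := rfl

theorem linearPart_lie (v : V) (P : Forms R V R) :
    linearPart (𝒜.lie φ v P) = 𝒜.lieDeriv φ v (linearPart P) := by
  ext x
  rw [linearPart_apply, interior_lie, lieDeriv_apply, linearPart_apply, linearPart_apply]
  simp only [Pi.sub_apply, AlternatingMap.sub_apply, lie_apply]
  simp
  ring

theorem lie_apply_zero (v : V) (P : Forms R V R) (u : Fin 0 → V) :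
    𝒜.lie φ v P 0 u = 𝒜.anchor v (P 0 u) + φ v * P 0 u := by
  simp [lie_apply]

/-- The defect of the Leibniz rule of a Lie derivative on a graded product is again a graded
product, and so is known once it is known on functions and sections. -/
theorem isGradedProduct_lie (v : V) (M : Forms R V R →+ Forms R V R →+ Forms R V R)
    (hM : IsGradedProduct (fun P Q => M P Q)) :
    IsGradedProduct (fun P Q =>
      𝒜.lie φ v (M P Q) - M (𝒜.lie φ v P) Q - M P (𝒜.lie φ v Q)) := by
  intro u P Q
  dsimp only [IsGradedProduct] at hM
  simp only [map_sub, interior_lie, hM, map_add, AddMonoidHom.sub_apply, ← lie_gradeSign]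
  abel

theorem lie_contraction (v : V) (B : Module.Dual R V →ₗ[R] Module.Dual R V →ₗ[R] R)
    (P Q : Forms R V R) : 𝒜.lie φ v (contraction B P Q) =
      contraction B (𝒜.lie φ v P) Q + contraction B P (𝒜.lie φ v Q)
        + contraction (𝒜.liePairing φ v B) P Q := by
  have h := IsGradedProduct.ext
    (𝒜.isGradedProduct_lie φ v (contraction B) (isGradedProduct_contraction B))
    (isGradedProduct_contraction (𝒜.liePairing φ v B)) (fun P Q => by
      ext u
      simp only [Pi.sub_apply, AlternatingMap.sub_apply, lie_apply_zero, contraction_apply_zero,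
        linearPart_lie, liePairing_apply]) P Q
  rw [← h]; abel

/-- The bracket of forms defined by `S`:
`m(P, dQ) + (-1)^p m(dP, Q) - (-1)^p d m(P, Q)` for the contraction `m` by `S`. -/
def koszul (S : Module.Dual R V →ₗ[R] V) : Forms R V R →+ Forms R V R →+ Forms R V R :=
  AddMonoidHom.mk' (fun P => AddMonoidHom.mk' (fun Q =>
      contraction (sharpPairing S) P (𝒜.diff φ Q)
        + contraction (sharpPairing S) (𝒜.diff φ (gradeSign P)) Q
        - 𝒜.diff φ (contraction (sharpPairing S) (gradeSign P) Q))
      fun Q Q' => by simp only [map_add]; abel)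
    fun P P' => by
      ext1 Q
      simp only [AddMonoidHom.mk'_apply, AddMonoidHom.add_apply, map_add]
      abel

theorem koszul_apply (S : Module.Dual R V →ₗ[R] V) (P Q : Forms R V R) :
    𝒜.koszul φ S P Q = contraction (sharpPairing S) P (𝒜.diff φ Q)
        + contraction (sharpPairing S) (𝒜.diff φ (gradeSign P)) Q
        - 𝒜.diff φ (contraction (sharpPairing S) (gradeSign P) Q) := rfl

/-- The recursion of the bracket. Each exchange of a contraction with `diff` leaves a Lie
derivative; by `lie_contraction` these cancel up to the Lie derivative of the pairing itself.
`jacobiValue_cons` is the counterpart for the Schouten-Jacobi bracket. -/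
theorem interior_koszul (S : Module.Dual R V →ₗ[R] V) (v : V) (P Q : Forms R V R) :
    interior v (𝒜.koszul φ S P Q) =
      𝒜.koszul φ S (interior v P) Q - 𝒜.koszul φ S (gradeSign P) (interior v Q)
        - contraction (𝒜.liePairing φ v (sharpPairing S)) (gradeSign P) Q := by
  simp only [koszul_apply, map_sub, map_add, interior_contraction, interior_diff, lie_contraction,
    interior_gradeSign, map_neg, AddMonoidHom.neg_apply, AddMonoidHom.sub_apply, gradeSign_diff,
    gradeSign_gradeSign, AddMonoidHom.add_apply]
  abel

/-- The bracket is a graded commutator of the contraction with `diff`, so the derivation property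
only uses that `diff` squares to zero. It needs neither skewness of `S` nor a Jacobi identity for
the bracket. -/
theorem diff_koszul (h𝒜 : IsLieAlgebroid 𝒜) (hφ : 𝒜.IsCocycle φ) (S : Module.Dual R V →ₗ[R] V)
    (P Q : Forms R V R) : 𝒜.diff φ (𝒜.koszul φ S P Q) =
      𝒜.koszul φ S (𝒜.diff φ P) Q - 𝒜.koszul φ S (gradeSign P) (𝒜.diff φ Q) := by
  simp only [koszul_apply, map_sub, map_add, hφ.diff_diff h𝒜, gradeSign_diff, map_neg,
    AddMonoidHom.neg_apply, gradeSign_gradeSign, map_zero, AddMonoidHom.zero_apply]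
  abel

end PreLieAlgebroid

end

section

variable {R : Type*} [CommRing R] [Algebra ℝ R] {V : Type*} [AddCommGroup V] [Module R V]

/-! ### The Schouten-Jacobi bracket and contractions -/

theorem contr_contr {U : Type*} [AddCommGroup U] [Module R U] {p : ℕ} (x y : V)
    (P : V [⋀^Fin p]→ₗ[R] U) : contr x (contr y P) = - contr y (contr x P) := by
  rcases p with _ | _ | p
  · ext u; exact (neg_zero (G := U)).symm
  · ext u; exact (neg_zero (G := U)).symm
  · have h := congrArg (fun f : Forms R V U => f p)
      (interior_anticomm x y (Pi.single (p + 2) P : Forms R V U))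
    have h2 : (P.curryLeft y).curryLeft x = -(P.curryLeft x).curryLeft y := by
      simpa [interior_single_succ] using h
    exact h2

theorem contr_zero {U : Type*} [AddCommGroup U] [Module R U] {p : ℕ} (x : V) :
    contr x (0 : V [⋀^Fin p]→ₗ[R] U) = 0 := by
  rcases p with _ | p <;> rfl

namespace PreLieAlgebroid

variable (𝒜 : PreLieAlgebroid R (Module.Dual R V)) (φ : V)

/-- The values of the Schouten-Jacobi bracket, in terms of shuffles. -/
def jacobiValue {p q : ℕ} (P : V [⋀^Fin p]→ₗ[R] R) (Q : V [⋀^Fin q]→ₗ[R] R) {n : ℕ}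
    (v : Fin n → V) : R :=
  𝒜.schoutenValue P Q v + ((p : ℤ) - 1) • shuffle (biadd (LinearMap.mul R R)) P (contr φ Q) v
    - ((-1) ^ (p + 1) * ((q : ℤ) - 1)) • shuffle (biadd (LinearMap.mul R R)) (contr φ P) Q v

theorem jacobiBracket_apply {p q n : ℕ} (h : p + q = n + 1) (P : V [⋀^Fin p]→ₗ[R] R)
    (Q : V [⋀^Fin q]→ₗ[R] R) (v : Fin n → V) :
    jacobiBracket 𝒜 φ h P Q v = 𝒜.jacobiValue φ P Q v := by
  have h1 : wedgeContract φ h P Q v = shuffle (biadd (LinearMap.mul R R)) P (contr φ Q) v := by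
    rcases q with _ | q
    · simp [wedgeContract, contr, shuffle_zero_right]
    · rw [wedgeContract, wedge_eq_wedgeWith, wedgeWith_apply]; rfl
  have h2 : contractWedge φ h P Q v = shuffle (biadd (LinearMap.mul R R)) (contr φ P) Q v := by
    rcases p with _ | p
    · simp [contractWedge, contr, shuffle_zero_left]
    · rw [contractWedge, wedge_eq_wedgeWith, wedgeWith_apply]; rfl
  rw [jacobiBracket, AlternatingMap.sub_apply, AlternatingMap.add_apply, AlternatingMap.smul_apply,
    AlternatingMap.smul_apply, h1, h2, schouten_apply]
  rfl

theorem jacobiValue_zero_left {p q : ℕ} (Q : V [⋀^Fin q]→ₗ[R] R) {n : ℕ} (v : Fin n → V) :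
    𝒜.jacobiValue φ (0 : V [⋀^Fin p]→ₗ[R] R) Q v = 0 := by
  have h : lastArg (0 : V [⋀^Fin p]→ₗ[R] R) = 0 := by rcases p with _ | p <;> rfl
  simp [jacobiValue, schoutenValue, h, contr_zero, shuffle_zero_left, shuffleMid_zero_left]

theorem jacobiValue_zero_right {p q : ℕ} (P : V [⋀^Fin p]→ₗ[R] R) {n : ℕ} (v : Fin n → V) :
    𝒜.jacobiValue φ P (0 : V [⋀^Fin q]→ₗ[R] R) v = 0 := by
  have h : firstArg (0 : V [⋀^Fin q]→ₗ[R] R) = 0 := by rcases q with _ | q <;> rfl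
  simp [jacobiValue, schoutenValue, h, contr_zero, shuffle_zero_right, shuffleMid_zero_right]

/-- The pairing `d^φ v` for a section `v` of the dual:
`(d^φ v)(α, β) = (dv)(α, β) + ⟨α, φ⟩⟨β, v⟩ - ⟨α, v⟩⟨β, φ⟩`. -/
def twistedDDual (v : V) : Module.Dual R V →ₗ[R] Module.Dual R V →ₗ[R] R :=
  LinearMap.mk₂ R (fun α β => 𝒜.dDual v α β + α φ * β v - α v * β φ)
    (fun α α' β => by simp [dDual, 𝒜.add_bracket]; ring)
    (fun c α β => by simp [dDual, 𝒜.smul_bracket]; ring)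
    (fun α β β' => by simp [dDual, 𝒜.bracket_add]; ring)
    (fun c α β => by simp [dDual, 𝒜.bracket_smul]; ring)

theorem twistedDDual_apply (v : V) (α β : Module.Dual R V) :
    𝒜.twistedDDual φ v α β = 𝒜.dDual v α β + α φ * β v - α v * β φ := rfl

/-- The two `φ`-terms of the pairing contract one form with `φ` and the other with `x`; they match
what is left over when the weights `p - 1` and `q - 1` drop by one. -/
theorem shuffle_twistedDDual {p q : ℕ} (P : V [⋀^Fin p]→ₗ[R] R) (Q : V [⋀^Fin q]→ₗ[R] R) (x : V)
    {n : ℕ} (v : Fin n → V) :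
    (-1 : ℤ) ^ p • shuffle (biadd (𝒜.twistedDDual φ x)) (lastArg P) (firstArg Q) v =
      (-1 : ℤ) ^ p • shuffle (𝒜.dDualHom x) (lastArg P) (firstArg Q) v
        - shuffle (biadd (LinearMap.mul R R)) (contr φ P) (contr x Q) v
        + shuffle (biadd (LinearMap.mul R R)) (contr x P) (contr φ Q) v := by
  rcases p with _ | p
  · have h : lastArg P = 0 := rfl
    simp [h, contr, shuffle_zero_left]
  · simp only [shuffle, biadd_apply, twistedDDual_apply, lastArg_apply, firstArg_apply, permSum_add,
      permSum_sub, smul_sub, smul_add, dDualHom_apply, LinearMap.mul_apply', smul_mul_assoc,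
      permSum_zsmul, Nat.add_sub_cancel]
    simp only [smul_comm ((-1 : ℤ) ^ (p + 1)), smul_smul ((-1 : ℤ) ^ (p + 1))]
    simp only [← pow_add, show p + 1 + p = 2 * p + 1 by ring, pow_succ, pow_mul]
    have hp : (-1 : R) ^ (p * 2) = 1 := by rw [pow_mul']; simp
    simp
    ring_nf
    rw [hp]
    simp

/-- Contraction with `x` acts as a graded derivation of the bracket up to the pairing `d^φ x`. Its
`dx` part comes from the middle slot of `shuffleMid`, its `φ` part from the change of the weights in
the two wedge terms. -/
theorem jacobiValue_cons {p q n : ℕ} (h : p + q = n + 1 + 1) (P : V [⋀^Fin p]→ₗ[R] R)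
    (Q : V [⋀^Fin q]→ₗ[R] R) (x : V) (v : Fin n → V) :
    𝒜.jacobiValue φ P Q (Fin.cons x v : Fin (n + 1) → V) =
      𝒜.jacobiValue φ (contr x P) Q v - (-1 : ℤ) ^ p • 𝒜.jacobiValue φ P (contr x Q) v
        + (-1 : ℤ) ^ p •
          shuffle (biadd (𝒜.twistedDDual φ x)) (lastArg P) (firstArg Q) v := by
  have t1 : shuffle 𝒜.anchorPairing (lastArg P) Q (Fin.cons x v : Fin (n + 1) → V) =
      shuffle 𝒜.anchorPairing (lastArg (contr x P)) Q v
        - (-1 : ℤ) ^ p • shuffle 𝒜.anchorPairing (lastArg P) (contr x Q) v := by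
    rcases p with _ | p
    · have h0 : lastArg P = 0 := rfl
      have h1 : lastArg (contr x P) = 0 := rfl
      simp [h0, h1, shuffle_zero_left]
    · rw [shuffle_cons _ _ _ (by simp; omega), lastArg_contr]
      simp [pow_succ]
  have t2 : shuffle 𝒜.anchorPairing.flip P (firstArg Q) (Fin.cons x v : Fin (n + 1) → V) =
      shuffle 𝒜.anchorPairing.flip (contr x P) (firstArg Q) v
        - (-1 : ℤ) ^ p • shuffle 𝒜.anchorPairing.flip P (firstArg (contr x Q)) v := by
    rcases q with _ | q
    · have h0 : firstArg Q = 0 := rfl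
      have h1 : firstArg (contr x Q) = 0 := rfl
      simp [h0, h1, shuffle_zero_right]
    · rw [shuffle_cons _ _ _ (by simp; omega), firstArg_contr, shuffle_neg_right]
      simp
  have t3 : shuffleMid 𝒜.dDualHom (lastArg P) (firstArg Q) (Fin.cons x v : Fin (n + 1) → V) =
      shuffleMid 𝒜.dDualHom (lastArg (contr x P)) (firstArg Q) v
        - (-1 : ℤ) ^ p • shuffle (𝒜.dDualHom x) (lastArg P) (firstArg Q) v
        - (-1 : ℤ) ^ p • shuffleMid 𝒜.dDualHom (lastArg P) (firstArg (contr x Q)) v := by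
    rcases p with _ | p
    · have h0 : lastArg P = 0 := rfl
      have h1 : lastArg (contr x P) = 0 := rfl
      simp [h0, h1, shuffle_zero_left, shuffleMid_zero_left]
    · rcases q with _ | q
      · have h0 : firstArg Q = 0 := rfl
        have h1 : firstArg (contr x Q) = 0 := rfl
        simp [h0, h1, shuffle_zero_right, shuffleMid_zero_right]
      · rw [shuffleMid_cons _ _ _ (by simp; omega), lastArg_contr, firstArg_contr,
          shuffleMid_neg_right]
        simp [pow_succ]
        ring
  -- The weight of the bracket with `contr x P` is `p - 2`; the missing copy is written separately.
  -- The truncated `p - 1` at `p = 0` does no harm because `contr x P = 0` there.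
  have t4 : ((p : ℤ) - 1) • shuffle (biadd (LinearMap.mul R R)) P (contr φ Q)
        (Fin.cons x v : Fin (n + 1) → V) =
      (((p - 1 : ℕ) : ℤ) - 1) • shuffle (biadd (LinearMap.mul R R)) (contr x P) (contr φ Q) v
      + shuffle (biadd (LinearMap.mul R R)) (contr x P) (contr φ Q) v
      - (-1 : ℤ) ^ p • ((p : ℤ) - 1) •
        shuffle (biadd (LinearMap.mul R R)) P (contr φ (contr x Q)) v := by
    rcases q with _ | q
    · have h0 : contr φ Q = 0 := rfl
      have h1 : contr φ (contr x Q) = 0 := rfl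
      simp [h0, h1, shuffle_zero_right]
    · rw [shuffle_cons _ _ _ (by simp; omega), contr_contr x φ, shuffle_neg_right]
      rcases p with _ | p
      · have h0 : contr x P = 0 := rfl
        simp [h0, shuffle_zero_left]
      · simp only [Nat.add_sub_cancel, zsmul_eq_mul]; push_cast; ring
  have t5 : ((-1) ^ (p + 1) * ((q : ℤ) - 1)) • shuffle (biadd (LinearMap.mul R R)) (contr φ P) Q
        (Fin.cons x v : Fin (n + 1) → V) =
      ((-1) ^ (p - 1 + 1) * ((q : ℤ) - 1)) •
        shuffle (biadd (LinearMap.mul R R)) (contr φ (contr x P)) Q v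
      - (-1 : ℤ) ^ p • ((-1) ^ (p + 1) * (((q - 1 : ℕ) : ℤ) - 1)) •
        shuffle (biadd (LinearMap.mul R R)) (contr φ P) (contr x Q) v
      + shuffle (biadd (LinearMap.mul R R)) (contr φ P) (contr x Q) v := by
    rcases p with _ | p
    · have h0 : contr φ P = 0 := rfl
      have h1 : contr φ (contr x P) = 0 := rfl
      simp [h0, h1, shuffle_zero_left]
    · have hp : (-1 : R) ^ p * (-1) ^ p = 1 := by rw [← mul_pow]; simp
      rw [shuffle_cons _ _ _ (by simp; omega), contr_contr x φ]
      have hn : shuffle (biadd (LinearMap.mul R R)) (-contr φ (contr x P)) Q v =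
          - shuffle (biadd (LinearMap.mul R R)) (contr φ (contr x P)) Q v := by
        simpa using shuffle_zsmul_left (biadd (LinearMap.mul R R)) (-1) (contr φ (contr x P)) Q v
      rw [hn]
      rcases q with _ | q
      · have h0 : contr x Q = 0 := rfl
        simp only [h0, shuffle_zero_right, Nat.add_sub_cancel, zsmul_eq_mul]; push_cast; ring
      · simp only [Nat.add_sub_cancel, zsmul_eq_mul]; push_cast
        linear_combination ((q : R) * shuffle (biadd (LinearMap.mul R R)) (contr φ P) (contr x Q) v
          - ((q : R) - 1) * shuffle (biadd (LinearMap.mul R R)) (contr φ P) (contr x Q) v) * hp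
  rw [shuffle_twistedDDual]
  simp only [jacobiValue, schoutenValue, t1, t2, t3, t4, t5, smul_sub, smul_add]
  abel

end PreLieAlgebroid

end

/-! ### The Schouten-Jacobi bracket of the dual algebroid as a Koszul bracket -/

section

variable {R : Type*} [CommRing R] [Algebra ℝ R] {V : Type*} [AddCommGroup V] [Module R V]

theorem interior_single (v : V) {p : ℕ} (P : V [⋀^Fin p]→ₗ[R] R) (hp : p ≠ 0) :
    interior v (Pi.single p P : Forms R V R) = Pi.single (p - 1) (contr v P) := by
  rcases p with _ | p
  · exact absurd rfl hp
  · exact interior_single_succ v p P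

theorem gradeSign_single' (p : ℕ) (P : V [⋀^Fin p]→ₗ[R] R) :
    gradeSign (Pi.single p P : Forms R V R) = (-1 : ℤ) ^ p • Pi.single p P := by
  rw [gradeSign_single, Pi.single_smul]

theorem lastTotal_single (p : ℕ) (P : V [⋀^Fin (p + 1)]→ₗ[R] R) :
    lastTotal (Pi.single (p + 1) P) = Pi.single p (lastArg P) := by
  funext j
  by_cases h : j = p
  · subst h; simp [lastTotal]; rfl
  · simp only [lastTotal, AddMonoidHom.mk'_apply]
    rw [Pi.single_eq_of_ne (by omega), Pi.single_eq_of_ne h]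
    rfl

theorem firstTotal_single (p : ℕ) (P : V [⋀^Fin (p + 1)]→ₗ[R] R) :
    firstTotal (Pi.single (p + 1) P) = Pi.single p (firstArg P) := by
  funext j
  by_cases h : j = p
  · subst h; simp [firstTotal]; rfl
  · simp only [firstTotal, AddMonoidHom.mk'_apply]
    rw [Pi.single_eq_of_ne (by omega), Pi.single_eq_of_ne h]
    rfl

theorem lastTotal_single_zero (f : V [⋀^Fin 0]→ₗ[R] R) :
    lastTotal (Pi.single 0 f) = 0 := by
  funext j
  simp only [lastTotal, AddMonoidHom.mk'_apply]
  rw [Pi.single_eq_of_ne (by omega)]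
  rfl

theorem firstTotal_single_zero (f : V [⋀^Fin 0]→ₗ[R] R) :
    firstTotal (Pi.single 0 f) = 0 := by
  funext j
  simp only [firstTotal, AddMonoidHom.mk'_apply]
  rw [Pi.single_eq_of_ne (by omega)]
  rfl

theorem contraction_single (B : Module.Dual R V →ₗ[R] Module.Dual R V →ₗ[R] R) {p q n : ℕ}
    (h : p + q = n + 1 + 1) (P : V [⋀^Fin p]→ₗ[R] R) (Q : V [⋀^Fin q]→ₗ[R] R) (u : Fin n → V) :
    contraction B (Pi.single p P) (Pi.single q Q) n u =
      shuffle (biadd B) (lastArg P) (firstArg Q) u := by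
  rw [contraction_apply]
  rcases p with _ | p
  · rw [lastTotal_single_zero]
    have h0 : lastArg P = 0 := rfl
    simp [h0, shuffle_zero_left]
  · rcases q with _ | q
    · rw [firstTotal_single_zero]
      have h0 : firstArg Q = 0 := rfl
      simp [h0, shuffle_zero_right]
    · rw [lastTotal_single, firstTotal_single, wedgeTotal_single B (n := n) (by omega),
        Pi.single_eq_same, wedgeWith_apply]

theorem linearPart_single_one (P : V [⋀^Fin 1]→ₗ[R] R) (x : V) :
    linearPart (Pi.single 1 P : Forms R V R) x = P ![x] := by
  rw [linearPart_apply, interior_apply, Pi.single_eq_same]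
  rfl

theorem linearPart_single_of_ne {p : ℕ} (hp : p ≠ 1) (P : V [⋀^Fin p]→ₗ[R] R) :
    linearPart (Pi.single p P : Forms R V R) = 0 := by
  ext x
  rw [linearPart_apply, interior_apply, Pi.single_eq_of_ne (by omega)]
  rfl

namespace PreLieAlgebroid

variable (𝒜 : PreLieAlgebroid R V) (φ : Module.Dual R V)

theorem linearPart_diff (P : Forms R V R) :
    linearPart (𝒜.diff φ P) = 𝒜.dFun φ (P 0 ![]) := by
  ext x
  rw [linearPart_apply, interior_diff, dFun_apply]
  simp [lie_apply_zero]

theorem dual_bracket_apply (S : Bivector R V) (α β : Module.Dual R V) (v : V) :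
    (𝒜.dual φ S).bracket α β v =
      𝒜.lieDeriv φ (S.sharp α) β v - 𝒜.lieDeriv φ (S.sharp β) α v
        - 𝒜.dFun φ (β (S.sharp α)) v := rfl

theorem dual_anchor (S : Bivector R V) (α : Module.Dual R V) :
    (𝒜.dual φ S).anchor α = 𝒜.anchor (S.sharp α) := rfl

/-- The link between the two recursions: their error terms agree. It follows from the definition of
the dual bracket and the skewness of `S`; the choice of `-(S.sharp φ)` as the twist is exactly what
absorbs the terms in `φ`. -/
theorem twistedDDual_dual (S : Bivector R V) (v : V) :
    (𝒜.dual φ S).twistedDDual (-(S.sharp φ)) v = - 𝒜.liePairing φ v (sharpPairing S.sharp) := by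
  ext α β
  simp only [twistedDDual_apply, dDual, dual_bracket_apply, dual_anchor, LinearMap.neg_apply,
    liePairing_apply, sharpPairing_apply, lieDeriv_apply, dFun_apply, map_neg]
  rw [S.skew (𝒜.lieDeriv φ v α) β, lieDeriv_apply, S.skew α β, S.skew φ α, S.skew φ β,
    𝒜.bracket_swap v (S.sharp α), 𝒜.bracket_swap v (S.sharp β), map_neg, map_neg, map_neg]
  ring

/-- Induction on the resulting degree: by `jacobiValue_cons`, `interior_koszul` and
`twistedDDual_dual` both brackets satisfy the same recursion. The right side makes its interaction
with `diff` and insertions accessible. -/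
theorem jacobiBracket_dual (S : Bivector R V) : ∀ {n p q : ℕ} (h : p + q = n + 1)
    (P : V [⋀^Fin p]→ₗ[R] R) (Q : V [⋀^Fin q]→ₗ[R] R),
    jacobiBracket (𝒜.dual φ S) (-(S.sharp φ)) h P Q =
      𝒜.koszul φ S.sharp (Pi.single p P) (Pi.single q Q) n := by
  intro n
  induction n with
  | zero =>
    intro p q h P Q
    ext u
    rw [jacobiBracket_apply]
    have hu : u = ![] := Subsingleton.elim _ _
    subst hu
    rw [koszul_apply, Pi.sub_apply, Pi.add_apply, AlternatingMap.sub_apply,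
      AlternatingMap.add_apply, contraction_apply_zero, contraction_apply_zero, diff_apply_zero,
      AlternatingMap.zero_apply, sub_zero, linearPart_diff, linearPart_diff]
    -- In resulting degree zero, one argument is a section and the other a function; both brackets
    -- are then the twisted derivative of the function along the section.
    have hc : (p = 1 ∧ q = 0) ∨ (p = 0 ∧ q = 1) := by omega
    rcases hc with ⟨rfl, rfl⟩ | ⟨rfl, rfl⟩
    · have h1 : shuffle (𝒜.dual φ S).anchorPairing (lastArg P) Q ![] =
          𝒜.anchor (S.sharp (linearPart (Pi.single 1 P : Forms R V R))) (Q ![]) := by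
        rw [shuffle_degree_zero_left]
        have e : lastArg P ![] = linearPart (Pi.single 1 P : Forms R V R) := by
          ext x
          rw [linearPart_single_one, lastArg_apply]
          exact one_smul ℤ (P ![x])
        rw [e]; rfl
      have h2 : shuffle (biadd (LinearMap.mul R R)) (contr (-(S.sharp φ)) P) Q ![] =
          linearPart (Pi.single 1 P : Forms R V R) (-(S.sharp φ)) * Q ![] := by
        rw [shuffle_degree_zero_left, linearPart_single_one]; rfl
      have h3 : firstArg Q = 0 := rfl
      have h4 : contr (-(S.sharp φ)) Q = 0 := rfl
      simp only [jacobiValue, schoutenValue, h1, h2, h3, h4, shuffle_zero_right,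
        shuffleMid_zero_right, sharpPairing_apply, dFun_apply, Pi.single_eq_same,
        linearPart_single_of_ne (p := 0) (by norm_num), map_zero, LinearMap.zero_apply]
      rw [map_neg, S.skew φ]
      simp
    · have h1 : shuffle (𝒜.dual φ S).anchorPairing.flip P (firstArg Q) ![] =
          𝒜.anchor (S.sharp (linearPart (Pi.single 1 Q : Forms R V R))) (P ![]) := by
        rw [shuffle_degree_zero_left]
        have e : firstArg Q ![] = linearPart (Pi.single 1 Q : Forms R V R) := by
          ext x
          rw [linearPart_single_one, firstArg_apply]
          rfl
        rw [e]; rfl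
      have h2 : shuffle (biadd (LinearMap.mul R R)) P (contr (-(S.sharp φ)) Q) ![] =
          P ![] * linearPart (Pi.single 1 Q : Forms R V R) (-(S.sharp φ)) := by
        rw [shuffle_degree_zero_left, linearPart_single_one]; rfl
      have h3 : lastArg P = 0 := rfl
      have h4 : contr (-(S.sharp φ)) P = 0 := rfl
      simp only [jacobiValue, schoutenValue, h1, h2, h3, h4, shuffle_zero_left,
        shuffleMid_zero_left, sharpPairing_apply, dFun_apply, Pi.single_eq_same,
        linearPart_single_of_ne (p := 0) (by norm_num), map_zero, LinearMap.zero_apply,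
        gradeSign_zero]
      rw [S.skew, dFun_apply, map_neg, S.skew φ]
      simp
      ring
  | succ n ih =>
    intro p q h P Q
    ext u
    rw [jacobiBracket_apply, ← Fin.cons_self_tail u, jacobiValue_cons _ _ h]
    generalize u 0 = x
    generalize Fin.tail u = w
    rw [← interior_apply, interior_koszul, gradeSign_single', twistedDDual_dual]
    have e1 : (𝒜.dual φ S).jacobiValue (-(S.sharp φ)) (contr x P) Q w =
        𝒜.koszul φ S.sharp (interior x (Pi.single p P)) (Pi.single q Q) n w := by
      -- A function has no contraction, and its truncated degree `p - 1 = 0` would violate the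
      -- degree condition of `ih`; here both sides vanish.
      by_cases hp : p = 0
      · subst hp
        have h0 : contr x P = 0 := rfl
        rw [h0, jacobiValue_zero_left, interior_single_zero, map_zero]
        rfl
      · rw [interior_single x P hp, ← ih (by omega), jacobiBracket_apply]
    have e2 : (𝒜.dual φ S).jacobiValue (-(S.sharp φ)) P (contr x Q) w =
        𝒜.koszul φ S.sharp (Pi.single p P) (interior x (Pi.single q Q)) n w := by
      by_cases hq : q = 0
      · subst hq
        have h0 : contr x Q = 0 := rfl
        rw [h0, jacobiValue_zero_right, interior_single_zero, map_zero]
        rfl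
      · rw [interior_single x Q hq, ← ih (by omega), jacobiBracket_apply]
    have e3 : ∀ B : Module.Dual R V →ₗ[R] Module.Dual R V →ₗ[R] R,
        shuffle (biadd (-B)) (lastArg P) (firstArg Q) w =
          - contraction B (Pi.single p P) (Pi.single q Q) n w := by
      intro B
      rw [contraction_single B h]
      simp [shuffle, permSum_neg]
    rw [e1, e2, e3]
    simp only [map_zsmul, AddMonoidHom.smul_apply, Pi.sub_apply, Pi.smul_apply,
      AlternatingMap.sub_apply, AlternatingMap.smul_apply, smul_neg]
    ring

end PreLieAlgebroid

end

section

variable {R : Type*} [CommRing R] [Algebra ℝ R] {V : Type*} [AddCommGroup V] [Module R V]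

/-! ### Insertions and deformations -/

theorem insertion_add (A B : V →ₗ[R] V) (P : Forms R V R) :
    insertion (A + B) P = insertion A P + insertion B P := by
  funext k; ext u
  simp [insertion_apply, Finset.sum_add_distrib]

theorem insertion_sub (A B : V →ₗ[R] V) (P : Forms R V R) :
    insertion (A - B) P = insertion A P - insertion B P := by
  have h := insertion_add (A - B) B P
  rw [sub_add_cancel] at h
  rw [h, add_sub_cancel_right]

/-- Insertion acts on forms through transposes, so the order of composition is reversed in the
commutator. -/
theorem insertion_insertion_sub (A B : V →ₗ[R] V) (P : Forms R V R) :
    insertion A (insertion B P) - insertion B (insertion A P) =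
      insertion (B ∘ₗ A - A ∘ₗ B) P := by
  rw [← sub_eq_zero]
  refine Forms.eq_zero_of_interior (fun P => insertion A (insertion B P) -
    insertion B (insertion A P) - insertion (B ∘ₗ A - A ∘ₗ B) P) (fun P => by simp)
    (fun n hn P v => ?_) P
  have e : interior v (insertion A (insertion B P) - insertion B (insertion A P)
      - insertion (B ∘ₗ A - A ∘ₗ B) P) = insertion A (insertion B (interior v P))
        - insertion B (insertion A (interior v P))
        - insertion (B ∘ₗ A - A ∘ₗ B) (interior v P) := by
    simp only [map_sub, interior_insertion, map_add, LinearMap.sub_apply, LinearMap.comp_apply,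
      AddMonoidHom.sub_apply]
    abel
  rw [e]; exact hn _

theorem linearPart_insertion (A : V →ₗ[R] V) (P : Forms R V R) :
    linearPart (insertion A P) = linearPart P ∘ₗ A := by
  ext x
  rw [linearPart_apply, interior_insertion, LinearMap.comp_apply, linearPart_apply]
  simp

/-- `B(α ∘ A, β) + B(α, β ∘ A)`. -/
def insertPairing (A : V →ₗ[R] V) (B : Module.Dual R V →ₗ[R] Module.Dual R V →ₗ[R] R) :
    Module.Dual R V →ₗ[R] Module.Dual R V →ₗ[R] R :=
  LinearMap.mk₂ R (fun α β => B (α ∘ₗ A) β + B α (β ∘ₗ A))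
    (fun α α' β => by simp [LinearMap.add_comp]; ring)
    (fun c α β => by simp [LinearMap.smul_comp]; ring)
    (fun α β β' => by simp [LinearMap.add_comp]; ring)
    (fun c α β => by simp [LinearMap.smul_comp]; ring)

theorem insertPairing_apply (A : V →ₗ[R] V) (B : Module.Dual R V →ₗ[R] Module.Dual R V →ₗ[R] R)
    (α β : Module.Dual R V) : insertPairing A B α β = B (α ∘ₗ A) β + B α (β ∘ₗ A) := rfl

/-- The first two terms on the right also insert `A` into the contracted slots; `insertPairing`
takes these contributions away. -/
theorem insertion_contraction (A : V →ₗ[R] V)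
    (B : Module.Dual R V →ₗ[R] Module.Dual R V →ₗ[R] R) (P Q : Forms R V R) :
    insertion A (contraction B P Q) = contraction B (insertion A P) Q
      + contraction B P (insertion A Q) - contraction (insertPairing A B) P Q := by
  have h := IsGradedProduct.ext (M := fun P Q => contraction B (insertion A P) Q
      + contraction B P (insertion A Q) - insertion A (contraction B P Q))
    (M' := fun P Q => contraction (insertPairing A B) P Q) (fun v P Q => by
      simp only [map_sub, interior_insertion, interior_contraction, map_add,
        AddMonoidHom.add_apply, ← gradeSign_insertion]
      abel) (isGradedProduct_contraction _) (fun P Q => by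
      ext u
      simp [contraction_apply_zero, linearPart_insertion, insertPairing_apply]) P Q
  rw [← h]; abel

namespace PreLieAlgebroid

variable (𝒜 : PreLieAlgebroid R V) (φ : Module.Dual R V)

/-- The deformed bracket with `v` is the bracket with `N v` plus the endomorphism `lieEnd v N`. -/
theorem lie_deform (N : V →ₗ[R] V) (v : V) (P : Forms R V R) :
    (𝒜.deform N).lie (φ ∘ₗ N) v P = 𝒜.lie φ (N v) P - insertion (𝒜.lieEnd v N) P := by
  funext k
  ext w
  have h : ∀ j, P k (Function.update w j ((𝒜.deform N).bracket v (w j))) =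
      P k (Function.update w j (𝒜.bracket (N v) (w j)))
        + P k (Function.update w j (𝒜.lieEnd v N (w j))) := by
    intro j
    rw [← AlternatingMap.map_update_add]
    congr 2
    show 𝒜.bracket (N v) (w j) + 𝒜.bracket v (N (w j)) - N (𝒜.bracket v (w j)) = _
    rw [lieEnd_apply]; abel
  simp only [Pi.sub_apply, AlternatingMap.sub_apply, lie_apply, insertion_apply, insertSum_apply,
    h, Finset.sum_add_distrib]
  show 𝒜.anchor (N v) _ - _ + φ (N v) * _ = _
  ring

/-- Makes the deformed differential a commutator, twist included: by `lie_deform` and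
`lie_insertion`, both sides have the same Lie derivatives. Later statements about it become
commutator algebra. -/
theorem diff_deform (N : V →ₗ[R] V) (P : Forms R V R) :
    (𝒜.deform N).diff (φ ∘ₗ N) P = insertion N (𝒜.diff φ P) - 𝒜.diff φ (insertion N P) := by
  rw [← sub_eq_zero]
  refine Forms.eq_zero_of_interior (fun P => (𝒜.deform N).diff (φ ∘ₗ N) P -
    (insertion N (𝒜.diff φ P) - 𝒜.diff φ (insertion N P))) (fun P => by simp) (fun n hn P v => ?_) P
  have e : interior v ((𝒜.deform N).diff (φ ∘ₗ N) P -
      (insertion N (𝒜.diff φ P) - 𝒜.diff φ (insertion N P))) =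
      -((𝒜.deform N).diff (φ ∘ₗ N) (interior v P) -
      (insertion N (𝒜.diff φ (interior v P)) - 𝒜.diff φ (insertion N (interior v P)))) := by
    simp only [map_sub, map_add, interior_diff, interior_insertion, lie_deform, lie_insertion]
    abel
  rw [e, Pi.neg_apply, hn, neg_zero]

variable {𝒜 φ}

/-- The bivector `N π`, when `N π♯ = π♯ N*`. -/
def composedBivector (π : Bivector R V) (N : V →ₗ[R] V)
    (hcomm : ∀ α, N (π.sharp α) = π.sharp (α ∘ₗ N)) : Bivector R V where
  sharp := N ∘ₗ π.sharp
  skew α β := by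
    have h1 := π.skew α (β ∘ₗ N)
    simp only [LinearMap.comp_apply] at h1 ⊢
    rw [h1, hcomm]

/-- The concomitant condition evaluated on `v`. By `twistedDDual_dual`, applied to `π` and to the
bivector `Nπ`, these Lie derivatives are expressed through the brackets of `π` and `Nπ`. -/
theorem IsCompatible.liePairing {π : Bivector R V} {N : V →ₗ[R] V} (h : 𝒜.IsCompatible φ π N)
    (v : V) : insertPairing N (𝒜.liePairing φ v (sharpPairing π.sharp)) =
      𝒜.liePairing φ (N v) (sharpPairing π.sharp)
        + 𝒜.liePairing φ v (sharpPairing (N ∘ₗ π.sharp)) := by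
  have h1 : ∀ (π : Bivector R V) (v : V) (α β), 𝒜.liePairing φ v (sharpPairing π.sharp) α β =
      -((𝒜.dual φ π).twistedDDual (-(π.sharp φ)) v α β) := by
    intro π v α β
    rw [twistedDDual_dual]; simp
  have h3 : ∀ α β, 𝒜.liePairing φ v (sharpPairing (N ∘ₗ π.sharp)) α β = _ := h1 (composedBivector π N h.comm) v
  ext α β
  have hc := congrArg (fun f : Module.Dual R V => f v) (h.concomitant α β)
  have e0 : ∀ α β : Module.Dual R V, (𝒜.dual φ π).bracket α β = 𝒜.dualBracket φ π.sharp α β :=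
    fun _ _ => rfl
  have e1 : (𝒜.dual φ (composedBivector π N h.comm)).bracket α β = 𝒜.dualBracket φ (N ∘ₗ π.sharp) α β := rfl
  have e2 : ∀ α : Module.Dual R V, (composedBivector π N h.comm).sharp α = N (π.sharp α) := fun _ => rfl
  simp only [insertPairing_apply, h1, h3, LinearMap.neg_apply, LinearMap.add_apply, twistedDDual_apply,
    dDual, dual_anchor, e0, e1, e2, map_neg, LinearMap.comp_apply, LinearMap.sub_apply] at hc ⊢
  rw [hc]
  simp only [← h.comm]
  ring

theorem koszul_apply_zero (S : Module.Dual R V →ₗ[R] V) (P Q : Forms R V R) (u : Fin 0 → V) :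
    𝒜.koszul φ S P Q 0 u = 𝒜.dFun φ (Q 0 ![]) (S (linearPart P))
      + linearPart Q (S (𝒜.dFun φ (P 0 ![]))) := by
  simp only [koszul_apply, Pi.sub_apply, Pi.add_apply, AlternatingMap.sub_apply,
    AlternatingMap.add_apply, contraction_apply_zero, diff_apply_zero, linearPart_diff,
    AlternatingMap.zero_apply, gradeSign_zero, sharpPairing_apply, sub_zero]

theorem dFun_zero : 𝒜.dFun φ 0 = 0 := by
  ext v; simp [dFun_apply]

/-- The concomitant condition carried over to all degrees: the error terms of the recursions match
by `IsCompatible.liePairing`, and in degree zero the identity is `N π♯ = π♯ N*`. -/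
theorem IsCompatible.insertion_koszul {π : Bivector R V} {N : V →ₗ[R] V}
    (h : 𝒜.IsCompatible φ π N) (P Q : Forms R V R) :
    insertion N (𝒜.koszul φ π.sharp P Q) = 𝒜.koszul φ π.sharp (insertion N P) Q
      + 𝒜.koszul φ π.sharp P (insertion N Q) - 𝒜.koszul φ (N ∘ₗ π.sharp) P Q := by
  rw [← sub_eq_zero]
  refine Forms.eq_zero_of_interior (I := Forms R V R × Forms R V R)
    (fun i => insertion N (𝒜.koszul φ π.sharp i.1 i.2) - (𝒜.koszul φ π.sharp (insertion N i.1) i.2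
      + 𝒜.koszul φ π.sharp i.1 (insertion N i.2) - 𝒜.koszul φ (N ∘ₗ π.sharp) i.1 i.2))
    (fun i => ?_) (fun n hn i v => ?_) (P, Q)
  · ext u
    simp only [Pi.sub_apply, Pi.add_apply, AlternatingMap.sub_apply,
      AlternatingMap.add_apply, koszul_apply_zero, insertion_apply_zero, linearPart_insertion,
      AlternatingMap.zero_apply, dFun_zero, map_zero, LinearMap.zero_apply, ← h.comm,
      LinearMap.comp_apply]
    ring
  · obtain ⟨P, Q⟩ := i
    have e : interior v (insertion N (𝒜.koszul φ π.sharp P Q)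
        - (𝒜.koszul φ π.sharp (insertion N P) Q + 𝒜.koszul φ π.sharp P (insertion N Q)
          - 𝒜.koszul φ (N ∘ₗ π.sharp) P Q)) =
        (insertion N (𝒜.koszul φ π.sharp (interior v P) Q)
          - (𝒜.koszul φ π.sharp (insertion N (interior v P)) Q
            + 𝒜.koszul φ π.sharp (interior v P) (insertion N Q)
            - 𝒜.koszul φ (N ∘ₗ π.sharp) (interior v P) Q))
        - (insertion N (𝒜.koszul φ π.sharp (gradeSign P) (interior v Q))
          - (𝒜.koszul φ π.sharp (insertion N (gradeSign P)) (interior v Q)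
            + 𝒜.koszul φ π.sharp (gradeSign P) (insertion N (interior v Q))
            - 𝒜.koszul φ (N ∘ₗ π.sharp) (gradeSign P) (interior v Q))) := by
      -- Contractions are additive in the pairing, because graded products are determined by their
      -- values in degree zero.
      have hB : ∀ X Y, contraction (insertPairing N (𝒜.liePairing φ v (sharpPairing π.sharp))) X Y =
          contraction (𝒜.liePairing φ (N v) (sharpPairing π.sharp)) X Y
          + contraction (𝒜.liePairing φ v (sharpPairing (N ∘ₗ π.sharp))) X Y := by
        intro X Y
        rw [h.liePairing]
        refine IsGradedProduct.ext (M' := fun X Y =>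
          contraction (𝒜.liePairing φ (N v) (sharpPairing π.sharp)) X Y
          + contraction (𝒜.liePairing φ v (sharpPairing (N ∘ₗ π.sharp))) X Y)
          (isGradedProduct_contraction _) (fun v P Q => ?_) (fun P Q => ?_) X Y
        · simp only [map_add, interior_contraction]; abel
        · ext u; simp [contraction_apply_zero]
      simp only [map_sub, map_add, interior_insertion, interior_koszul, insertion_contraction,
        AddMonoidHom.add_apply, AddMonoidHom.sub_apply, hB, gradeSign_insertion]
      abel
    have h1 := hn (interior v P, Q)
    have h2 := hn (gradeSign P, interior v Q)
    dsimp only at h1 h2 ⊢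
    rw [e, Pi.sub_apply, h1, h2, sub_zero]

/-- `diff` derives the bracket of `π` and that of `Nπ`; so in the commutator with the insertion of
`N` the terms with `Nπ` cancel. -/
theorem IsCompatible.diff_koszul {π : Bivector R V} {N : V →ₗ[R] V} (h𝒜 : IsLieAlgebroid 𝒜)
    (hφ : 𝒜.IsCocycle φ) (h : 𝒜.IsCompatible φ π N) (P Q : Forms R V R) :
    (𝒜.deform N).diff (φ ∘ₗ N) (𝒜.koszul φ π.sharp P Q) =
      𝒜.koszul φ π.sharp ((𝒜.deform N).diff (φ ∘ₗ N) P) Q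
        - 𝒜.koszul φ π.sharp (gradeSign P) ((𝒜.deform N).diff (φ ∘ₗ N) Q) := by
  simp only [diff_deform, 𝒜.diff_koszul φ h𝒜 hφ, map_sub, map_add, h.insertion_koszul,
    AddMonoidHom.sub_apply, gradeSign_insertion]
  abel

theorem contraction_single_one (S : Module.Dual R V →ₗ[R] V) (A : V [⋀^Fin 1]→ₗ[R] R)
    (P : Forms R V R) : contraction (sharpPairing S) (Pi.single 1 A) P =
      interior (S (linearPart (Pi.single 1 A : Forms R V R))) P := by
  rw [← sub_eq_zero]
  refine Forms.eq_zero_of_interior (fun P => contraction (sharpPairing S) (Pi.single 1 A) P -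
    interior (S (linearPart (Pi.single 1 A : Forms R V R))) P) (fun P => ?_) (fun n hn P v => ?_) P
  · ext u
    have hu : u = ![] := Subsingleton.elim _ _
    subst hu
    simp [contraction_apply_zero, linearPart_apply]
  · have h0 : ∀ f : V [⋀^Fin 0]→ₗ[R] R, contraction (sharpPairing S) (Pi.single 0 f) P = 0 := by
      intro f
      rw [contraction_apply, lastTotal_single_zero, map_zero, AddMonoidHom.zero_apply]
    have e : interior v (contraction (sharpPairing S) (Pi.single 1 A) P -
        interior (S (linearPart (Pi.single 1 A : Forms R V R))) P) =
        -(contraction (sharpPairing S) (Pi.single 1 A) (interior v P) -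
        interior (S (linearPart (Pi.single 1 A : Forms R V R))) (interior v P)) := by
      rw [map_sub, interior_contraction, interior_single_succ, h0, gradeSign_single',
        interior_anticomm v]
      simp
      abel
    rw [e, Pi.neg_apply, hn, neg_zero]

/-- A `2`-form raised by `S` is an endomorphism, and contracting with it inserts that endomorphism.
For a `3`-form this applies after one contraction, where `T` becomes the torsion with one argument
fixed. -/
theorem contraction_single_two (S : Module.Dual R V →ₗ[R] V) (A : V [⋀^Fin 2]→ₗ[R] R)
    (T : V →ₗ[R] V) (hT : ∀ y, T y = S (linearPart (interior y (Pi.single 2 A : Forms R V R))))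
    (P : Forms R V R) : contraction (sharpPairing S) (Pi.single 2 A) P = insertion T P := by
  rw [← sub_eq_zero]
  refine Forms.eq_zero_of_interior (fun P => contraction (sharpPairing S) (Pi.single 2 A) P -
    insertion T P) (fun P => ?_) (fun n hn P v => ?_) P
  · ext u
    simp [contraction_apply_zero, linearPart_single_of_ne]
  · have e : interior v (contraction (sharpPairing S) (Pi.single 2 A) P - insertion T P) =
        contraction (sharpPairing S) (Pi.single 2 A) (interior v P) - insertion T (interior v P) := by
      rw [map_sub, interior_contraction, interior_insertion, hT, interior_single_succ,
        contraction_single_one, gradeSign_single']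
      simp
      abel
    rw [e, hn]

/-- The torsion as an endomorphism in its second argument. -/
theorem torsion_eq_lieEnd (N : V →ₗ[R] V) (v y : V) : 𝒜.torsion N v y =
    (𝒜.lieEnd (N v) N - N ∘ₗ 𝒜.lieEnd v N) y := by
  show 𝒜.bracket (N v) (N y) - N (𝒜.bracket (N v) y + 𝒜.bracket v (N y) - N (𝒜.bracket v y)) = _
  simp only [LinearMap.sub_apply, LinearMap.comp_apply, lieEnd_apply, map_sub, map_add]
  abel

/-- The left side anticommutes with contraction by `v` up to `-2` times the insertion of the torsion
`𝒯_N(v, -)`: one copy comes from the Lie derivative along `N v`, the other from commuting the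
insertion of `N` with the Lie derivative along `v`. By `hX`, the contraction with `X` has the same
behaviour. -/
theorem insertion_diff_deform (N : V →ₗ[R] V) (S : Module.Dual R V →ₗ[R] V)
    (X : V [⋀^Fin 3]→ₗ[R] R) (hX : ∀ v y, 𝒜.torsion N v y =
      S (linearPart (interior y (interior v (Pi.single 3 X : Forms R V R))))) (P : Forms R V R) :
    insertion N ((𝒜.deform N).diff (φ ∘ₗ N) P) - (𝒜.deform N).diff (φ ∘ₗ N) (insertion N P)
      - (insertion (N ∘ₗ N) (𝒜.diff φ P) - 𝒜.diff φ (insertion (N ∘ₗ N) P)) =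
      -(2 : ℤ) • contraction (sharpPairing S) (Pi.single 3 X) P := by
  rw [← sub_eq_zero]
  refine Forms.eq_zero_of_interior (fun P => insertion N ((𝒜.deform N).diff (φ ∘ₗ N) P)
    - (𝒜.deform N).diff (φ ∘ₗ N) (insertion N P)
    - (insertion (N ∘ₗ N) (𝒜.diff φ P) - 𝒜.diff φ (insertion (N ∘ₗ N) P))
      - -(2 : ℤ) • contraction (sharpPairing S) (Pi.single 3 X) P) (fun P => ?_)
      (fun n hn P v => ?_) P
  · ext u
    simp [contraction_apply_zero, linearPart_single_of_ne]
  · have hT : ∀ P : Forms R V R, contraction (sharpPairing S) (interior v (Pi.single 3 X)) P =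
        insertion (𝒜.lieEnd (N v) N) P - insertion (N ∘ₗ 𝒜.lieEnd v N) P := by
      intro P
      rw [← insertion_sub, interior_single_succ]
      refine contraction_single_two S _ _ (fun y => ?_) P
      rw [← torsion_eq_lieEnd, hX, interior_single_succ]
    have hg : gradeSign (Pi.single 3 X : Forms R V R) = - Pi.single 3 X := by
      rw [gradeSign_single']; norm_num
    -- Together with the product rule for `N ∘ N` in `hN`, this removes `lieEnd v N ∘ N` and leaves
    -- `N ∘ lieEnd v N` twice.
    have hc := insertion_insertion_sub N (𝒜.lieEnd v N) P
    have hN : insertion (𝒜.lieEnd v (N ∘ₗ N)) P = insertion (𝒜.lieEnd v N ∘ₗ N) P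
        + insertion (N ∘ₗ 𝒜.lieEnd v N) P := by
      rw [← insertion_add]
      congr 2
      ext y
      simp only [lieEnd_apply, LinearMap.add_apply, LinearMap.comp_apply, map_sub]
      abel
    rw [insertion_sub, sub_eq_iff_eq_add] at hc
    have e : interior v (insertion N ((𝒜.deform N).diff (φ ∘ₗ N) P)
        - (𝒜.deform N).diff (φ ∘ₗ N) (insertion N P)
        - (insertion (N ∘ₗ N) (𝒜.diff φ P) - 𝒜.diff φ (insertion (N ∘ₗ N) P))
        - -(2 : ℤ) • contraction (sharpPairing S) (Pi.single 3 X) P) =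
        -(insertion N ((𝒜.deform N).diff (φ ∘ₗ N) (interior v P))
        - (𝒜.deform N).diff (φ ∘ₗ N) (insertion N (interior v P))
        - (insertion (N ∘ₗ N) (𝒜.diff φ (interior v P))
          - 𝒜.diff φ (insertion (N ∘ₗ N) (interior v P)))
        - -(2 : ℤ) • contraction (sharpPairing S) (Pi.single 3 X) (interior v P)) := by
      simp only [map_sub, map_zsmul, interior_insertion, interior_diff, lie_deform, map_add,
        interior_contraction, hT, hg, map_neg, AddMonoidHom.neg_apply, 𝒜.lie_insertion φ, hN,
        LinearMap.comp_apply, hc]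
      abel
    rw [e, Pi.neg_apply, hn, neg_zero]

/-- With `d_N = i d - d i` and `d² = 0`, composing `insertion_diff_deform` with `d` on the left and
on the right and adding gives `-2 d_N²`; the terms with `N ∘ N` cancel. On the other side one finds
`-2` times the bracket with `X`, since `X` is closed of odd degree. -/
theorem diff_deform_sq (h𝒜 : IsLieAlgebroid 𝒜) (hφ : 𝒜.IsCocycle φ) (N : V →ₗ[R] V)
    (S : Module.Dual R V →ₗ[R] V) (X : V [⋀^Fin 3]→ₗ[R] R) (hX : ∀ v y, 𝒜.torsion N v y =
      S (linearPart (interior y (interior v (Pi.single 3 X : Forms R V R)))))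
    (hd : 𝒜.diff φ (Pi.single 3 X) = 0) (P : Forms R V R) :
    (𝒜.deform N).diff (φ ∘ₗ N) ((𝒜.deform N).diff (φ ∘ₗ N) P) =
      𝒜.koszul φ S (Pi.single 3 X) P := by
  have h1 := congrArg (𝒜.diff φ) (insertion_diff_deform (φ := φ) N S X hX P)
  have h2 := insertion_diff_deform (φ := φ) N S X hX (𝒜.diff φ P)
  have hg : gradeSign (Pi.single 3 X : Forms R V R) = - Pi.single 3 X := by
    rw [gradeSign_single']; norm_num
  simp only [koszul_apply, hg, map_neg, hd, neg_zero, map_zero, AddMonoidHom.zero_apply,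
    AddMonoidHom.neg_apply, sub_neg_eq_add, add_zero]
  simp only [diff_deform, map_sub, hφ.diff_diff h𝒜, map_zero, map_zsmul, sub_zero, zero_sub]
    at h1 h2 ⊢
  -- Division by two uses the real scalars on `R`.
  have h3 : ∀ A B : Forms R V R, (2 : ℤ) • A = (2 : ℤ) • B → A = B := by
    intro A B h
    funext k
    ext u
    have h4 := congrArg (fun f : Forms R V R => (2 : ℝ)⁻¹ • f k u) h
    have h5 : ∀ r : R, (2 : ℝ)⁻¹ • ((2 : ℤ) • r) = r := by
      intro r
      rw [← Int.cast_smul_eq_zsmul ℝ, smul_smul]; norm_num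
    simpa only [Pi.smul_apply, AlternatingMap.smul_apply, h5] using h4
  apply h3
  have h4 := congrArg₂ (· + ·) h1 h2
  rw [← sub_eq_zero] at h4
  rw [← sub_eq_zero, ← neg_eq_zero]
  refine Eq.trans ?_ h4
  rw [map_neg]
  abel

end PreLieAlgebroid

end

section

variable {R : Type*} [CommRing R] [Algebra ℝ R] {V : Type*} [AddCommGroup V] [Module R V]

/-! ### Quasi-differentials -/

namespace PreLieAlgebroid

variable (𝒜 : PreLieAlgebroid R V) (φ : Module.Dual R V)

/-- The untwisted differential is a graded derivation. The first two terms on the right contain the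
wedge with `φ` twice, the left side once; this accounts for the `W`-term of a quasi-differential,
with `W` the twist. -/
theorem diff_wedgeTotal (P Q : Forms R V R) :
    𝒜.diff φ (wedgeTotal (LinearMap.mul R R) P Q) =
      wedgeTotal (LinearMap.mul R R) (𝒜.diff φ P) Q
        + wedgeTotal (LinearMap.mul R R) (gradeSign P) (𝒜.diff φ Q)
        - wedgeTotal (LinearMap.mul R R) (Pi.single 1 (oneForm φ))
            (wedgeTotal (LinearMap.mul R R) P Q) := by
  -- The same double counting for Lie derivatives, where it concerns the function `φ v`.
  have hlie : ∀ (v : V) (P Q : Forms R V R), 𝒜.lie φ v (wedgeTotal (LinearMap.mul R R) P Q) =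
      wedgeTotal (LinearMap.mul R R) (𝒜.lie φ v P) Q
        + wedgeTotal (LinearMap.mul R R) P (𝒜.lie φ v Q)
        - wedgeTotal (LinearMap.mul R R) (Pi.single 0 ((oneForm φ).curryLeft v))
            (wedgeTotal (LinearMap.mul R R) P Q) := by
    intro v P Q
    have h := IsGradedProduct.ext
      (M' := fun P Q => -wedgeTotal (LinearMap.mul R R) (Pi.single 0 ((oneForm φ).curryLeft v))
            (wedgeTotal (LinearMap.mul R R) P Q))
      (𝒜.isGradedProduct_lie φ v _ (isGradedProduct_wedgeTotal (LinearMap.mul R R)))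
      (fun u P Q => by
        simp only [map_neg, interior_wedgeTotal, interior_single_zero, gradeSign_single, map_add,
          pow_zero, one_smul, map_zero, AddMonoidHom.zero_apply, zero_add]
        abel)
      (fun P Q => by
        ext u
        have hu : u = ![] := Subsingleton.elim _ _
        subst hu
        simp only [Pi.sub_apply, AlternatingMap.sub_apply, Pi.neg_apply, AlternatingMap.neg_apply,
          lie_apply_zero, wedgeTotal_apply_zero, Pi.single_eq_same, LinearMap.mul_apply',
          Derivation.leibniz, smul_eq_mul]
        have e : (oneForm φ).curryLeft v ![] = φ v := rfl
        rw [e]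
        ring) P Q
    rw [sub_sub, sub_eq_iff_eq_add] at h
    rw [h]
    abel
  rw [← sub_eq_zero]
  refine Forms.eq_zero_of_interior (I := Forms R V R × Forms R V R)
    (fun i => 𝒜.diff φ (wedgeTotal (LinearMap.mul R R) i.1 i.2) -
      (wedgeTotal (LinearMap.mul R R) (𝒜.diff φ i.1) i.2
        + wedgeTotal (LinearMap.mul R R) (gradeSign i.1) (𝒜.diff φ i.2)
        - wedgeTotal (LinearMap.mul R R) (Pi.single 1 (oneForm φ))
            (wedgeTotal (LinearMap.mul R R) i.1 i.2)))
    (fun i => ?_) (fun n hn i v => ?_) (P, Q)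
  · ext u
    simp [wedgeTotal_apply_zero]
  · obtain ⟨P, Q⟩ := i
    have e : interior v (𝒜.diff φ (wedgeTotal (LinearMap.mul R R) P Q) -
      (wedgeTotal (LinearMap.mul R R) (𝒜.diff φ P) Q
        + wedgeTotal (LinearMap.mul R R) (gradeSign P) (𝒜.diff φ Q)
        - wedgeTotal (LinearMap.mul R R) (Pi.single 1 (oneForm φ))
            (wedgeTotal (LinearMap.mul R R) P Q))) =
      -(𝒜.diff φ (wedgeTotal (LinearMap.mul R R) (interior v P) Q) -
      (wedgeTotal (LinearMap.mul R R) (𝒜.diff φ (interior v P)) Q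
        + wedgeTotal (LinearMap.mul R R) (gradeSign (interior v P)) (𝒜.diff φ Q)
        - wedgeTotal (LinearMap.mul R R) (Pi.single 1 (oneForm φ))
            (wedgeTotal (LinearMap.mul R R) (interior v P) Q)))
      -(𝒜.diff φ (wedgeTotal (LinearMap.mul R R) (gradeSign P) (interior v Q)) -
      (wedgeTotal (LinearMap.mul R R) (𝒜.diff φ (gradeSign P)) (interior v Q)
        + wedgeTotal (LinearMap.mul R R) (gradeSign (gradeSign P)) (𝒜.diff φ (interior v Q))
        - wedgeTotal (LinearMap.mul R R) (Pi.single 1 (oneForm φ))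
            (wedgeTotal (LinearMap.mul R R) (gradeSign P) (interior v Q)))) := by
      simp only [map_sub, map_add, interior_diff, interior_wedgeTotal, hlie, gradeSign_diff,
        interior_gradeSign, map_neg, AddMonoidHom.neg_apply, AddMonoidHom.sub_apply,
        gradeSign_gradeSign, interior_single_succ, gradeSign_single, pow_one, neg_smul, one_smul,
        Pi.single_neg]
      abel
    have h1 := hn (interior v P, Q)
    have h2 := hn (gradeSign P, interior v Q)
    dsimp only at h1 h2 ⊢
    rw [e, Pi.sub_apply, Pi.neg_apply, h1, h2, neg_zero, sub_zero]

theorem diff_single (p : ℕ) (P : V [⋀^Fin p]→ₗ[R] R) :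
    𝒜.diff φ (Pi.single p P) = Pi.single (p + 1) (𝒜.twistedD φ p P) := raise_single _ _ _

theorem twistedD_wedge (p q : ℕ) (P : V [⋀^Fin p]→ₗ[R] R) (Q : V [⋀^Fin q]→ₗ[R] R) :
    𝒜.twistedD φ (p + q) (wedge rfl P Q) =
      wedge (by omega) (𝒜.twistedD φ p P) Q + (-1 : ℤ) ^ p • wedge (by omega) P (𝒜.twistedD φ q Q)
        - wedge (by omega) (oneForm φ) (wedge (rfl : p + q = p + q) P Q) := by
  have h := congrArg (fun F : Forms R V R => F (p + q + 1))
    (𝒜.diff_wedgeTotal φ (Pi.single p P) (Pi.single q Q))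
  rw [gradeSign_single', map_zsmul, AddMonoidHom.smul_apply, diff_single, diff_single,
    wedgeTotal_single _ (rfl : p + q = p + q), diff_single,
    wedgeTotal_single _ (by omega : p + 1 + q = p + q + 1),
    wedgeTotal_single _ (by omega : p + (q + 1) = p + q + 1),
    wedgeTotal_single _ (by omega : 1 + (p + q) = p + q + 1)] at h
  simp only [Pi.single_eq_same, Pi.sub_apply, Pi.add_apply, Pi.smul_apply] at h
  exact h

variable {𝒜 φ}

theorem deform_dFun (N : V →ₗ[R] V) (f : R) :
    (𝒜.deform N).dFun (φ ∘ₗ N) f = 𝒜.dFun φ f ∘ₗ N := rfl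

theorem linearPart_single_twistedD_zero (f : V [⋀^Fin 0]→ₗ[R] R) :
    linearPart (Pi.single 1 (𝒜.twistedD φ 0 f)) = 𝒜.dFun φ (f ![]) := by
  have h := 𝒜.linearPart_diff φ (Pi.single 0 f)
  rwa [diff_single, Pi.single_eq_same] at h

theorem koszul_one_zero (S : Module.Dual R V →ₗ[R] V) (P : V [⋀^Fin 1]→ₗ[R] R)
    (f : V [⋀^Fin 0]→ₗ[R] R) (u : Fin 0 → V) :
    𝒜.koszul φ S (Pi.single 1 P) (Pi.single 0 f) 0 u =
      𝒜.dFun φ (f ![]) (S (linearPart (Pi.single 1 P))) := by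
  rw [koszul_apply_zero, linearPart_single_of_ne (p := 0) (by norm_num), Pi.single_eq_same,
    LinearMap.zero_apply, add_zero]

theorem koszul_zero_one (S : Module.Dual R V →ₗ[R] V) (P : V [⋀^Fin 1]→ₗ[R] R)
    (f : V [⋀^Fin 0]→ₗ[R] R) (u : Fin 0 → V) :
    𝒜.koszul φ S (Pi.single 0 f) (Pi.single 1 P) 0 u =
      linearPart (Pi.single 1 P) (S (𝒜.dFun φ (f ![]))) := by
  rw [koszul_apply_zero, linearPart_single_of_ne (p := 0) (by norm_num), Pi.single_eq_same, map_zero,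
    map_zero, zero_add]

theorem interior_koszul_function (S : Module.Dual R V →ₗ[R] V) (v : V) (P : Forms R V R)
    (f : V [⋀^Fin 0]→ₗ[R] R) : interior v (𝒜.koszul φ S P (Pi.single 0 f)) =
      𝒜.koszul φ S (interior v P) (Pi.single 0 f) := by
  rw [interior_koszul, interior_single_zero, contraction_apply, firstTotal_single_zero]
  simp

/-- The compatibility of `D` with the bracket of two functions. -/
theorem jacobiBracket_functions (π : Bivector R V) (N : V →ₗ[R] V) (f g : V [⋀^Fin 0]→ₗ[R] R) :
    (jacobiBracket (𝒜.dual φ π) (-(π.sharp φ)) (p := 1) (q := 0) (n := 0) rfl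
        ((𝒜.deform N).twistedD (φ ∘ₗ N) 0 f) g
      + (-1 : ℤ) ^ (0 + 1) • jacobiBracket (𝒜.dual φ π) (-(π.sharp φ)) (p := 0) (q := 1) (n := 0)
        rfl f ((𝒜.deform N).twistedD (φ ∘ₗ N) 0 g)) ![] =
      𝒜.dFun φ (g ![]) (π.sharp (𝒜.dFun φ (f ![]) ∘ₗ N) - N (π.sharp (𝒜.dFun φ (f ![])))) := by
  rw [jacobiBracket_dual, jacobiBracket_dual, AlternatingMap.add_apply, AlternatingMap.smul_apply,
    koszul_one_zero, koszul_zero_one, linearPart_single_twistedD_zero,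
    linearPart_single_twistedD_zero, deform_dFun, deform_dFun, map_sub]
  simp [sub_eq_add_neg]

/-- The three axioms come from `diff_wedgeTotal`, from `IsCompatible.diff_koszul` and, for two
functions, from `N π♯ = π♯ N*`. -/
theorem IsCompatible.isQuasiDifferential {π : Bivector R V} {N : V →ₗ[R] V}
    (h𝒜 : IsLieAlgebroid 𝒜) (hφ : 𝒜.IsCocycle φ) (h : 𝒜.IsCompatible φ π N) :
    IsQuasiDifferential (𝒜.dual φ π) (-(π.sharp φ)) (φ ∘ₗ N)
      ((𝒜.deform N).twistedD (φ ∘ₗ N)) where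
  map_wedge p q P Q := (𝒜.deform N).twistedD_wedge (φ ∘ₗ N) p q P Q
  map_bracket p q n hn P Q := by
    have hd := congrArg (fun F : Forms R V R => F (n + 1))
      (h.diff_koszul h𝒜 hφ (Pi.single p P) (Pi.single q Q))
    rw [diff_single, diff_single, gradeSign_single', map_zsmul, AddMonoidHom.smul_apply] at hd
    rw [jacobiBracket_dual, jacobiBracket_dual, jacobiBracket_dual]
    refine hd.trans ?_
    rw [Pi.sub_apply, Pi.smul_apply, pow_succ]
    simp [sub_eq_add_neg]
  map_bracket_zero f g := by
    ext u
    have hu : u = ![] := Subsingleton.elim _ _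
    subst hu
    rw [jacobiBracket_functions, ← h.comm, sub_self, map_zero]
    rfl

/-- `contractTwo` inserts `y` before `x`; reordering gives the sign that cancels the one in the
torsion condition. -/
theorem contractTwo_eq (x y : V) (X : V [⋀^Fin 3]→ₗ[R] R) : contractTwo x y X =
    -linearPart (interior y (interior x (Pi.single 3 X : Forms R V R))) := by
  rw [← map_neg, ← interior_anticomm, interior_single_succ, interior_single_succ]
  ext z
  rw [linearPart_single_one, contractTwo, AlternatingMap.ofSubsingleton_symm_apply_apply]
  congr 1
  funext i
  fin_cases i
  rfl

/-- For closed `X` only one term of the commutator `diff_deform` survives, `-d(i_N X)`. -/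
theorem twistedD_eq_zero_iff (N : V →ₗ[R] V) (X : V [⋀^Fin 3]→ₗ[R] R)
    (hX : 𝒜.twistedD φ 3 X = 0) :
    (𝒜.deform N).twistedD (φ ∘ₗ N) 3 X = 0 ↔ 𝒜.twistedD φ 3 (insertSum N X) = 0 := by
  have h := congrArg (fun F : Forms R V R => F 4) (𝒜.diff_deform φ N (Pi.single 3 X))
  have h1 : insertion N (𝒜.diff φ (Pi.single 3 X)) = 0 := by
    rw [diff_single, hX, Pi.single_zero, map_zero]
  have h2 : 𝒜.diff φ (insertion N (Pi.single 3 X)) 4 = 𝒜.twistedD φ 3 (insertSum N X) := by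
    show 𝒜.twistedD φ 3 (insertSum N ((Pi.single 3 X : Forms R V R) 3)) = _
    rw [Pi.single_eq_same]
  rw [h1, diff_single, Pi.single_eq_same, Pi.sub_apply, h2, Pi.zero_apply, zero_sub] at h
  rw [h, neg_eq_zero]

theorem twistedD_twistedD_deform (h𝒜 : IsLieAlgebroid 𝒜) (hφ : 𝒜.IsCocycle φ) {π : Bivector R V}
    {N : V →ₗ[R] V} {X : V [⋀^Fin 3]→ₗ[R] R}
    (hT : ∀ x y, 𝒜.torsion N x y = -π.sharp (contractTwo x y X))
    (hX : 𝒜.twistedD φ 3 X = 0) (k : ℕ) (P : V [⋀^Fin k]→ₗ[R] R) :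
    (𝒜.deform N).twistedD (φ ∘ₗ N) (k + 1) ((𝒜.deform N).twistedD (φ ∘ₗ N) k P) =
      jacobiBracket (𝒜.dual φ π) (-(π.sharp φ)) (by omega : 3 + k = k + 2 + 1) X P := by
  have h := congrArg (fun F : Forms R V R => F (k + 2))
    (diff_deform_sq h𝒜 hφ N π.sharp X (fun v y => by
      rw [hT, contractTwo_eq, map_neg, neg_neg]) (by rw [diff_single, hX, Pi.single_zero])
      (Pi.single k P))
  rw [diff_single, diff_single, Pi.single_eq_same] at h
  rw [jacobiBracket_dual, h]

end PreLieAlgebroid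

end

section

variable {R : Type*} [CommRing R] [Algebra ℝ R] {V : Type*} [AddCommGroup V] [Module R V]

/-! ### Compatibility from the bialgebroid conditions -/

namespace PreLieAlgebroid

variable {𝒜 : PreLieAlgebroid R V} {φ : Module.Dual R V}

theorem linearPart_interior_diff (v : V) (P : Forms R V R) :
    linearPart (interior v (𝒜.diff φ P)) =
      𝒜.lieDeriv φ v (linearPart P) - 𝒜.dFun φ (linearPart P v) := by
  rw [interior_diff, map_sub, linearPart_lie, linearPart_diff, ← linearPart_apply]

/-- The twisted Lie derivative commutes with the twisted differential of functions; the twisted Lie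
derivative of `f` along `x` is `𝒜.dFun φ f x`. -/
theorem lieDeriv_dFun (h𝒜 : IsLieAlgebroid 𝒜) (hφ : 𝒜.IsCocycle φ) (x : V) (f : R) :
    𝒜.lieDeriv φ x (𝒜.dFun φ f) = 𝒜.dFun φ (𝒜.dFun φ f x) := by
  ext v
  have h1 := congrArg (fun D : Derivation ℝ R R => D f) (h𝒜.anchor_bracket x v)
  have h2 := hφ x v
  simp only [Derivation.commutator_apply] at h1
  simp only [lieDeriv_apply, dFun_apply, map_add, Derivation.leibniz, smul_eq_mul, h1]
  linear_combination f * h2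

theorem deform_lieDeriv_apply (N : V →ₗ[R] V) (v w : V) (α : Module.Dual R V) :
    (𝒜.deform N).lieDeriv (φ ∘ₗ N) v α w =
      𝒜.anchor (N v) (α w) - α (𝒜.bracket (N v) w + 𝒜.bracket v (N w) - N (𝒜.bracket v w))
        + φ (N v) * α w := rfl

variable {π : Bivector R V} {N : V →ₗ[R] V}

/-- Separation gives the identity on differentials of functions. Skewness of `π` then moves a
general `α` to the other side of the pairing, and separation applies once more. -/
theorem comm_of_jacobiBracket_functions
    (hsep : ∀ y : V, (∀ f : R, 𝒜.dFun φ f y = 0) → y = 0)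
    (h : ∀ f g : R, 𝒜.dFun φ g (π.sharp (𝒜.dFun φ f ∘ₗ N) - N (π.sharp (𝒜.dFun φ f))) = 0)
    (α : Module.Dual R V) : N (π.sharp α) = π.sharp (α ∘ₗ N) := by
  have h1 : ∀ f : R, π.sharp (𝒜.dFun φ f ∘ₗ N) = N (π.sharp (𝒜.dFun φ f)) :=
    fun f => sub_eq_zero.1 (hsep _ (h f))
  refine (sub_eq_zero.1 (hsep _ fun f => ?_)).symm
  have h2 := π.skew (𝒜.dFun φ f) (α ∘ₗ N)
  have h3 := π.skew (𝒜.dFun φ f ∘ₗ N) α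
  simp only [LinearMap.comp_apply] at h2 h3
  rw [h1] at h3
  rw [map_sub, sub_eq_zero]
  rw [h3, neg_eq_iff_eq_neg, neg_neg] at h2
  exact h2.symm

/-- Evaluating both sides of `D² f = [X, f]` on `(x, y)` gives the differential of `f` on the
torsion and on `π♯` of the contracted `X`; the second derivatives of `f` cancel by `lieDeriv_dFun`
along `N x`. -/
theorem dFun_torsion_of_sq (h𝒜 : IsLieAlgebroid 𝒜) (hφ : 𝒜.IsCocycle φ) {X : V [⋀^Fin 3]→ₗ[R] R}
    (f : V [⋀^Fin 0]→ₗ[R] R)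
    (h : (𝒜.deform N).twistedD (φ ∘ₗ N) 1 ((𝒜.deform N).twistedD (φ ∘ₗ N) 0 f) =
      jacobiBracket (𝒜.dual φ π) (-(π.sharp φ)) (by omega : 3 + 0 = 0 + 2 + 1) X f) (x y : V) :
    𝒜.dFun φ (f ![]) (𝒜.torsion N x y + π.sharp (contractTwo x y X)) = 0 := by
  rw [jacobiBracket_dual] at h
  have h1 : linearPart (interior x ((𝒜.deform N).diff (φ ∘ₗ N)
      ((𝒜.deform N).diff (φ ∘ₗ N) (Pi.single 0 f)))) y =
      linearPart (interior x (𝒜.koszul φ π.sharp (Pi.single 3 X) (Pi.single 0 f))) y := by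
    rw [diff_single, diff_single, h, linearPart_apply, linearPart_apply, interior_apply,
      interior_apply, interior_apply, interior_apply, Pi.single_eq_same]
  rw [linearPart_interior_diff, linearPart_apply (interior x _), interior_koszul_function,
    interior_koszul_function, linearPart_diff, deform_dFun, interior_single_succ,
    interior_single_succ, koszul_one_zero, Pi.single_eq_same, LinearMap.sub_apply,
    deform_lieDeriv_apply] at h1
  have h2 := congrArg (fun α : Module.Dual R V => α (N y)) (lieDeriv_dFun h𝒜 hφ (N x) (f ![]))
  rw [map_add, contractTwo_eq, map_neg, map_neg, interior_single_succ, interior_single_succ, ← h1]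
  simp only [deform_dFun, lieDeriv_apply, LinearMap.comp_apply] at h2 ⊢
  rw [torsion, map_sub]
  show _ - 𝒜.dFun φ (f ![]) (N (𝒜.bracket (N x) y + 𝒜.bracket x (N y) - N (𝒜.bracket x y))) + _ = _
  linear_combination -h2

/-- The concomitant of `π` and `N`. -/
def concomitant (𝒜 : PreLieAlgebroid R V) (φ : Module.Dual R V) (π : Bivector R V) (N : V →ₗ[R] V)
    (α β : Module.Dual R V) : Module.Dual R V :=
  𝒜.dualBracket φ (N ∘ₗ π.sharp) α β - (𝒜.dualBracket φ π.sharp (α ∘ₗ N) β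
    + 𝒜.dualBracket φ π.sharp α (β ∘ₗ N) - (𝒜.dualBracket φ π.sharp α β) ∘ₗ N)

/-- The derivation property of `D` on a section and a function, evaluated on `v`, is the concomitant
at `(α, df)` up to `N π♯ = π♯ N*`. -/
theorem concomitant_dFun (h𝒜 : IsLieAlgebroid 𝒜) (hφ : 𝒜.IsCocycle φ)
    (hcomm : ∀ α, N (π.sharp α) = π.sharp (α ∘ₗ N)) (P : V [⋀^Fin 1]→ₗ[R] R)
    (f : V [⋀^Fin 0]→ₗ[R] R)
    (h : (𝒜.deform N).twistedD (φ ∘ₗ N) 0 (jacobiBracket (𝒜.dual φ π) (-(π.sharp φ))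
        (rfl : 1 + 0 = 0 + 1) P f) =
      jacobiBracket (𝒜.dual φ π) (-(π.sharp φ)) (rfl : 2 + 0 = 1 + 1)
          ((𝒜.deform N).twistedD (φ ∘ₗ N) 1 P) f
        + (-1 : ℤ) ^ (1 + 1) • jacobiBracket (𝒜.dual φ π) (-(π.sharp φ)) (rfl : 1 + 1 = 1 + 1) P
          ((𝒜.deform N).twistedD (φ ∘ₗ N) 0 f)) :
    𝒜.concomitant φ π N (linearPart (Pi.single 1 P)) (𝒜.dFun φ (f ![])) = 0 := by
  -- On two sections of the dual, the Koszul bracket is the bracket of the dual algebroid.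
  have hbr : ∀ (P Q : V [⋀^Fin 1]→ₗ[R] R) (v : V),
      interior v (𝒜.koszul φ π.sharp (Pi.single 1 P) (Pi.single 1 Q)) 0 ![] =
        𝒜.dualBracket φ π.sharp (linearPart (Pi.single 1 P)) (linearPart (Pi.single 1 Q)) v := by
    intro P Q v
    rw [interior_koszul, interior_single_succ, interior_single_succ, gradeSign_single', pow_one,
      neg_smul, one_smul]
    simp only [map_neg, AddMonoidHom.neg_apply, Pi.sub_apply, Pi.neg_apply,
      AlternatingMap.sub_apply, AlternatingMap.neg_apply, koszul_zero_one, koszul_one_zero,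
      contraction_apply_zero]
    have e : ∀ P : V [⋀^Fin 1]→ₗ[R] R,
        P.curryLeft v ![] = linearPart (Pi.single 1 P : Forms R V R) v := by
      intro P
      rw [linearPart_single_one]; rfl
    rw [e, e]
    generalize linearPart (Pi.single 1 P : Forms R V R) = α
    generalize linearPart (Pi.single 1 Q : Forms R V R) = β
    simp only [dualBracket, liePairing_apply, sharpPairing_apply, LinearMap.sub_apply,
      lieDeriv_apply, dFun_apply, 𝒜.bracket_swap v, map_neg]
    rw [π.skew (𝒜.dFun φ (α v)) β, π.skew (𝒜.lieDeriv φ v α) β, π.skew α β]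
    simp only [lieDeriv_apply, dFun_apply, 𝒜.bracket_swap v, map_neg]
    ring
  ext v
  have h1 := congrArg (fun F : V [⋀^Fin 1]→ₗ[R] R => F ![v]) h
  have hL : ∀ F : Forms R V R, (𝒜.deform N).twistedD (φ ∘ₗ N) 0 (F 0) ![v] =
      𝒜.dFun φ (F 0 ![]) (N v) := by
    intro F
    have := congrArg (fun α : Module.Dual R V => α v) ((𝒜.deform N).linearPart_diff (φ ∘ₗ N) F)
    rw [linearPart_apply] at this
    exact this
  have hf := linearPart_single_twistedD_zero (𝒜 := 𝒜.deform N) (φ := φ ∘ₗ N) f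
  have e2 : 𝒜.koszul φ π.sharp (Pi.single 2 ((𝒜.deform N).twistedD (φ ∘ₗ N) 1 P))
      (Pi.single 0 f) 1 ![v] = _ :=
    congrArg (fun F : Forms R V R => F 0 ![]) (interior_koszul_function (𝒜 := 𝒜) (φ := φ) π.sharp v
      (Pi.single 2 ((𝒜.deform N).twistedD (φ ∘ₗ N) 1 P)) f)
  have e3 := hbr P ((𝒜.deform N).twistedD (φ ∘ₗ N) 0 f) v
  have e4 := linearPart_interior_diff (𝒜 := 𝒜.deform N) (φ := φ ∘ₗ N) v (Pi.single 1 P)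
  rw [diff_single, interior_single_succ] at e4
  rw [interior_single_succ, koszul_one_zero, e4] at e2
  rw [hf, deform_dFun] at e3
  simp only [jacobiBracket_dual, AlternatingMap.add_apply, AlternatingMap.smul_apply, hL, e2,
    koszul_one_zero] at h1
  replace h1 := h1.trans (congrArg (fun r : R => _ + (-1 : ℤ) ^ (1 + 1) • r) e3)
  generalize linearPart (Pi.single 1 P : Forms R V R) = α at h1 ⊢
  generalize f ![] = f at h1 ⊢
  have hL1 : ∀ x y, 𝒜.lieDeriv φ x (𝒜.dFun φ f) y = 𝒜.dFun φ (𝒜.dFun φ f x) y := fun x y => by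
    rw [lieDeriv_dFun h𝒜 hφ]
  have hs : ∀ β : Module.Dual R V, 𝒜.dFun φ f (π.sharp β) = -β (π.sharp (𝒜.dFun φ f)) :=
    fun β => π.skew _ _
  simp only [concomitant, dualBracket, LinearMap.sub_apply, LinearMap.add_apply,
    LinearMap.comp_apply, hL1, LinearMap.zero_apply, ← hcomm] at h1 ⊢
  rw [hs, hs] at h1
  simp only [LinearMap.sub_apply, deform_lieDeriv_apply, deform_dFun, LinearMap.comp_apply] at h1
  -- These terms match as they stand; only the remaining ones have to be expanded.
  generalize 𝒜.lieDeriv φ (π.sharp α) (𝒜.dFun φ f ∘ₗ N) v = A at h1 ⊢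
  generalize 𝒜.dFun φ (𝒜.dFun φ f (N (π.sharp α))) v = B at h1 ⊢
  generalize 𝒜.dFun φ (𝒜.dFun φ f (π.sharp α)) (N v) = C at h1 ⊢
  generalize π.sharp (𝒜.dFun φ f) = y at h1 ⊢
  simp only [lieDeriv_apply, dFun_apply, LinearMap.comp_apply, 𝒜.bracket_swap v,
    𝒜.bracket_swap (N v), map_neg, map_add, map_sub] at h1 ⊢
  norm_num at h1
  linear_combination h1

theorem concomitant_add (hcomm : ∀ α, N (π.sharp α) = π.sharp (α ∘ₗ N)) (α β γ : Module.Dual R V) :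
    𝒜.concomitant φ π N α (β + γ) = 𝒜.concomitant φ π N α β + 𝒜.concomitant φ π N α γ := by
  have h1 := (𝒜.dual φ π).bracket_add
  have h2 := (𝒜.dual φ (composedBivector π N hcomm)).bracket_add
  change ∀ α β γ, 𝒜.dualBracket φ π.sharp α (β + γ) = 𝒜.dualBracket φ π.sharp α β
    + 𝒜.dualBracket φ π.sharp α γ at h1
  change ∀ α β γ, 𝒜.dualBracket φ (N ∘ₗ π.sharp) α (β + γ) =
    𝒜.dualBracket φ (N ∘ₗ π.sharp) α β + 𝒜.dualBracket φ (N ∘ₗ π.sharp) α γ at h2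
  simp only [concomitant, h1, h2, LinearMap.add_comp]
  abel

/-- The derivatives of `c` along `N π♯ α` and `π♯ N* α` cancel by `hcomm`, and those multiplying `N*
β` cancel between the last two brackets. -/
theorem concomitant_smul (hcomm : ∀ α, N (π.sharp α) = π.sharp (α ∘ₗ N)) (α : Module.Dual R V)
    (c : R) (β : Module.Dual R V) :
    𝒜.concomitant φ π N α (c • β) = c • 𝒜.concomitant φ π N α β := by
  have h1 := (𝒜.dual φ π).bracket_smul
  have h2 := (𝒜.dual φ (composedBivector π N hcomm)).bracket_smul
  change ∀ α (c : R) β, 𝒜.dualBracket φ π.sharp α (c • β) = c • 𝒜.dualBracket φ π.sharp α β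
    + 𝒜.anchor (π.sharp α) c • β at h1
  change ∀ α (c : R) β, 𝒜.dualBracket φ (N ∘ₗ π.sharp) α (c • β) =
    c • 𝒜.dualBracket φ (N ∘ₗ π.sharp) α β + 𝒜.anchor (N (π.sharp α)) c • β at h2
  simp only [concomitant, h1, h2, LinearMap.smul_comp, LinearMap.add_comp, ← hcomm, smul_sub,
    smul_add]
  abel

theorem isCompatible_of_concomitant
    (hgen : ∀ T : Module.Dual R V →ₗ[R] R, (∀ f, T (𝒜.dFun φ f) = 0) → T = 0)
    (hcomm : ∀ α, N (π.sharp α) = π.sharp (α ∘ₗ N))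
    (h : ∀ α f, 𝒜.concomitant φ π N α (𝒜.dFun φ f) = 0) : 𝒜.IsCompatible φ π N where
  comm := hcomm
  concomitant α β := by
    rw [← sub_eq_zero]
    ext v
    let T : Module.Dual R V →ₗ[R] R :=
      { toFun := fun β => 𝒜.concomitant φ π N α β v
        map_add' := fun β γ => by rw [concomitant_add hcomm]; rfl
        map_smul' := fun c β => by rw [concomitant_smul hcomm]; rfl }
    have hT : T = 0 := hgen T fun f => by
      show 𝒜.concomitant φ π N α (𝒜.dFun φ f) v = 0
      rw [h]; rfl
    exact congrArg (fun T : Module.Dual R V →ₗ[R] R => T β) hT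

/-- The algebraic core. Besides `D X = 0`, the converse uses the bialgebroid axioms only for two
functions, for a section and a function, and for the square of `D` on functions; `hsep` and `hgen`
pass from differentials of functions to all sections. -/
theorem isCompatible_iff (h𝒜 : IsLieAlgebroid 𝒜) (hφ : 𝒜.IsCocycle φ)
    (hsep : ∀ y : V, (∀ f : R, 𝒜.dFun φ f y = 0) → y = 0)
    (hgen : ∀ T : Module.Dual R V →ₗ[R] R, (∀ f, T (𝒜.dFun φ f) = 0) → T = 0)
    {X : V [⋀^Fin 3]→ₗ[R] R} (hX : 𝒜.twistedD φ 3 X = 0) :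
    (𝒜.IsCompatible φ π N ∧ (∀ x y, 𝒜.torsion N x y = -π.sharp (contractTwo x y X)) ∧
        𝒜.twistedD φ 3 (insertSum N X) = 0) ↔
      (∃ W, IsQuasiDifferential (𝒜.dual φ π) (-(π.sharp φ)) W
        ((𝒜.deform N).twistedD (φ ∘ₗ N))) ∧ (𝒜.deform N).twistedD (φ ∘ₗ N) 3 X = 0 ∧
      ∀ (k : ℕ) (P : V [⋀^Fin k]→ₗ[R] R),
        (𝒜.deform N).twistedD (φ ∘ₗ N) (k + 1) ((𝒜.deform N).twistedD (φ ∘ₗ N) k P) =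
          jacobiBracket (𝒜.dual φ π) (-(π.sharp φ)) (by omega : 3 + k = k + 2 + 1) X P := by
  rw [twistedD_eq_zero_iff N X hX]
  have hconst : ∀ f : R, ∃ P : V [⋀^Fin 0]→ₗ[R] R, P ![] = f := fun f =>
    ⟨AlternatingMap.constOfIsEmpty R V (Fin 0) f, rfl⟩
  constructor
  · rintro ⟨hc, hT, hcl⟩
    exact ⟨⟨_, hc.isQuasiDifferential h𝒜 hφ⟩, hcl,
      twistedD_twistedD_deform h𝒜 hφ hT hX⟩
  · rintro ⟨⟨W, hW⟩, hcl, hsq⟩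
    have hcomm : ∀ α, N (π.sharp α) = π.sharp (α ∘ₗ N) := by
      refine comm_of_jacobiBracket_functions hsep fun f g => ?_
      obtain ⟨f, rfl⟩ := hconst f
      obtain ⟨g, rfl⟩ := hconst g
      rw [← jacobiBracket_functions, ← hW.map_bracket_zero]
      rfl
    refine ⟨isCompatible_of_concomitant hgen hcomm fun α f => ?_, fun x y => ?_, hcl⟩
    · obtain ⟨f, rfl⟩ := hconst f
      have h := concomitant_dFun h𝒜 hφ hcomm (oneForm α) f (hW.map_bracket 1 0 0 rfl (oneForm α) f)
      have e : linearPart (Pi.single 1 (oneForm α) : Forms R V R) = α := by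
        ext x
        rw [linearPart_single_one]
        rfl
      rwa [e] at h
    · rw [← add_eq_zero_iff_eq_neg]
      refine hsep _ fun f => ?_
      obtain ⟨f, rfl⟩ := hconst f
      exact dFun_torsion_of_sq h𝒜 hφ f (hsq 0 f) x y

end PreLieAlgebroid

end

section

variable {R : Type*} [CommRing R] [Algebra ℝ R] {V : Type*} [AddCommGroup V] [Module R V]

/-! ### The Jacobi algebroid of a Jacobi structure -/

namespace PreLieAlgebroid

variable {𝒜 : PreLieAlgebroid R V} {φ : Module.Dual R V} {π : Bivector R V}

theorem bracket_neg (x y : V) : 𝒜.bracket x (-y) = -𝒜.bracket x y := map_neg (𝒜.ad x) y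

theorem neg_bracket (x y : V) : 𝒜.bracket (-x) y = -𝒜.bracket x y := by
  rw [𝒜.bracket_swap, bracket_neg, ← 𝒜.bracket_swap x]

/-- The bracket of functions `{f, g} = ⟨d^φ g, π♯ d^φ f⟩`. -/
def dFunBracket (𝒜 : PreLieAlgebroid R V) (φ : Module.Dual R V) (π : Bivector R V) (f g : R) : R :=
  𝒜.dFun φ g (π.sharp (𝒜.dFun φ f))

theorem dFunBracket_swap (f g : R) :
    𝒜.dFunBracket φ π f g = -𝒜.dFunBracket φ π g f := π.skew _ _

theorem dFun_neg (f : R) : 𝒜.dFun φ (-f) = -𝒜.dFun φ f := by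
  ext v; simp [dFun_apply]; ring

/-- Each of the two Lie derivatives contributes the differential of the bracket of `f` and `g`; the
third term removes one of them. -/
theorem dual_bracket_dFun (h𝒜 : IsLieAlgebroid 𝒜) (hφ : 𝒜.IsCocycle φ) (f g : R) :
    (𝒜.dual φ π).bracket (𝒜.dFun φ f) (𝒜.dFun φ g) = 𝒜.dFun φ (𝒜.dFunBracket φ π f g) := by
  show 𝒜.lieDeriv φ _ _ - 𝒜.lieDeriv φ _ _ - 𝒜.dFun φ (𝒜.dFunBracket φ π f g) = _
  rw [lieDeriv_dFun h𝒜 hφ, lieDeriv_dFun h𝒜 hφ]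
  show 𝒜.dFun φ (𝒜.dFunBracket φ π f g) - 𝒜.dFun φ (𝒜.dFunBracket φ π g f) - _ = _
  rw [dFunBracket_swap g f, dFun_neg]
  abel

theorem dFun_bracket (h𝒜 : IsLieAlgebroid 𝒜) (hφ : 𝒜.IsCocycle φ) (f : R) (x y : V) :
    𝒜.dFun φ f (𝒜.bracket x y) =
      𝒜.dFun φ (𝒜.dFun φ f y) x - 𝒜.dFun φ (𝒜.dFun φ f x) y := by
  have h := congrArg (fun α : Module.Dual R V => α y) (lieDeriv_dFun h𝒜 hφ x f)
  rw [← h, dFun_apply _ _ (𝒜.dFun φ f y), lieDeriv_apply]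
  ring

/-- The defect is `R`-linear in the second argument and skew, so it may be computed on differentials
of functions. Tested against a further differential, it is the Jacobi identity for functions. -/
theorem sharp_dual_bracket (h𝒜 : IsLieAlgebroid 𝒜) (hφ : 𝒜.IsCocycle φ)
    (hsep : ∀ y : V, (∀ f : R, 𝒜.dFun φ f y = 0) → y = 0)
    (hgen : ∀ T : Module.Dual R V →ₗ[R] R, (∀ f, T (𝒜.dFun φ f) = 0) → T = 0)
    (hJ : ∀ f g h : R, 𝒜.dFunBracket φ π f (𝒜.dFunBracket φ π g h)
      + 𝒜.dFunBracket φ π g (𝒜.dFunBracket φ π h f)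
      + 𝒜.dFunBracket φ π h (𝒜.dFunBracket φ π f g) = 0) (α β : Module.Dual R V) :
    π.sharp ((𝒜.dual φ π).bracket α β) = 𝒜.bracket (π.sharp α) (π.sharp β) := by
  let K : Module.Dual R V → Module.Dual R V →ₗ[R] V := fun α =>
    { toFun := fun β => π.sharp ((𝒜.dual φ π).bracket α β) - 𝒜.bracket (π.sharp α) (π.sharp β)
      map_add' := fun β γ => by
        simp only [(𝒜.dual φ π).bracket_add, map_add, 𝒜.bracket_add]; abel
      map_smul' := fun c β => by
        simp only [(𝒜.dual φ π).bracket_smul, map_add, map_smul, 𝒜.bracket_smul, dual_anchor,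
          RingHom.id_apply, smul_sub]
        abel }
  -- `hgen` concerns functionals with values in `R`, so `K α` is composed with differentials of
  -- functions; these separate its values.
  have hK : ∀ α, (∀ f, K α (𝒜.dFun φ f) = 0) → ∀ β, K α β = 0 := by
    intro α h β
    refine hsep _ fun g => ?_
    have h1 : 𝒜.dFun φ g ∘ₗ K α = 0 := hgen _ fun f => by rw [LinearMap.comp_apply, h, map_zero]
    exact congrArg (fun T : Module.Dual R V →ₗ[R] R => T β) h1
  have hswap : ∀ α β, K α β = - K β α := by
    intro α β
    have hKd : ∀ α β, K α β = π.sharp ((𝒜.dual φ π).bracket α β)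
        - 𝒜.bracket (π.sharp α) (π.sharp β) := fun _ _ => rfl
    rw [hKd, hKd, (𝒜.dual φ π).bracket_swap, 𝒜.bracket_swap (π.sharp α), map_neg]
    abel
  refine sub_eq_zero.1 (hK α (fun f => ?_) β)
  rw [hswap, hK (𝒜.dFun φ f) (fun g => ?_) α, neg_zero]
  refine hsep _ fun h => ?_
  show 𝒜.dFun φ h (π.sharp _ - 𝒜.bracket _ _) = 0
  rw [map_sub, dual_bracket_dFun h𝒜 hφ, dFun_bracket h𝒜 hφ]
  show 𝒜.dFunBracket φ π (𝒜.dFunBracket φ π f g) h - (𝒜.dFunBracket φ π f (𝒜.dFunBracket φ π g h)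
    - 𝒜.dFunBracket φ π g (𝒜.dFunBracket φ π f h)) = 0
  have h1 := hJ f g h
  rw [dFunBracket_swap h (𝒜.dFunBracket φ π f g), dFunBracket_swap h f] at h1
  have h2 : 𝒜.dFunBracket φ π g (-𝒜.dFunBracket φ π f h) =
      -𝒜.dFunBracket φ π g (𝒜.dFunBracket φ π f h) := by
    rw [dFunBracket, dFun_neg]; rfl
  rw [h2] at h1
  linear_combination -h1

/-- The Jacobiator is totally antisymmetric, and it is `R`-linear in the last argument because
`sharp_dual_bracket` makes the anchor preserve brackets. It thus reduces to three differentials of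
functions. -/
theorem isJacobiAlgebroid_dual (h𝒜 : IsLieAlgebroid 𝒜) (hφ : 𝒜.IsCocycle φ)
    (hsep : ∀ y : V, (∀ f : R, 𝒜.dFun φ f y = 0) → y = 0)
    (hgen : ∀ T : Module.Dual R V →ₗ[R] R, (∀ f, T (𝒜.dFun φ f) = 0) → T = 0)
    (hJ : ∀ f g h : R, 𝒜.dFunBracket φ π f (𝒜.dFunBracket φ π g h)
      + 𝒜.dFunBracket φ π g (𝒜.dFunBracket φ π h f)
      + 𝒜.dFunBracket φ π h (𝒜.dFunBracket φ π f g) = 0) :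
    IsJacobiAlgebroid (𝒜.dual φ π) (-(π.sharp φ)) := by
  have hS := sharp_dual_bracket h𝒜 hφ hsep hgen hJ
  have hρ : ∀ α β, (𝒜.dual φ π).anchor ((𝒜.dual φ π).bracket α β) =
      ⁅(𝒜.dual φ π).anchor α, (𝒜.dual φ π).anchor β⁆ := by
    intro α β
    rw [dual_anchor, dual_anchor, dual_anchor, hS, h𝒜.anchor_bracket]
  refine ⟨⟨fun α β γ => ?_, hρ⟩, fun α β => ?_⟩
  · let J : Module.Dual R V → Module.Dual R V → Module.Dual R V →ₗ[R] Module.Dual R V := fun α β =>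
      { toFun := fun γ => (𝒜.dual φ π).bracket α ((𝒜.dual φ π).bracket β γ)
          - ((𝒜.dual φ π).bracket ((𝒜.dual φ π).bracket α β) γ
            + (𝒜.dual φ π).bracket β ((𝒜.dual φ π).bracket α γ))
        map_add' := fun γ δ => by
          simp only [(𝒜.dual φ π).bracket_add]; abel
        map_smul' := fun c γ => by
          simp only [(𝒜.dual φ π).bracket_smul, (𝒜.dual φ π).bracket_add, hρ,
            Derivation.commutator_apply, RingHom.id_apply, smul_sub, smul_add, sub_smul]
          abel }
    have hJ0 : ∀ α β, (∀ f, J α β (𝒜.dFun φ f) = 0) → ∀ γ, J α β γ = 0 := by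
      intro α β h γ
      ext v
      have h1 : Module.Dual.eval R V v ∘ₗ J α β = 0 := hgen _ fun f => by
        rw [LinearMap.comp_apply, h, map_zero]
      exact congrArg (fun T : Module.Dual R V →ₗ[R] R => T γ) h1
    have hJd : ∀ α β γ, J α β γ = (𝒜.dual φ π).bracket α ((𝒜.dual φ π).bracket β γ)
        - ((𝒜.dual φ π).bracket ((𝒜.dual φ π).bracket α β) γ
          + (𝒜.dual φ π).bracket β ((𝒜.dual φ π).bracket α γ)) := fun _ _ _ => rfl
    have h12 : ∀ α β γ, J α β γ = - J β α γ := by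
      intro α β γ
      rw [hJd, hJd, (𝒜.dual φ π).bracket_swap α β, neg_bracket]
      abel
    have h23 : ∀ α β γ, J α β γ = - J α γ β := by
      intro α β γ
      rw [hJd, hJd, (𝒜.dual φ π).bracket_swap γ β, bracket_neg,
        (𝒜.dual φ π).bracket_swap ((𝒜.dual φ π).bracket α β),
        (𝒜.dual φ π).bracket_swap ((𝒜.dual φ π).bracket α γ)]
      abel
    refine sub_eq_zero.1 (hJ0 α β (fun f => ?_) γ)
    rw [h23, h12, neg_neg, hJ0 (𝒜.dFun φ f) α (fun g => ?_) β]
    rw [h23, hJ0 (𝒜.dFun φ f) (𝒜.dFun φ g) (fun h => ?_) α, neg_zero]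
    show _ - (_ + _) = (0 : Module.Dual R V)
    simp only [dual_bracket_dFun h𝒜 hφ]
    have h1 := hJ f g h
    have h2 : 𝒜.dFunBracket φ π g (-𝒜.dFunBracket φ π f h) =
        -𝒜.dFunBracket φ π g (𝒜.dFunBracket φ π f h) := by
      rw [dFunBracket, dFun_neg]; rfl
    rw [dFunBracket_swap h (𝒜.dFunBracket φ π f g), dFunBracket_swap h f, h2] at h1
    have h3 : 𝒜.dFunBracket φ π f (𝒜.dFunBracket φ π g h) =
        𝒜.dFunBracket φ π (𝒜.dFunBracket φ π f g) h
          + 𝒜.dFunBracket φ π g (𝒜.dFunBracket φ π f h) := by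
      linear_combination h1
    rw [h3, sub_eq_zero]
    ext v
    simp only [dFun_apply, LinearMap.add_apply, map_add]
    ring
  · have h1 := hφ (π.sharp α) (π.sharp β)
    rw [← hS] at h1
    -- So `-(π.sharp φ)` is the pullback of the cocycle `φ` along the morphism `π.sharp`.
    have e : ∀ ζ : Module.Dual R V, ζ (-(π.sharp φ)) = φ (π.sharp ζ) := fun ζ => by
      rw [map_neg, π.skew φ, neg_neg]
    rw [dDual, dual_anchor, dual_anchor, e, e, e, h1]

end PreLieAlgebroid

/-! ### The Lie algebroid `TM × ℝ` -/

theorem tangentTimes_isLieAlgebroid : IsLieAlgebroid (tangentTimes R) where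
  jacobi x y z := by
    ext : 1
    · exact leibniz_lie x.1 y.1 z.1
    · simp only [tangentTimes, Prod.snd_add, map_sub, Derivation.commutator_apply]
      ring
  anchor_bracket x y := rfl

theorem cocycleOne_isCocycle : (tangentTimes R).IsCocycle (cocycleOne R) := by
  intro x y
  simp [tangentTimes, cocycleOne]

theorem tangentTimes_dFun_apply (f : R) (x : Derivation ℝ R R × R) :
    (tangentTimes R).dFun (cocycleOne R) f x = x.1 f + x.2 * f := rfl

/-- The function `1` detects the second component; the first is a derivation, hence determined by
its values on functions. -/
theorem tangentTimes_separated (y : Derivation ℝ R R × R)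
    (h : ∀ f, (tangentTimes R).dFun (cocycleOne R) f y = 0) : y = 0 := by
  have h2 : y.2 = 0 := by simpa [tangentTimes_dFun_apply] using h 1
  refine Prod.ext ?_ ?_
  · ext f
    simpa [tangentTimes_dFun_apply, h2] using h f
  · exact h2

theorem functionBracket_eq (Λ : Bivector R (Derivation ℝ R R)) (E : Derivation ℝ R R) (f h : R) :
    functionBracket Λ E f h =
      (tangentTimes R).dFunBracket (cocycleOne R) (pairBivector Λ E) f h := by
  have e : (tangentTimes R).dFun (cocycleOne R) f ∘ₗ LinearMap.inl R (Derivation ℝ R R) R =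
      (tangent R).dFun 0 f := by
    ext X
    show X f + 0 * f = X f + 0 * f
    rfl
  rw [PreLieAlgebroid.dFunBracket, tangentTimes_dFun_apply]
  simp only [pairBivector, LinearMap.coe_mk, AddHom.coe_mk, e, tangentTimes_dFun_apply,
    functionBracket, Derivation.add_apply, Derivation.smul_apply, smul_eq_mul]
  simp
  ring

theorem sharp_cocycleOne (Λ : Bivector R (Derivation ℝ R R)) (E : Derivation ℝ R R) :
    -(pairBivector Λ E).sharp (cocycleOne R) = (-E, 0) := by
  have e : cocycleOne R ∘ₗ LinearMap.inl R (Derivation ℝ R R) R = 0 := by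
    ext X; simp [cocycleOne]
  ext : 1
  · simp only [pairBivector, LinearMap.coe_mk, AddHom.coe_mk, e]
    simp [cocycleOne]
  · simp [pairBivector, cocycleOne]

theorem cocycleOne_comp_pairMap (N : Derivation ℝ R R →ₗ[R] Derivation ℝ R R)
    (Y : Derivation ℝ R R) (γ : Module.Dual R (Derivation ℝ R R)) (g : R) :
    cocycleOne R ∘ₗ pairMap N Y γ g = pairOneForm γ g := rfl

/-- `(dω, ω)` is the twisted differential of the pullback of `ω` to `TM × ℝ`. This is why the
`3`-section is closed for every `ω`. -/
theorem threeFormOf_eq (ω₂ : Derivation ℝ R R [⋀^Fin 2]→ₗ[R] R) :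
    threeFormOf ω₂ = (tangentTimes R).twistedD (cocycleOne R) 2
      (ω₂.compLinearMap (LinearMap.fst R (Derivation ℝ R R) R)) := by
  have e : (tangentTimes R).d (ω₂.compLinearMap (LinearMap.fst R (Derivation ℝ R R) R)) =
      ((tangent R).d ω₂).compLinearMap (LinearMap.fst R (Derivation ℝ R R) R) := by
    ext v
    rw [AlternatingMap.compLinearMap_apply, PreLieAlgebroid.d_eq_alternatizeUncurryFin,
      PreLieAlgebroid.alternatizeUncurryFin_cartanAux, PreLieAlgebroid.d_eq_alternatizeUncurryFin,
      PreLieAlgebroid.alternatizeUncurryFin_cartanAux]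
    refine Finset.sum_congr rfl fun i _ => ?_
    congr 2
    congr 1
    refine Finset.sum_congr rfl fun j _ => ?_
    rw [AlternatingMap.compLinearMap_apply]
    congr 1
    funext l
    by_cases h : l = j
    · subst h; simp [tangent, tangentTimes]; rfl
    · simp [h]; rfl
  show ((tangent R).d ω₂).compLinearMap _ + _ = (tangentTimes R).d _ + _
  rw [e]

theorem twistedD_threeFormOf (ω₂ : Derivation ℝ R R [⋀^Fin 2]→ₗ[R] R) :
    (tangentTimes R).twistedD (cocycleOne R) 3 (threeFormOf ω₂) = 0 := by
  have h := cocycleOne_isCocycle.diff_diff tangentTimes_isLieAlgebroid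
    (Pi.single 2 (ω₂.compLinearMap (LinearMap.fst R (Derivation ℝ R R) R)))
  rw [PreLieAlgebroid.diff_single, PreLieAlgebroid.diff_single, Pi.single_eq_zero_iff] at h
  rw [threeFormOf_eq, h]

/-- The main equivalence, when the `1`-forms are generated by differentials in the sense of
`hgen`. -/
theorem isJacobiQuasiNijenhuis_iff
    (hgen : ∀ T : Module.Dual R (Derivation ℝ R R × R) →ₗ[R] R,
      (∀ f, T ((tangentTimes R).dFun (cocycleOne R) f) = 0) → T = 0)
    (Λ : Bivector R (Derivation ℝ R R)) (E : Derivation ℝ R R) (hJ : IsJacobiStructure Λ E)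
    (N : Derivation ℝ R R →ₗ[R] Derivation ℝ R R) (Y : Derivation ℝ R R)
    (γ : Module.Dual R (Derivation ℝ R R)) (g : R) (ω₂ : Derivation ℝ R R [⋀^Fin 2]→ₗ[R] R) :
    IsJacobiQuasiNijenhuis Λ E (pairMap N Y γ g) ω₂ ↔
      IsQuasiJacobiBialgebroid (jacobiDual Λ E) (-E, 0)
        (((tangentTimes R).deform (pairMap N Y γ g)).twistedD (pairOneForm γ g))
        (threeFormOf ω₂) := by
  have h := PreLieAlgebroid.isCompatible_iff (π := pairBivector Λ E) (N := pairMap N Y γ g)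
    tangentTimes_isLieAlgebroid cocycleOne_isCocycle tangentTimes_separated hgen
    (twistedD_threeFormOf ω₂)
  have hA : IsJacobiAlgebroid (jacobiDual Λ E) (-E, 0) := by
    rw [← sharp_cocycleOne Λ E]
    refine PreLieAlgebroid.isJacobiAlgebroid_dual tangentTimes_isLieAlgebroid cocycleOne_isCocycle
      tangentTimes_separated hgen fun f g h => ?_
    simp only [← functionBracket_eq]
    exact hJ f g h
  rw [sharp_cocycleOne, cocycleOne_comp_pairMap] at h
  constructor
  · intro hN
    obtain ⟨h1, h2, h3⟩ := h.1 ⟨hN.isCompatible, hN.torsion_eq, hN.closed⟩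
    exact ⟨hA, h1, h2, h3⟩
  · intro hB
    obtain ⟨h1, h2, h3⟩ := h.2 ⟨hB.exists_isQuasiDifferential, hB.map_threeSection, hB.map_map⟩
    exact ⟨hJ, h1, h2, h3⟩

end

section

variable {R : Type*} [CommRing R] [Algebra ℝ R] {V : Type*} [AddCommGroup V] [Module R V]

/-! ### Hadamard's lemma -/

section Hadamard

universe u

open MeasureTheory intervalIntegral

theorem hasFDerivAt_parametric_integral {E G : Type u} [NormedAddCommGroup E] [NormedSpace ℝ E]
    [FiniteDimensional ℝ E] [NormedAddCommGroup G] [NormedSpace ℝ G] {K : E × ℝ → G}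
    (hK : ContDiff ℝ 1 K) (x : E) :
    HasFDerivAt (fun y => ∫ t in (0 : ℝ)..1, K (y, t))
      (∫ t in (0 : ℝ)..1, (fderiv ℝ K (x, t)).comp (ContinuousLinearMap.inl ℝ E ℝ)) x := by
  have : ProperSpace E := FiniteDimensional.proper ℝ E
  have hc : Continuous fun z : E × ℝ =>
      (fderiv ℝ K z).comp (ContinuousLinearMap.inl ℝ E ℝ) :=
    (hK.continuous_fderiv (by norm_num)).clm_comp continuous_const
  -- The dominating function is a constant: a bound of the derivative on the compact set of a closed
  -- unit ball times `[0, 1]`.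
  obtain ⟨C, hC⟩ := ((isCompact_closedBall x 1).prod (isCompact_Icc (a := (0 : ℝ)) (b := 1))).exists_bound_of_continuousOn
    hc.continuousOn
  refine intervalIntegral.hasFDerivAt_integral_of_dominated_of_fderiv_le (bound := fun _ => C)
    (F' := fun y t => (fderiv ℝ K (y, t)).comp (ContinuousLinearMap.inl ℝ E ℝ))
    (Metric.closedBall_mem_nhds x one_pos)
    (Filter.Eventually.of_forall fun y => ?_) ?_ ?_ ?_ ?_ ?_
  · exact (hK.continuous.comp (Continuous.prodMk_right y)).aestronglyMeasurable
  · exact (hK.continuous.comp (Continuous.prodMk_right x)).intervalIntegrable _ _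
  · exact (hc.comp (Continuous.prodMk_right x)).aestronglyMeasurable
  · refine Filter.Eventually.of_forall fun t ht y hy => hC (y, t) ⟨hy, ?_⟩
    rw [Set.uIoc_of_le zero_le_one] at ht
    exact Set.Ioc_subset_Icc_self ht
  · exact intervalIntegrable_const
  · refine Filter.Eventually.of_forall fun t _ y _ => ?_
    have h1 : HasFDerivAt K (fderiv ℝ K (y, t)) (y, t) :=
      (hK.differentiable (by norm_num) (y, t)).hasFDerivAt
    exact h1.comp y (hasFDerivAt_prodMk_left y t)

/-- The derivative is again a parametric integral, now with values in `E →L[ℝ] G`; therefore the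
induction varies `G`, and the common universe keeps that space within its range. -/
theorem contDiff_parametric_integral_nat (n : ℕ) : ∀ {E G : Type u} [NormedAddCommGroup E]
    [NormedSpace ℝ E] [FiniteDimensional ℝ E] [NormedAddCommGroup G] [NormedSpace ℝ G]
    {K : E × ℝ → G}, ContDiff ℝ n K → ContDiff ℝ n fun y => ∫ t in (0 : ℝ)..1, K (y, t) := by
  induction n with
  | zero =>
    intro E G _ _ _ _ _ K hK
    simp only [Nat.cast_zero, contDiff_zero] at hK ⊢
    exact intervalIntegral.continuous_parametric_intervalIntegral_of_continuous'
      (f := fun y t => K (y, t)) hK _ _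
  | succ n ih =>
    intro E G _ _ _ _ _ K hK
    push_cast at hK ⊢
    rw [contDiff_succ_iff_hasFDerivAt]
    refine ⟨_, ih (K := fun z => (fderiv ℝ K z).comp (ContinuousLinearMap.inl ℝ E ℝ)) ?_,
      hasFDerivAt_parametric_integral (hK.of_le le_add_self)⟩
    exact (hK.fderiv_right le_rfl).clm_comp contDiff_const

theorem contDiff_parametric_integral {E G : Type u} [NormedAddCommGroup E]
    [NormedSpace ℝ E] [FiniteDimensional ℝ E] [NormedAddCommGroup G] [NormedSpace ℝ G]
    {K : E × ℝ → G} (hK : ContDiff ℝ ∞ K) :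
    ContDiff ℝ ∞ fun y => ∫ t in (0 : ℝ)..1, K (y, t) :=
  contDiff_infty.2 fun n => contDiff_parametric_integral_nat n (contDiff_infty.1 hK n)

/-- Hadamard's lemma. -/
theorem exists_contDiff_eq_add_apply_sub {E : Type u} [NormedAddCommGroup E] [NormedSpace ℝ E]
    [FiniteDimensional ℝ E] {H : E → ℝ} (hH : ContDiff ℝ ∞ H) (a : E) :
    ∃ G : E → E →L[ℝ] ℝ, ContDiff ℝ ∞ G ∧ G a = fderiv ℝ H a ∧
      ∀ y, H y - H a = G y (y - a) := by
  have hK : ContDiff ℝ ∞ fun z : E × ℝ => fderiv ℝ H (a + z.2 • (z.1 - a)) :=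
    (hH.fderiv_right (m := ∞) (by simp)).comp
      (contDiff_const.add (contDiff_snd.smul (contDiff_fst.sub contDiff_const)))
  refine ⟨fun y => ∫ t in (0 : ℝ)..1, fderiv ℝ H (a + t • (y - a)),
    contDiff_parametric_integral hK, by simp, fun y => ?_⟩
  have hc : Continuous fun t : ℝ => fderiv ℝ H (a + t • (y - a)) :=
    hK.continuous.comp (Continuous.prodMk_right y)
  show _ = (∫ t in (0 : ℝ)..1, fderiv ℝ H (a + t • (y - a))) (y - a)
  rw [ContinuousLinearMap.intervalIntegral_apply (hc.intervalIntegrable _ _)]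
  -- The fundamental theorem of calculus along the segment from `a` to `y`.
  have hd : ∀ t : ℝ, HasDerivAt (fun t : ℝ => H (a + t • (y - a)))
      (fderiv ℝ H (a + t • (y - a)) (y - a)) t := by
    intro t
    have h1 : HasFDerivAt H (fderiv ℝ H (a + t • (y - a))) (a + t • (y - a)) :=
      (hH.differentiable (by simp) _).hasFDerivAt
    have h2 : HasDerivAt (fun t : ℝ => a + t • (y - a)) (y - a) t := by
      simpa using ((hasDerivAt_id t).smul_const (y - a)).const_add a
    exact h1.comp_hasDerivAt t h2
  rw [intervalIntegral.integral_eq_sub_of_hasDerivAt (fun t _ => hd t)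
    ((hc.clm_apply continuous_const).intervalIntegrable _ _)]
  simp

end Hadamard


/-! ### Local frames of vector fields -/

section Frame

universe u

open Module

variable {F : Type u} [NormedAddCommGroup F] [NormedSpace ℝ F] [FiniteDimensional ℝ F]
  {M : Type*} [TopologicalSpace M] [ChartedSpace F M] [IsManifold 𝓘(ℝ, F) ∞ M] [T2Space M]

theorem contDiffOn_comp_extChartAt_symm (p : M) (h : SmoothFunctions F M) :
    ContDiffOn ℝ ∞ (h ∘ (extChartAt 𝓘(ℝ, F) p).symm) (extChartAt 𝓘(ℝ, F) p).target :=
  contMDiffOn_iff_contDiffOn.1 (h.contMDiff.comp_contMDiffOn (contMDiffOn_extChartAt_symm p))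

/-- The product of a bump function and a function that is smooth on the domain of the chart. -/
def bumpMul {p : M} (ψ : SmoothBumpFunction 𝓘(ℝ, F) p) (g : M → ℝ)
    (hg : ContMDiffOn 𝓘(ℝ, F) 𝓘(ℝ, ℝ) ∞ g (chartAt F p).source) : SmoothFunctions F M :=
  ⟨fun x => ψ x • g x, ψ.contMDiff_smul hg⟩

theorem contMDiffOn_comp_extChartAt (p : M) {U : Set F} {g : F → ℝ} (hg : ContDiffOn ℝ ∞ g U)
    (hU : (extChartAt 𝓘(ℝ, F) p).target ⊆ U) :
    ContMDiffOn 𝓘(ℝ, F) 𝓘(ℝ, ℝ) ∞ (g ∘ extChartAt 𝓘(ℝ, F) p) (chartAt F p).source := by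
  refine (contMDiffOn_iff_contDiffOn.2 hg).comp contMDiffOn_extChartAt fun x hx => hU ?_
  rw [← extChartAt_source 𝓘(ℝ, F)] at hx
  exact (extChartAt 𝓘(ℝ, F) p).map_source hx

/-- The derivative of `h` in the direction `v` of the chart at `p`. -/
def chartDeriv (p : M) (v : F) (h : SmoothFunctions F M) : M → ℝ :=
  (fun y => fderiv ℝ (h ∘ (extChartAt 𝓘(ℝ, F) p).symm) y v) ∘ extChartAt 𝓘(ℝ, F) p

theorem contMDiffOn_chartDeriv (p : M) (v : F) (h : SmoothFunctions F M) :
    ContMDiffOn 𝓘(ℝ, F) 𝓘(ℝ, ℝ) ∞ (chartDeriv p v h) (chartAt F p).source := by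
  refine contMDiffOn_comp_extChartAt p ?_ subset_rfl
  exact ((contDiffOn_comp_extChartAt_symm p h).fderiv_of_isOpen (isOpen_extChartAt_target p)
    (by simp)).clm_apply contDiffOn_const

theorem differentiableAt_comp_extChartAt_symm (p : M) (h : SmoothFunctions F M) {x : M}
    (hx : x ∈ (chartAt F p).source) :
    DifferentiableAt ℝ (h ∘ (extChartAt 𝓘(ℝ, F) p).symm) (extChartAt 𝓘(ℝ, F) p x) := by
  rw [← extChartAt_source 𝓘(ℝ, F)] at hx
  exact ((contDiffOn_comp_extChartAt_symm p h).contDiffAt ((isOpen_extChartAt_target p).mem_nhds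
    ((extChartAt 𝓘(ℝ, F) p).map_source hx))).differentiableAt (by simp)

/-- The vector field that is the coordinate field in the direction `v`, times a bump function. -/
def bumpField {p : M} (ψ : SmoothBumpFunction 𝓘(ℝ, F) p) (v : F) : VectorFields F M :=
  Derivation.mk'
    { toFun := fun h => bumpMul ψ (chartDeriv p v h) (contMDiffOn_chartDeriv p v h)
      map_add' := fun h k => by
        ext x
        show ψ x * chartDeriv p v (h + k) x = ψ x * chartDeriv p v h x + ψ x * chartDeriv p v k x
        -- Outside the chart domain the chart derivative has no meaning, but there the bump function
        -- vanishes.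
        by_cases hx : x ∈ (chartAt F p).source
        · have e : chartDeriv p v (h + k) x = chartDeriv p v h x + chartDeriv p v k x := by
            show fderiv ℝ ((h ∘ (extChartAt 𝓘(ℝ, F) p).symm) + (k ∘ (extChartAt 𝓘(ℝ, F) p).symm)) _ v
              = _
            rw [fderiv_add (differentiableAt_comp_extChartAt_symm p h hx)
              (differentiableAt_comp_extChartAt_symm p k hx)]
            rfl
          rw [e, mul_add]
        · have : ψ x = 0 := by
            by_contra h0
            exact hx (ψ.support_subset_source h0)
          simp [this]
      map_smul' := fun c h => by
        ext x
        show ψ x * chartDeriv p v (c • h) x = c * (ψ x * chartDeriv p v h x)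
        by_cases hx : x ∈ (chartAt F p).source
        · have e : chartDeriv p v (c • h) x = c * chartDeriv p v h x := by
            show fderiv ℝ (c • (h ∘ (extChartAt 𝓘(ℝ, F) p).symm)) _ v = _
            rw [fderiv_const_smul (differentiableAt_comp_extChartAt_symm p h hx)]
            rfl
          rw [e]; ring
        · have : ψ x = 0 := by
            by_contra h0
            exact hx (ψ.support_subset_source h0)
          simp [this] }
    fun h k => by
      ext x
      show ψ x * chartDeriv p v (h * k) x =
        h x * (ψ x * chartDeriv p v k x) + k x * (ψ x * chartDeriv p v h x)
      by_cases hx : x ∈ (chartAt F p).source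
      · have e : chartDeriv p v (h * k) x = h x * chartDeriv p v k x + k x * chartDeriv p v h x := by
          show fderiv ℝ ((h ∘ (extChartAt 𝓘(ℝ, F) p).symm) * (k ∘ (extChartAt 𝓘(ℝ, F) p).symm)) _ v
            = _
          have hs : (extChartAt 𝓘(ℝ, F) p).symm (extChartAt 𝓘(ℝ, F) p x) = x :=
            (extChartAt 𝓘(ℝ, F) p).left_inv (by rwa [extChartAt_source])
          rw [fderiv_mul (differentiableAt_comp_extChartAt_symm p h hx)
            (differentiableAt_comp_extChartAt_symm p k hx)]
          simp only [Function.comp_apply, hs]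
          rfl
        rw [e]; ring
      · have : ψ x = 0 := by
          by_contra h0
          exact hx (ψ.support_subset_source h0)
        simp [this]

/-- A smooth function read in a chart and multiplied by a bump function. -/
theorem contDiff_bump_mul {p : M} (ρ : SmoothBumpFunction 𝓘(ℝ, F) p) (h : SmoothFunctions F M) :
    ContDiff ℝ ∞ fun y => ρ.toContDiffBump y * h ((extChartAt 𝓘(ℝ, F) p).symm y) := by
  rw [contDiff_iff_contDiffAt]
  intro y
  by_cases hy : y ∈ Metric.closedBall (extChartAt 𝓘(ℝ, F) p p) ρ.rOut
  · have ht : y ∈ (extChartAt 𝓘(ℝ, F) p).target := ρ.closedBall_subset ⟨hy, by simp⟩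
    exact ρ.toContDiffBump.contDiffAt.mul ((contDiffOn_comp_extChartAt_symm p h).contDiffAt
      ((isOpen_extChartAt_target p).mem_nhds ht))
  · have hz : (fun y => ρ.toContDiffBump y * h ((extChartAt 𝓘(ℝ, F) p).symm y)) =ᶠ[nhds y]
        fun _ => 0 := by
      filter_upwards [Metric.isClosed_closedBall.isOpen_compl.mem_nhds hy] with z hz
      rw [ρ.toContDiffBump.zero_of_le_dist, zero_mul]
      exact (not_le.1 fun h => hz (Metric.mem_closedBall.2 h)).le
    exact contDiffAt_const.congr_of_eventuallyEq hz

/-- The `f i` are coordinates cut off by `ρ`, the `X i` coordinate fields cut off by `ψ`.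
Derivations are not known beforehand to be sums of coordinate fields; Hadamard's lemma supplies this
at each point `q`. -/
theorem exists_local_frame (p : M) : ∃ (χ : SmoothFunctions F M)
    (f : Fin (finrank ℝ F) → SmoothFunctions F M) (X : Fin (finrank ℝ F) → VectorFields F M),
    χ p ≠ 0 ∧ ∀ Z : VectorFields F M, χ • Z = ∑ i, Z (f i) • X i := by
  obtain ⟨ρ⟩ : Nonempty (SmoothBumpFunction 𝓘(ℝ, F) p) := inferInstance
  -- The outer radius of `ψ` is the inner radius of `ρ`, so that `ρ = 1` wherever `ψ` does not
  -- vanish.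
  let ψ : SmoothBumpFunction 𝓘(ℝ, F) p :=
    { rIn := ρ.rIn / 2
      rOut := ρ.rIn
      rIn_pos := half_pos ρ.rIn_pos
      rIn_lt_rOut := half_lt_self ρ.rIn_pos
      closedBall_subset := (Set.inter_subset_inter_left _
        (Metric.closedBall_subset_closedBall ρ.rIn_lt_rOut.le)).trans ρ.closedBall_subset }
  let b := finBasis ℝ F
  let e := extChartAt 𝓘(ℝ, F) p
  have hψ : ∀ x, ψ x ≠ 0 → x ∈ (chartAt F p).source ∧ e x ∈ Metric.ball (e p) ρ.rIn := by
    intro x hx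
    have : x ∈ Function.support ψ := hx
    rw [ψ.support_eq_inter_preimage] at this
    exact this
  let f : Fin (finrank ℝ F) → SmoothFunctions F M := fun i =>
    bumpMul ρ ((fun y => b.coord i y) ∘ e) (contMDiffOn_comp_extChartAt p
      (LinearMap.toContinuousLinearMap (b.coord i)).contDiff.contDiffOn (Set.subset_univ _))
  have hf : ∀ i x, ψ x ≠ 0 → f i x = b.coord i (e x) := by
    intro i x hx
    show ρ x * b.coord i (e x) = _
    rw [ρ.one_of_dist_le (hψ x hx).1 (hψ x hx).2.le, one_mul]
  let χ : SmoothFunctions F M := ⟨ψ, ψ.contMDiff⟩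
  refine ⟨χ, f, fun i => bumpField ψ (b i), ?_, fun Z => ?_⟩
  · show ψ p ≠ 0
    rw [ψ.eq_one]; exact one_ne_zero
  ext h q
  let evalAt : M → SmoothFunctions F M →+ ℝ := fun x => AddMonoidHom.mk' (fun h => h x)
    fun _ _ => rfl
  let evalField : VectorFields F M →+ ℝ := AddMonoidHom.mk' (fun D => D h q) fun _ _ => rfl
  show ψ q * Z h q = evalField (∑ i, Z (f i) • bumpField ψ (b i))
  rw [map_sum]
  show ψ q * Z h q = ∑ i, Z (f i) q * (ψ q * chartDeriv p (b i) h q)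
  by_cases hq : ψ q = 0
  · simp [hq]
  -- Hadamard's lemma needs a function on the whole of `F`; multiplying by `ρ` extends `h` without
  -- changing it where `ψ` is nonzero.
  obtain ⟨G, hG, hGa, hGy⟩ := exists_contDiff_eq_add_apply_sub (contDiff_bump_mul ρ h) (e q)
  have hloc : ∀ x, x ∈ (chartAt F p).source → e.symm (e x) = x := fun x hx =>
    e.left_inv (by rwa [extChartAt_source])
  have hH : ∀ x, ψ x ≠ 0 → ρ.toContDiffBump (e x) * h (e.symm (e x)) = h x := by
    intro x hx
    rw [hloc x (hψ x hx).1, ρ.toContDiffBump.one_of_mem_closedBall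
      (Metric.ball_subset_closedBall (hψ x hx).2), one_mul]
  have hGq : ∀ v, G (e q) v = chartDeriv p v h q := by
    intro v
    rw [hGa]
    have : (fun y => ρ.toContDiffBump y * h (e.symm y)) =ᶠ[nhds (e q)] h ∘ e.symm := by
      filter_upwards [Metric.isOpen_ball.mem_nhds (hψ q hq).2] with y hy
      rw [ρ.toContDiffBump.one_of_mem_closedBall (Metric.ball_subset_closedBall hy), one_mul]
      rfl
    rw [this.fderiv_eq]
    rfl
  let g : Fin (finrank ℝ F) → SmoothFunctions F M := fun i =>
    bumpMul ψ ((fun y => G y (b i)) ∘ e) (contMDiffOn_comp_extChartAt p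
      (hG.clm_apply contDiff_const).contDiffOn (Set.subset_univ _))
  have key : χ * (h - algebraMap ℝ _ (h q)) = ∑ i, (f i - algebraMap ℝ _ (f i q)) * g i := by
    ext x
    show ψ x * (h x - h q) = evalAt x (∑ i, (f i - algebraMap ℝ _ (f i q)) * g i)
    rw [map_sum]
    show ψ x * (h x - h q) = ∑ i, (f i x - f i q) * (ψ x * G (e x) (b i))
    by_cases hx : ψ x = 0
    · simp [hx]
    · have h1 := hGy (e x)
      rw [hH x hx, hH q hq] at h1
      rw [h1, ← b.sum_repr (e x - e q), map_sum, Finset.mul_sum]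
      refine Finset.sum_congr rfl fun i _ => ?_
      rw [hf i x hx, hf i q hq, map_smul, map_sub, smul_eq_mul, Finsupp.sub_apply]
      simp only [Basis.coord_apply]
      ring
  -- Each product in `key` has a factor that vanishes at `q`, so `Z` only has to differentiate that
  -- factor.
  have h2 := congrArg (fun k => Z k q) key
  simp only [Derivation.leibniz, map_sum, map_sub, Derivation.map_algebraMap, sub_zero] at h2
  replace h2 : ψ q * Z h q + (h q - h q) * Z χ q =
      evalAt q (∑ i, ((f i - algebraMap ℝ _ (f i q)) • Z (g i) + g i • Z (f i))) := h2
  rw [map_sum] at h2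
  replace h2 : ψ q * Z h q + (h q - h q) * Z χ q =
      ∑ i, ((f i q - f i q) * Z (g i) q + (ψ q * G (e q) (b i)) * Z (f i) q) := h2
  simp only [sub_self, zero_mul, add_zero, zero_add, hGq] at h2
  rw [h2]
  exact Finset.sum_congr rfl fun i _ => by ring

/-- The sections of `T*M × ℝ` are locally generated by the twisted differentials of functions. -/
theorem eq_zero_of_dFun_eq_zero
    (T : Dual (SmoothFunctions F M) (VectorFields F M × SmoothFunctions F M)
      →ₗ[SmoothFunctions F M] SmoothFunctions F M)
    (hT : ∀ f, T ((tangentTimes (SmoothFunctions F M)).dFun (cocycleOne _) f) = 0) : T = 0 := by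
  refine LinearMap.ext fun α => ContMDiffMap.ext fun p => ?_
  obtain ⟨χ, f, X, hχ, hX⟩ := exists_local_frame (F := F) p
  -- The twisted differential of the function `1` is the cocycle.
  have hφ : T (cocycleOne (SmoothFunctions F M)) = 0 := by
    rw [← hT 1]
    congr 1
    refine LinearMap.ext fun x => ?_
    rw [tangentTimes_dFun_apply, Derivation.map_one_eq_zero, zero_add, mul_one]
    rfl
  -- Subtracting `f i` times the cocycle from the twisted differential leaves the ordinary
  -- differential of `f i`; together with the cocycle these span the sections near `p`.
  have e : χ • α = ∑ i, α (X i, 0) • ((tangentTimes (SmoothFunctions F M)).dFun (cocycleOne _) (f i)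
      - f i • cocycleOne (SmoothFunctions F M))
      + (χ * α (0, 1)) • cocycleOne (SmoothFunctions F M) := by
    refine LinearMap.ext fun z => ?_
    obtain ⟨Z, h⟩ := z
    have h1 : α (Z, h) = α (Z, 0) + h * α (0, 1) := by
      rw [← smul_eq_mul, ← map_smul, ← map_add]
      simp
    have h2 : χ * α (Z, 0) = ∑ i, Z (f i) * α (X i, 0) := by
      rw [← smul_eq_mul, ← map_smul]
      have : χ • ((Z, 0) : VectorFields F M × SmoothFunctions F M) = ∑ i, Z (f i) • (X i, 0) := by
        refine Prod.ext ?_ ?_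
        · rw [Prod.fst_sum]
          exact hX Z
        · rw [Prod.snd_sum]
          simp
      rw [this, map_sum]
      exact Finset.sum_congr rfl fun i _ => by rw [map_smul, smul_eq_mul]
    simp only [LinearMap.smul_apply, LinearMap.add_apply, LinearMap.sum_apply, LinearMap.sub_apply,
      tangentTimes_dFun_apply, smul_eq_mul]
    rw [h1, mul_add, h2]
    show _ + _ = ∑ i, α (X i, 0) * (Z (f i) + h * f i - f i * h) + χ * α (0, 1) * h
    congr 1
    · exact Finset.sum_congr rfl fun i _ => by ring
    · ring
  have h3 := congrArg T e
  rw [map_smul, map_add, map_sum, map_smul, hφ, smul_zero, add_zero,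
    Finset.sum_eq_zero fun i _ => by rw [map_smul, map_sub, map_smul, hT, hφ]; simp] at h3
  have h4 : χ p * T α p = 0 := congrArg (fun k : SmoothFunctions F M => k p) h3
  exact (mul_eq_zero.1 h4).resolve_left hχ

end Frame

end

end JacobiGeom

end

/-! ### The equivalence on a manifold -/

theorem mainTheorem5
    {F : Type*} [NormedAddCommGroup F] [NormedSpace ℝ F] [FiniteDimensional ℝ F]
    {M : Type*} [TopologicalSpace M] [ChartedSpace F M] [IsManifold 𝓘(ℝ, F) ∞ M]
    [T2Space M] [SecondCountableTopology M]
    (Λ : JacobiGeom.Bivector (JacobiGeom.SmoothFunctions F M) (JacobiGeom.VectorFields F M))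
    (E : JacobiGeom.VectorFields F M)
    (hJacobi : JacobiGeom.IsJacobiStructure Λ E)
    (N : JacobiGeom.VectorFields F M →ₗ[JacobiGeom.SmoothFunctions F M]
      JacobiGeom.VectorFields F M)
    (Y : JacobiGeom.VectorFields F M)
    (γ : Module.Dual (JacobiGeom.SmoothFunctions F M) (JacobiGeom.VectorFields F M))
    (g : JacobiGeom.SmoothFunctions F M)
    (ω₂ : JacobiGeom.VectorFields F M [⋀^Fin 2]→ₗ[JacobiGeom.SmoothFunctions F M]
      JacobiGeom.SmoothFunctions F M) :
    JacobiGeom.IsJacobiQuasiNijenhuis Λ E (JacobiGeom.pairMap N Y γ g) ω₂ ↔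
      JacobiGeom.IsQuasiJacobiBialgebroid (JacobiGeom.jacobiDual Λ E) (-E, 0)
        (((JacobiGeom.tangentTimes (JacobiGeom.SmoothFunctions F M)).deform
          (JacobiGeom.pairMap N Y γ g)).twistedD (JacobiGeom.pairOneForm γ g))
        (JacobiGeom.threeFormOf ω₂) :=
  JacobiGeom.isJacobiQuasiNijenhuis_iff JacobiGeom.eq_zero_of_dFun_eq_zero Λ E hJacobi N Y γ g ω₂
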